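/- **Model.** A radio network is a connected undirected graph $G=(V,E)$ with $n=|V|$ nodes and diameter $D$. Communication takes place in synchronous rounds; in each round every node either listens or transmits a packet of $O(\log n)$ bits. A listening node receives a packet if and only if exactly one of its neighbours transmits (no collision detection). All nodes run the same randomized program with private, independent coin flips, and start simultaneously; initially a node knows only whether it is the given source $s$, a number $L$ with $\log_2 n\le L\le \kappa\log_2 n$, and a number $\hat D$ with $D/\kappa\le \hat D\le \kappa D$, where $\kappa\ge 1$ is an arbitrary constant. Nodes pick their own identifiers of $O(\log n)$ bits. **Layerings.** A layering of $G$ assigns to each node $u$ an integer $\ell(u)$ such that exactly one node (the source) has $\ell=0$ and every other node $u$ has a neighbour $v$ with $\ell(v)<\ell(u)$; its depth is $\max_u \ell(u)$. Together with a colouring $c:V\to\{0,\dots,C-1\}$ it is $C$-collision-free if $c(u)\ne c(v)$ whenever $\ell(u)\neq\ell(v)$ and $\mathrm{dist}_G(u,v)\le 2$. A pseudo-BFS layering is an $O(1)$-collision-free layering of depth $O(D+\log n)$. An algorithm constructs such a layering from $s$ if all nodes terminate, the identifiers are distinct, $\ell(s)=0$, each node knows $C$ and its own $\ell(u)$ and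 $c(u)$, and each $u\ne s$ knows the identifier of a neighbour $v$ with $\ell(v)<\ell(u)$. **Theorem.** There is a distributed randomized algorithm that constructs, w.h.p., a pseudo-BFS layering from a given source node $s$ in $$O\!\left(D\left(1+\log\tfrac nD\right)+\log^3 n\right)$$ rounds. That is: there is an absolute constant $C$ such that for all constants $\kappa\ge 1$ and $\beta\ge 2$ there are a constant $a$ and an algorithm (both depending only on $\kappa$ and $\beta$) with packets and identifiers of $O(\log n)$ bits, such that on every connected graph $G$, for every source $s$ and all admissible $L,\hat D$, with probability at least $1-n^{-\beta}$ all nodes have terminated after at most $a\,(D(1+\log_2\frac nD)+\log_2^3 n)$ rounds and their outputs form a $C$-collision-free layering with source $s$ of depth at most $a\,(D+\log_2 n)$. (For $n=1$, where $D=0$, the term $D(1+\log_2\frac nD)$ is read as $0$.) -/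

import Mathlib

/-! ### The radio network model

Synchronous rounds, no collision detection, anonymous nodes that all run the same program and
start together.  Local computation is unrestricted; topology is unknown to the nodes. -/

/-- Bit strings of length at most `b`. They serve as packets and as node identifiers. -/
abbrev BitString (b : ℕ) : Type := { p : List Bool // p.length ≤ b }

/-- A randomized program for the nodes of a radio network, with packets of at most `b` bits and
local results in `Out`. In every round a node flips `coins` fresh fair coins, and from its state
and these coins it either transmits a packet (`act = some p`) or listens (`act = none`); it then
updates its state from the packet it has received, if any.
A node terminates as soon as `out` yields a result. -/
structure RadioProtocol (b : ℕ) (Out : Type) where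
  /-- the local states -/
  State : Type
  /-- the number of coins flipped by a node in a round -/
  coins : ℕ
  /-- the initial state; the only input is whether the node is the given source -/
  init : Bool → State
  /-- transmit a packet or listen -/
  act : State → (Fin coins → Bool) → Option (BitString b)
  /-- the state after the round, from the old state, the coins, and what has been received -/
  next : State → (Fin coins → Bool) → Option (BitString b) → State
  /-- the result of a terminated node -/
  out : State → Option Out

open Classical in
/-- What node `v` receives if every node `u` transmits `x u` (`none`: listens): a listening node
with exactly one transmitting neighbour receives that neighbour's packet, and every other node
receives nothing. -/
noncomputable def radioReceive {V M : Type*} (G : SimpleGraph V) (x : V → Option M) (v : V) :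
    Option M :=
  if h : x v = none ∧ ∃! u, G.Adj v u ∧ (x u).isSome then x h.2.exists.choose else none

namespace RadioProtocol

variable {b : ℕ} {Out : Type} {V : Type*}

/-- What node `v` transmits in a round that starts in configuration `σ` and in which node `u`
flips the coins `ω u`. A terminated node is silent. -/
def transmission (P : RadioProtocol b Out) (σ : V → P.State) (ω : V → Fin P.coins → Bool) (v : V) :
    Option (BitString b) :=
  if (P.out (σ v)).isSome then none else P.act (σ v) (ω v)

/-- One round. A terminated node no longer changes its state. -/
noncomputable def step (P : RadioProtocol b Out) (G : SimpleGraph V) (σ : V → P.State)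
    (ω : V → Fin P.coins → Bool) (v : V) : P.State :=
  if (P.out (σ v)).isSome then σ v
  else P.next (σ v) (ω v) (radioReceive G (P.transmission σ ω) v)

open Classical in
/-- The configuration after `t` rounds on `G` with source `s`, where `ω i v` are the coins flipped
by node `v` in round `i`. -/
noncomputable def run (P : RadioProtocol b Out) (G : SimpleGraph V) (s : V) :
    (t : ℕ) → (Fin t → V → Fin P.coins → Bool) → V → P.State
  | 0, _ => fun v => P.init (decide (v = s))
  | t + 1, ω => P.step G (run P G s t (fun i => ω i.castSucc)) (ω (Fin.last t))

/-- The probability that the configuration after `t` rounds lies in `E`; all coins flipped in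
these rounds are fair and independent. -/
noncomputable def prob [Fintype V] (P : RadioProtocol b Out) (G : SimpleGraph V) (s : V) (t : ℕ)
    (E : Set (V → P.State)) : ℝ :=
  (Nat.card { ω : Fin t → V → Fin P.coins → Bool // P.run G s t ω ∈ E } : ℝ) /
    Nat.card (Fin t → V → Fin P.coins → Bool)

end RadioProtocol

/-! ### Layerings -/

section Layerings

variable {V : Type*}

/-- `ℓ` is a layering of `G`: exactly one node (the source) has layer number `0`, and every other
node has a neighbour with a smaller layer number. -/
def IsLayering (G : SimpleGraph V) (ℓ : V → ℤ) : Prop :=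
  (∃! s, ℓ s = 0) ∧ ∀ u, ℓ u ≠ 0 → ∃ v, G.Adj u v ∧ ℓ v < ℓ u

/-- The depth of a layering: its largest layer number. -/
noncomputable def layeringDepth (ℓ : V → ℤ) : ℤ := ⨆ u, ℓ u

/-- A layering `ℓ` with a colouring `c` by `C` colours is `C`-collision-free: nodes in different
layers at distance at most `2` have different colours. -/
def IsCollisionFree {C : ℕ} (G : SimpleGraph V) (ℓ : V → ℤ) (c : V → Fin C) : Prop :=
  ∀ u v, ℓ u ≠ ℓ v → G.edist u v ≤ 2 → c u ≠ c v

/-- What a node knows at the end of a distributed layering algorithm with `C` colours: its own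
identifier (chosen by itself), its layer number, its colour, and the identifier of its parent
(which the source does not need). -/
structure LayerOutput (b C : ℕ) where
  /-- the identifier of the node -/
  id : BitString b
  /-- the layer number -/
  layer : ℤ
  /-- the colour -/
  color : Fin C
  /-- the identifier of the parent -/
  parent : Option (BitString b)

/-- The local results `o` form a `C`-collision-free layering of `G` with source `s` and depth at
most `B`, in the distributed sense: identifiers are distinct, and every node other than the source
knows the identifier of a neighbour with a smaller layer number. -/
structure IsDistributedLayering {b C : ℕ} (G : SimpleGraph V) (s : V) (B : ℝ)
    (o : V → LayerOutput b C) : Prop where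
  id_injective : Function.Injective fun v => (o v).id
  layering : IsLayering G fun v => (o v).layer
  source : (o s).layer = 0
  parent : ∀ u, u ≠ s →
    ∃ v, G.Adj u v ∧ (o v).layer < (o u).layer ∧ (o u).parent = some (o v).id
  collisionFree : IsCollisionFree G (fun v => (o v).layer) fun v => (o v).color
  depth_le : (layeringDepth fun v => (o v).layer : ℝ) ≤ B

end Layerings

/-! The engine is a flood that adapts to degrees. In a phase of length `l` the active nodes transmit
with probabilities `1/2, …, 2^(-l)`; a node of degree below `2^l` with an active neighbour is then
informed with constant probability. Phases of length `L` throughout would cost `D log n`. Instead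
phase `m` has length `min L (lam + v₂(m))`, and full length only if `2^q ∣ m`. The average length is
`lam + O(1)` (`length_flood_le'`), and a node of degree class `e` is still served in every phase
divisible by its delay `wt = 2^min(e - lam, q)` (`le_phaseLen`). Passing a node thus takes `O(wt)`
phases. On a shortest path the delays sum to `O(D)` once `2^lam ≥ n / D`: every node has at most
three neighbours on the path, so the degrees along it sum to at most `3n` (`sum_degree_shortest_le`,
`exists_cheap_walk`). An exponential potential gives the high-probability bound
(`pow_mul_failProb_flood_le`).

The right `lam` is unknown, so `1, 2, 4, …` are tried, and the geometric sum of their costs is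
dominated by the last one needed. A bad value has to be detected by all nodes together. For this an
informed node waits for its own delay before it transmits; then the time at which a node is informed
bounds the cost of a walk to the origin with certainty (`FloodInv.exists_walk`). If some node is
more expensive than `M₁`, there is one only slightly more expensive (`exists_walk_moderate`); it is
certainly uninformed, and its alarm flood reaches the source. If all nodes are cheap, all are
informed and no alarm is raised. In between either verdict is harmless, since the later flood is
long enough (`triple_attempt`).

The times of a flood already define a layering, but nearby nodes may have very different times. So
time is cut into slabs of `X` phases. With high probability a flood advances by at least `ρ ≥ 2`
hops during each slab (`failProb_thick_le`), and every node of slab `j + 1` is within `X` hops of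
slab `j`. Breadth-first searches to depth `X` run from all slabs; those with congruent indices
modulo `md` run simultaneously, being too far apart to interfere (`Bfs.eq_of_receive`). A node takes
the least index `j` with distance at most `X` and the layer `j * (X + 1) + distance`. Nodes at
distance at most two have indices differing by at most one and distances to a common slab differing
by at most two, so the parity of the index and the distance modulo three make a valid colouring with
six colours (`Timing.color_ne`).

The searches cost `O(4^q L^3)`. If `D < L^5`, then `q = 0` and the flood is the ordinary one; its
cost `D L` is affordable because `log n` and `log (n / D)` are then comparable. If `D ≥ L^5`, then
`2^q` is about `L` and the searches cost `O(L^5) = O(D)`.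

Probabilities are computed for straight-line programs by averaging round by round. All nodes
terminate in the same round, so frozen nodes never interact with running ones. -/

namespace RadioLayering

open Finset
open scoped BigOperators

/-! ### Straight-line programs and their expectation semantics -/

/-- One round of a straight-line program: a node in state `s` with `tx s = some m` transmits `m`
with probability `2 ^ (-dens)`, and then updates its state. -/
structure Instr (c : ℕ) (S M : Type) where
  /-- the transmission probability is `2 ^ (-dens)` -/
  dens : ℕ
  /-- the packet to be transmitted, if any -/
  tx : S → Option M
  /-- the update of the state -/
  upd : S → (Fin c → Bool) → Option M → S

section Semantics

variable {c : ℕ} {S M : Type} {V : Type*}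

/-- The packets sent in a round with coins `ω`. -/
def sent (i : Instr c S M) (σ : V → S) (ω : V → Fin c → Bool) (u : V) : Option M :=
  if ∀ k : Fin c, (k : ℕ) < i.dens → ω u k = true then i.tx (σ u) else none

/-- One round of a straight-line program. -/
noncomputable def step (G : SimpleGraph V) (i : Instr c S M) (σ : V → S)
    (ω : V → Fin c → Bool) (v : V) : S :=
  i.upd (σ v) (ω v) (radioReceive G (sent i σ ω) v)

/-- One round in which the nodes with `done` are frozen and silent. -/
noncomputable def gstep (done : S → Bool) (G : SimpleGraph V) (i : Instr c S M) (σ : V → S)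
    (ω : V → Fin c → Bool) (v : V) : S :=
  if done (σ v) then σ v
  else i.upd (σ v) (ω v)
    (radioReceive G (fun u => if done (σ u) then none else sent i σ ω u) v)

/-- `σ'` can be reached from `σ` by running `p`. -/
def Reach (G : SimpleGraph V) : List (Instr c S M) → (V → S) → (V → S) → Prop
  | [], σ, σ' => σ' = σ
  | i :: p, σ, σ' => ∃ ω : V → Fin c → Bool, Reach G p (step G i σ ω) σ'

variable {G : SimpleGraph V}

theorem Reach.append {p q : List (Instr c S M)} {σ σ' : V → S} (h : Reach G (p ++ q) σ σ') :
    ∃ τ, Reach G p σ τ ∧ Reach G q τ σ' := by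
  induction p generalizing σ with
  | nil => exact ⟨σ, rfl, h⟩
  | cons i p ih =>
    obtain ⟨ω, h⟩ := h
    obtain ⟨τ, h1, h2⟩ := ih h
    exact ⟨τ, ⟨ω, h1⟩, h2⟩

/-- Facts that hold for every outcome of the coins are proved along `Reach`, so they cost no failure
probability. -/
theorem Reach.invariant {p : List (Instr c S M)} {I : (V → S) → Prop}
    (hI : ∀ i ∈ p, ∀ σ ω, I σ → I (step G i σ ω)) {σ σ' : V → S} (h : Reach G p σ σ')
    (h0 : I σ) : I σ' := by
  induction p generalizing σ with
  | nil => exact h.symm ▸ h0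
  | cons i p ih =>
    obtain ⟨ω, h⟩ := h
    exact ih (fun j hj => hI j (by simp [hj])) h (hI i (by simp) σ ω h0)

theorem gstep_eq_step {done : S → Bool} {i : Instr c S M} {σ : V → S} {ω : V → Fin c → Bool}
    (h : ∀ v, done (σ v) = false) : gstep done G i σ ω = step G i σ ω := by
  funext v
  simp [gstep, step, h]

variable [Fintype V] [DecidableEq V]

/-- The expectation of `f` after the program `p` has been run from a configuration. -/
noncomputable def ex (G : SimpleGraph V) :
    List (Instr c S M) → ((V → S) → ℝ) → (V → S) → ℝ
  | [], f, σ => f σ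
  | i :: p, f, σ => 𝔼 ω : V → Fin c → Bool, ex G p f (step G i σ ω)

/-- The expectation of `f` after `p`, where nodes with `done` are frozen and silent. -/
noncomputable def gex (done : S → Bool) (G : SimpleGraph V) :
    List (Instr c S M) → ((V → S) → ℝ) → (V → S) → ℝ
  | [], f, σ => f σ
  | i :: p, f, σ => 𝔼 ω : V → Fin c → Bool, gex done G p f (gstep done G i σ ω)

theorem ex_append (p q : List (Instr c S M)) (f : (V → S) → ℝ) (σ : V → S) :
    ex G (p ++ q) f σ = ex G p (ex G q f) σ := by
  induction p generalizing σ with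
  | nil => rfl
  | cons i p ih => simp only [List.cons_append, ex, ih]

theorem gex_append (done : S → Bool) (p q : List (Instr c S M)) (f : (V → S) → ℝ) (σ : V → S) :
    gex done G (p ++ q) f σ = gex done G p (gex done G q f) σ := by
  induction p generalizing σ with
  | nil => rfl
  | cons i p ih => simp only [List.cons_append, gex, ih]

/-- Only reachable final configurations enter the average. This is how deterministic invariants are
combined with probabilistic bounds. -/
theorem ex_mono {p : List (Instr c S M)} {f g : (V → S) → ℝ} {σ : V → S}
    (h : ∀ σ', Reach G p σ σ' → f σ' ≤ g σ') : ex G p f σ ≤ ex G p g σ := by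
  induction p generalizing σ with
  | nil => exact h σ rfl
  | cons i p ih => exact expect_le_expect fun ω _ => ih fun σ' h' => h σ' ⟨ω, h'⟩

theorem ex_const (p : List (Instr c S M)) (a : ℝ) (σ : V → S) : ex G p (fun _ => a) σ = a := by
  induction p generalizing σ with
  | nil => rfl
  | cons i p ih => simp only [ex, ih, Fintype.expect_const]

theorem ex_le {p : List (Instr c S M)} {f : (V → S) → ℝ} {σ : V → S} {a : ℝ}
    (h : ∀ σ', Reach G p σ σ' → f σ' ≤ a) : ex G p f σ ≤ a :=
  (ex_mono h).trans_eq (ex_const p a σ)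

theorem ex_nonneg {p : List (Instr c S M)} {f : (V → S) → ℝ} {σ : V → S}
    (h : ∀ σ', 0 ≤ f σ') : 0 ≤ ex G p f σ :=
  (ex_const p 0 σ).symm.trans_le (ex_mono fun σ' _ => h σ')

theorem ex_add (p : List (Instr c S M)) (f g : (V → S) → ℝ) (σ : V → S) :
    ex G p (fun τ => f τ + g τ) σ = ex G p f σ + ex G p g σ := by
  induction p generalizing σ with
  | nil => rfl
  | cons i p ih => simp only [ex, ih, expect_add_distrib]

theorem ex_const_mul (p : List (Instr c S M)) (a : ℝ) (f : (V → S) → ℝ) (σ : V → S) :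
    ex G p (fun τ => a * f τ) σ = a * ex G p f σ := by
  induction p generalizing σ with
  | nil => rfl
  | cons i p ih => simp only [ex, ih, mul_expect]

theorem ex_sum {ι : Type*} (s : Finset ι) (p : List (Instr c S M)) (f : ι → (V → S) → ℝ)
    (σ : V → S) : ex G p (fun τ => ∑ j ∈ s, f j τ) σ = ∑ j ∈ s, ex G p (f j) σ := by
  induction p generalizing σ with
  | nil => rfl
  | cons i p ih => simp only [ex, ih, expect_sum_comm]

/-! ### Hoare triples with a failure probability -/

open Classical in
/-- The probability that `Q` fails after running `p`. -/
noncomputable def failProb (G : SimpleGraph V) (p : List (Instr c S M)) (Q : (V → S) → Prop)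
    (σ : V → S) : ℝ :=
  ex G p (fun τ => if Q τ then 0 else 1) σ

/-- From every configuration with `P`, the program `p` establishes `Q` up to a failure probability
of at most `ε`. -/
def Triple (G : SimpleGraph V) (p : List (Instr c S M)) (P Q : (V → S) → Prop) (ε : ℝ) : Prop :=
  ∀ σ, P σ → failProb G p Q σ ≤ ε

theorem failProb_nonneg (p : List (Instr c S M)) (Q : (V → S) → Prop) (σ : V → S) :
    0 ≤ failProb G p Q σ :=
  ex_nonneg fun σ' => by split_ifs <;> norm_num

theorem failProb_le_one (p : List (Instr c S M)) (Q : (V → S) → Prop) (σ : V → S) :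
    failProb G p Q σ ≤ 1 :=
  ex_le fun σ' _ => by split_ifs <;> norm_num

theorem failProb_mono {p : List (Instr c S M)} {Q R : (V → S) → Prop} {σ : V → S}
    (h : ∀ τ, Reach G p σ τ → Q τ → R τ) : failProb G p R σ ≤ failProb G p Q σ :=
  ex_mono fun τ hτ => by
    have := h τ hτ
    by_cases hQ : Q τ
    · simp [hQ, this hQ]
    · by_cases hR : R τ <;> simp [hQ, hR]

theorem failProb_eq_zero {p : List (Instr c S M)} {Q : (V → S) → Prop} {σ : V → S}
    (h : ∀ τ, Reach G p σ τ → Q τ) : failProb G p Q σ = 0 :=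
  le_antisymm (ex_le fun τ hτ => by simp [h τ hτ]) (failProb_nonneg _ _ _)

/-- Union bound: where `Q` is missed, the failure of `q` is bounded by one; elsewhere it is at most
`ε`. -/
theorem failProb_append_le {p q : List (Instr c S M)} {Q R : (V → S) → Prop} {σ : V → S} {ε : ℝ}
    (hε : 0 ≤ ε) (h : ∀ τ, Reach G p σ τ → Q τ → failProb G q R τ ≤ ε) :
    failProb G (p ++ q) R σ ≤ failProb G p Q σ + ε := by
  classical
  have : failProb G (p ++ q) R σ ≤ ex G p (fun τ => (if Q τ then 0 else 1) + ε) σ := by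
    rw [failProb, ex_append]
    refine ex_mono fun τ hτ => ?_
    split_ifs with hQ
    · rw [zero_add]; exact h τ hτ hQ
    · exact (failProb_le_one q R τ).trans (by linarith)
  rwa [ex_add, ex_const] at this

theorem Triple.seq {p q : List (Instr c S M)} {P Q R : (V → S) → Prop} {ε δ : ℝ}
    (h1 : Triple G p P Q ε) (h2 : Triple G q Q R δ) (hδ : 0 ≤ δ) :
    Triple G (p ++ q) P R (ε + δ) := fun σ hσ =>
  (failProb_append_le hδ fun τ _ hτ => h2 τ hτ).trans (by linarith [h1 σ hσ])

theorem Triple.weaken {p : List (Instr c S M)} {P P' Q Q' : (V → S) → Prop} {ε ε' : ℝ}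
    (h : Triple G p P Q ε) (hP : ∀ σ, P' σ → P σ) (hQ : ∀ σ, Q σ → Q' σ) (hε : ε ≤ ε') :
    Triple G p P' Q' ε' := fun σ hσ =>
  (failProb_mono fun τ _ => hQ τ).trans ((h σ (hP σ hσ)).trans hε)

theorem Triple.of_reach {p : List (Instr c S M)} {P Q : (V → S) → Prop}
    (h : ∀ σ τ, P σ → Reach G p σ τ → Q τ) : Triple G p P Q 0 := fun σ hσ =>
  (failProb_eq_zero fun τ hτ => h σ τ hσ hτ).le

theorem Triple.and {p : List (Instr c S M)} {P Q R : (V → S) → Prop} {ε δ : ℝ}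
    (h1 : Triple G p P Q ε) (h2 : Triple G p P R δ) :
    Triple G p P (fun σ => Q σ ∧ R σ) (ε + δ) := fun σ hσ => by
  classical
  have : failProb G p (fun σ => Q σ ∧ R σ) σ ≤
      ex G p (fun τ => (if Q τ then 0 else 1) + (if R τ then 0 else 1)) σ := by
    refine ex_mono fun τ _ => ?_
    by_cases hQ : Q τ <;> by_cases hR : R τ <;> simp [hQ, hR]
  rw [ex_add] at this
  exact this.trans (add_le_add (h1 σ hσ) (h2 σ hσ))

theorem failProb_forall_le {ι : Type*} [Fintype ι] {p : List (Instr c S M)}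
    {Q : ι → (V → S) → Prop} {σ : V → S} {ε : ℝ} (h : ∀ j, failProb G p (Q j) σ ≤ ε) :
    failProb G p (fun τ => ∀ j, Q j τ) σ ≤ Fintype.card ι * ε := by
  classical
  have : failProb G p (fun τ => ∀ j, Q j τ) σ ≤
      ex G p (fun τ => ∑ j, if Q j τ then 0 else 1) σ := by
    refine ex_mono fun τ _ => ?_
    split_ifs with hQ
    · exact sum_nonneg fun j _ => by split_ifs <;> norm_num
    · push Not at hQ
      obtain ⟨j, hj⟩ := hQ
      calc (1 : ℝ) = if Q j τ then 0 else 1 := by simp [hj]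
        _ ≤ _ := single_le_sum (f := fun j => if Q j τ then (0 : ℝ) else 1)
          (fun j _ => by split_ifs <;> norm_num) (mem_univ j)
  refine this.trans ?_
  rw [ex_sum]
  calc _ ≤ ∑ _j : ι, ε := sum_le_sum fun j _ => h j
    _ = _ := by simp

open Classical in
/-- If `Q` is never lost and a run of `p` fails to establish it with probability at most `δ`, then
`N` runs fail with probability at most `δ ^ N`. -/
theorem failProb_replicate_le {p : List (Instr c S M)} {I Q : (V → S) → Prop} {δ : ℝ}
    (hδ : 0 ≤ δ) (hI : ∀ σ τ, I σ → Reach G p σ τ → I τ)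
    (hQ : ∀ σ τ, I σ → Q σ → Reach G p σ τ → Q τ)
    (h : ∀ σ, I σ → ¬ Q σ → failProb G p Q σ ≤ δ) (N : ℕ) (σ : V → S) (hσ : I σ) :
    failProb G (List.replicate N p).flatten Q σ ≤ if Q σ then 0 else δ ^ N := by
  induction N generalizing σ with
  | zero => simp [failProb, ex]
  | succ N ih =>
    -- The induction bound vanishes where `Q` already holds, so the remaining runs count only if the
    -- first one has failed.
    have key : failProb G (List.replicate (N + 1) p).flatten Q σ ≤
        δ ^ N * failProb G p Q σ := by
      rw [List.replicate_succ, List.flatten_cons, failProb, ex_append, failProb, ← ex_const_mul]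
      refine ex_mono fun τ hτ => (ih τ (hI σ τ hσ hτ)).trans ?_
      split_ifs <;> simp
    split_ifs with hq
    · rw [failProb_eq_zero (p := p) fun τ hτ => hQ σ τ hσ hq hτ, mul_zero] at key
      exact key
    · rw [pow_succ]
      exact key.trans (mul_le_mul_of_nonneg_left (h σ hσ hq) (pow_nonneg hδ N))

/-! ### Frozen nodes -/

/-- On configurations without frozen nodes, a program that freezes no node before its last round
has the same expectations in both semantics. -/
theorem gex_eq_ex {done : S → Bool} {p : List (Instr c S M)} {f : (V → S) → ℝ} {σ : V → S}
    (hp : ∀ i ∈ p, ∀ s x r, done s = false → done (i.upd s x r) = false)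
    (h : ∀ v, done (σ v) = false) : gex done G p f σ = ex G p f σ := by
  induction p generalizing σ with
  | nil => rfl
  | cons i p ih =>
    refine expect_congr rfl fun ω _ => ?_
    rw [gstep_eq_step h]
    exact ih (fun j hj => hp j (by simp [hj])) fun v => hp i (by simp) _ _ _ (h v)

/-- This makes the rest of the program, with its larger values of `lam`, harmless after success. -/
theorem gex_of_done {done : S → Bool} (p : List (Instr c S M)) {f : (V → S) → ℝ} {σ : V → S}
    (h : ∀ v, done (σ v) = true) : gex done G p f σ = f σ := by
  induction p with
  | nil => rfl
  | cons i p ih =>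
    have : ∀ ω, gstep done G i σ ω = σ := fun ω => by funext v; simp [gstep, h]
    simp [gex, this, ih]

theorem gex_le {done : S → Bool} {p : List (Instr c S M)} {f g : (V → S) → ℝ} {σ : V → S}
    (h : ∀ σ', f σ' ≤ g σ') : gex done G p f σ ≤ gex done G p g σ := by
  induction p generalizing σ with
  | nil => exact h σ
  | cons i p ih => exact expect_le_expect fun ω _ => ih

theorem gex_const (done : S → Bool) (p : List (Instr c S M)) (a : ℝ) (σ : V → S) :
    gex done G p (fun _ => a) σ = a := by
  induction p generalizing σ with
  | nil => rfl
  | cons i p ih => simp only [gex, ih, Fintype.expect_const]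

end Semantics

/-! ### From programs to protocols -/

section Protocol

variable {c b : ℕ} {S M Out : Type} {V : Type*}

/-- The idle round. -/
def nop : Instr c S M := ⟨0, fun _ => none, fun s _ _ => s⟩

/-- The protocol that executes a straight-line program; a packet `m` is sent as `enc m`. -/
@[reducible] def toProtocol (prog : List (Instr c S M)) (init : Bool → S) (res : S → Option Out)
    (enc : M → BitString b) (dec : BitString b → Option M) : RadioProtocol b Out where
  State := ℕ × S
  coins := c
  init x := (0, init x)
  act st x :=
    if ∀ k : Fin c, (k : ℕ) < (prog.getD st.1 nop).dens → x k = true then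
      ((prog.getD st.1 nop).tx st.2).map enc else none
  next st x r := (st.1 + 1, (prog.getD st.1 nop).upd st.2 x (r.bind dec))
  out st := res st.2

theorem radioReceive_map {M' : Type*} (G : SimpleGraph V) (x : V → Option M) (e : M → M') (v : V) :
    radioReceive G (fun u => (x u).map e) v = (radioReceive G x v).map e := by
  unfold radioReceive
  by_cases h : x v = none ∧ ∃! u, G.Adj v u ∧ (x u).isSome
  · have h' : (x v).map e = none ∧ ∃! u, G.Adj v u ∧ ((x u).map e).isSome := by simpa using h
    rw [dif_pos h, dif_pos h']
    -- The two choices of a transmitter come from different existence proofs; uniqueness identifies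
    -- them.
    have := h.2.unique h.2.exists.choose_spec
      (y₂ := h'.2.exists.choose) (by simpa using h'.2.exists.choose_spec)
    rw [← this]
  · have h' : ¬ ((x v).map e = none ∧ ∃! u, G.Adj v u ∧ ((x u).map e).isSome) := by simpa using h
    rw [dif_neg h, dif_neg h']
    rfl

/-- The round counter of a terminated node stops, so the counters agree with `t` only at running
nodes; these are the only nodes that look at it. -/
theorem toProtocol_step {prog : List (Instr c S M)} {init : Bool → S} {res : S → Option Out}
    {enc : M → BitString b} {dec : BitString b → Option M} (hdec : ∀ m, dec (enc m) = some m)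
    (G : SimpleGraph V) (t : ℕ) (σ : V → ℕ × S)
    (hσ : ∀ v, (res (σ v).2).isSome = false → (σ v).1 = t) (ω : V → Fin c → Bool) (v : V) :
    (((toProtocol prog init res enc dec).step G σ ω v).2 =
      gstep (fun s => (res s).isSome) G (prog.getD t nop) (fun v => (σ v).2) ω v) ∧
    ((res (gstep (fun s => (res s).isSome) G (prog.getD t nop) (fun v => (σ v).2) ω v)).isSome
        = false →
      ((toProtocol prog init res enc dec).step G σ ω v).1 = t + 1) := by
  have htr : (toProtocol prog init res enc dec).transmission σ ω = fun u =>
      ((if (res (σ u).2).isSome then none else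
        sent (prog.getD t nop) (fun v => (σ v).2) ω u : Option M)).map enc := by
    funext u
    unfold RadioProtocol.transmission
    by_cases hu : (res (σ u).2).isSome = true
    · simp [hu]
    · simp only [sent, hσ u (by simpa using hu)]
      simp only [hu]
      split_ifs <;> simp
  unfold RadioProtocol.step
  rw [htr]
  simp only [radioReceive_map]
  by_cases hv : (res (σ v).2).isSome = true
  · simp [gstep, hv]
  · have := hσ v (by simpa using hv)
    have hb : ∀ x : Option M, (x.map enc).bind dec = x := by
      rintro (_ | m) <;> simp [hdec]
    simp [gstep, hv, this, hb]

variable [Fintype V] [DecidableEq V]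

/-- The averaging operator of one round of a protocol. -/
noncomputable def avg (P : RadioProtocol b Out) (G : SimpleGraph V) (f : (V → P.State) → ℝ)
    (σ : V → P.State) : ℝ :=
  𝔼 ω : V → Fin P.coins → Bool, f (P.step G σ ω)

-- The coins of the last round are independent of the earlier ones, so the last round can be
-- averaged first. This turns `f` into `avg P G f` and leaves `t` rounds.
open Classical in
theorem expect_run (P : RadioProtocol b Out) (G : SimpleGraph V) (s : V) (t : ℕ)
    (f : (V → P.State) → ℝ) :
    𝔼 ω : Fin t → V → Fin P.coins → Bool, f (P.run G s t ω) =
      (avg P G)^[t] f fun v => P.init (decide (v = s)) := by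
  induction t generalizing f with
  | zero =>
    simp only [RadioProtocol.run, Fintype.expect_const, Function.iterate_zero, id]
    congr!
  | succ t ih =>
    rw [Function.iterate_succ_apply, ← ih]
    unfold avg
    rw [← expect_product' (s := univ) (t := univ)
      (f := fun (ω : Fin t → V → Fin P.coins → Bool) (x : V → Fin P.coins → Bool) =>
        f (P.step G (P.run G s t ω) x)), univ_product_univ]
    refine (Fintype.expect_equiv
      ((Equiv.prodComm _ _).trans
        (Fin.snocEquiv fun _ : Fin (t + 1) => V → Fin P.coins → Bool)) _ _ fun x => ?_).symm
    simp [RadioProtocol.run, Fin.snocEquiv]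

open Classical in
theorem prob_eq (P : RadioProtocol b Out) (G : SimpleGraph V) (s : V) (t : ℕ)
    (E : Set (V → P.State)) :
    P.prob G s t E =
      1 - (avg P G)^[t] (fun σ => if σ ∈ E then 0 else 1) fun v => P.init (decide (v = s)) := by
  rw [← expect_run]
  have h1 : P.prob G s t E = 𝔼 ω : Fin t → V → Fin P.coins → Bool,
      if P.run G s t ω ∈ E then (1 : ℝ) else 0 := by
    rw [Fintype.expect_eq_sum_div_card, RadioProtocol.prob, sum_boole, Nat.card_eq_fintype_card,
      Nat.card_eq_fintype_card, Fintype.card_subtype]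
  have h2 : (𝔼 ω : Fin t → V → Fin P.coins → Bool, if P.run G s t ω ∈ E then (1 : ℝ) else 0) +
      𝔼 ω : Fin t → V → Fin P.coins → Bool, (if P.run G s t ω ∈ E then (0 : ℝ) else 1) = 1 := by
    rw [← expect_add_distrib, ← Fintype.expect_one (M := ℝ)
      (ι := Fin t → V → Fin P.coins → Bool)]
    exact expect_congr rfl fun ω _ => by split_ifs <;> simp
  rw [h1]
  linarith

/-- The outermost average belongs to the first round. For the induction, `l` is the segment of the
program that starts at position `t`. -/
theorem avg_iterate {prog : List (Instr c S M)} {init : Bool → S} {res : S → Option Out}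
    {enc : M → BitString b} {dec : BitString b → Option M} (hdec : ∀ m, dec (enc m) = some m)
    (G : SimpleGraph V) (l : List (Instr c S M)) (f : (V → S) → ℝ) (t : ℕ)
    (hl : ∀ k (hk : k < l.length), prog.getD (t + k) nop = l[k]) (σ : V → ℕ × S)
    (hσ : ∀ v, (res (σ v).2).isSome = false → (σ v).1 = t) :
    (avg (toProtocol prog init res enc dec) G)^[l.length] (fun τ : V → ℕ × S => f fun v => (τ v).2) σ
      = gex (fun s => (res s).isSome) G l f fun v => (σ v).2 := by
  induction l generalizing t σ with
  | nil => rfl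
  | cons i l ih =>
    rw [List.length_cons, Function.iterate_succ_apply']
    refine expect_congr rfl fun ω _ => ?_
    have hs := toProtocol_step (prog := prog) (init := init) hdec G t σ hσ ω
    have hi : prog.getD t nop = i := hl 0 (by simp)
    rw [hi] at hs
    rw [ih (t + 1) (fun k hk => ?_) _ (fun v hv => ?_)]
    · congr 1
      funext v
      exact (hs v).1
    · have := hl (k + 1) (by simpa using hk)
      rw [add_right_comm, add_assoc]
      simpa using this
    · rw [(hs v).1] at hv
      exact (hs v).2 hv

end Protocol

/-! ### The probability of a reception -/

/-- Independence inside a round; it is applied both to the coins of one node and to the coins of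
different nodes. -/
theorem expect_prod_apply {ι X : Type*} [Fintype ι] [DecidableEq ι] [Fintype X]
    (f : ι → X → ℝ) : 𝔼 ω : ι → X, ∏ v, f v (ω v) = ∏ v, 𝔼 x, f v x := by
  simp only [Fintype.expect_eq_sum_div_card, prod_div_distrib, Fintype.card_pi,
    prod_univ_sum, Fintype.piFinset_univ, Nat.cast_prod]

/-- The first `r` coins show heads. -/
def Heads {c : ℕ} (r : ℕ) (x : Fin c → Bool) : Prop := ∀ k : Fin c, (k : ℕ) < r → x k = true

instance {c r : ℕ} (x : Fin c → Bool) : Decidable (Heads r x) := by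
  unfold Heads; infer_instance

theorem expect_heads {c r : ℕ} (hr : r ≤ c) :
    𝔼 x : Fin c → Bool, (if Heads r x then (1 : ℝ) else 0) = (2⁻¹) ^ r := by
  have h1 : ∀ x : Fin c → Bool, (if Heads r x then (1 : ℝ) else 0) =
      ∏ k : Fin c, if (k : ℕ) < r → x k = true then 1 else 0 := by
    intro x
    rw [prod_ite_zero]
    simp [Heads]
  simp_rw [h1]
  rw [expect_prod_apply fun (k : Fin c) (b : Bool) =>
    if (k : ℕ) < r → b = true then (1 : ℝ) else 0]
  have h2 : ∀ k : Fin c, (𝔼 b : Bool, if (k : ℕ) < r → b = true then (1 : ℝ) else 0) =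
      if (k : ℕ) < r then 2⁻¹ else 1 := by
    intro k
    rw [Fintype.expect_eq_sum_div_card]
    by_cases hk : (k : ℕ) < r <;> norm_num [hk]
  simp_rw [h2]
  rw [prod_ite, prod_const_one, mul_one, prod_const]
  congr 1
  rw [Fin.card_filter_val_lt]
  exact min_eq_right hr

theorem expect_not_heads {c r : ℕ} (hr : r ≤ c) :
    𝔼 x : Fin c → Bool, (if Heads r x then (0 : ℝ) else 1) = 1 - (2⁻¹) ^ r := by
  have h : (𝔼 x : Fin c → Bool, if Heads r x then (0 : ℝ) else 1) +
      𝔼 x : Fin c → Bool, (if Heads r x then (1 : ℝ) else 0) = 1 := by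
    rw [← expect_add_distrib, ← Fintype.expect_one (M := ℝ) (ι := Fin c → Bool)]
    exact expect_congr rfl fun ω _ => by split_ifs <;> simp
  rw [expect_heads hr] at h
  linarith

/-- At `a = 2 ^ r` the right side equals `1/4` for `r = 1` and increases with `r`, because `1 - y ≤
(1 - y/2)^2`. -/
theorem quarter_le_pow {r a : ℕ} (hr : 1 ≤ r) (ha : a ≤ 2 ^ r) :
    (1 : ℝ) / 4 ≤ (1 - 2⁻¹ ^ r) ^ a := by
  have h0 : ∀ r : ℕ, (0 : ℝ) ≤ 1 - 2⁻¹ ^ r := fun r => by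
    have : (2⁻¹ : ℝ) ^ r ≤ 1 := pow_le_one₀ (by norm_num) (by norm_num)
    linarith
  have h1 : ∀ r : ℕ, (1 : ℝ) - 2⁻¹ ^ r ≤ 1 := fun r => by
    have : (0 : ℝ) < 2⁻¹ ^ r := by positivity
    linarith
  refine le_trans ?_ (pow_le_pow_of_le_one (h0 r) (h1 r) ha)
  clear ha a
  induction r, hr using Nat.le_induction with
  | base => norm_num
  | succ r _ ih =>
    refine ih.trans ?_
    rw [pow_succ 2 r, mul_comm, pow_mul]
    refine pow_le_pow_left₀ (h0 r) ?_ _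
    rw [pow_succ (2⁻¹ : ℝ) r]
    nlinarith [sq_nonneg ((2⁻¹ : ℝ) ^ r)]

section Receive

variable {c : ℕ} {S M : Type} {V : Type*} {G : SimpleGraph V}

theorem sent_eq (i : Instr c S M) (σ : V → S) (ω : V → Fin c → Bool) (u : V) :
    sent i σ ω u = if Heads i.dens (ω u) then i.tx (σ u) else none := rfl

theorem exists_of_receive {i : Instr c S M} {σ : V → S} {ω : V → Fin c → Bool} {v : V} {m : M}
    (h : radioReceive G (sent i σ ω) v = some m) :
    ∃ u, G.Adj v u ∧ Heads i.dens (ω u) ∧ i.tx (σ u) = some m := by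
  unfold radioReceive at h
  split_ifs at h with h'
  refine ⟨_, h'.2.exists.choose_spec.1, ?_⟩
  rw [sent_eq] at h
  split_ifs at h with h''
  exact ⟨h'', h⟩

variable [Fintype V] [DecidableEq V]

/-- The chance that `u` is the only node of `A` whose first `r` coins show heads. -/
theorem expect_only {r : ℕ} (hr : r ≤ c) (A : Finset V) {u : V} (hu : u ∈ A) :
    𝔼 ω : V → Fin c → Bool,
      (if Heads r (ω u) ∧ ∀ w ∈ A, w ≠ u → ¬ Heads r (ω w) then (1 : ℝ) else 0) =
      2⁻¹ ^ r * (1 - 2⁻¹ ^ r) ^ (#A - 1) := by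
  have h1 : ∀ ω : V → Fin c → Bool,
      (if Heads r (ω u) ∧ ∀ w ∈ A, w ≠ u → ¬ Heads r (ω w) then (1 : ℝ) else 0) =
      ∏ v, (if v = u then (if Heads r (ω v) then 1 else 0)
        else if v ∈ A then (if Heads r (ω v) then 0 else 1) else 1) := by
    intro ω
    by_cases h : Heads r (ω u) ∧ ∀ w ∈ A, w ≠ u → ¬ Heads r (ω w)
    · rw [if_pos h, prod_eq_one]
      intro v _
      by_cases hv : v = u
      · subst hv; simp [h.1]
      · by_cases hA : v ∈ A
        · simp [hv, hA, h.2 v hA hv]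
        · simp [hv, hA]
    · rw [if_neg h, eq_comm]
      by_cases hu' : Heads r (ω u)
      · have : ∃ w ∈ A, w ≠ u ∧ Heads r (ω w) := by
          by_contra! hcon
          exact h ⟨hu', hcon⟩
        obtain ⟨w, hw, hwu, hh⟩ := this
        exact prod_eq_zero (mem_univ w) (by simp [hwu, hw, hh])
      · exact prod_eq_zero (mem_univ u) (by simp [hu'])
  simp_rw [h1]
  rw [expect_prod_apply fun (v : V) (x : Fin c → Bool) =>
    (if v = u then (if Heads r x then (1 : ℝ) else 0)
        else if v ∈ A then (if Heads r x then 0 else 1) else 1)]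
  have h2 : ∀ v : V, (𝔼 x : Fin c → Bool, if v = u then (if Heads r x then (1 : ℝ) else 0)
      else if v ∈ A then (if Heads r x then 0 else 1) else 1) =
      if v ∈ A then (if v = u then 2⁻¹ ^ r else 1 - 2⁻¹ ^ r) else 1 := by
    intro v
    by_cases hv : v = u
    · subst hv; simp [hu, expect_heads hr]
    · by_cases hA : v ∈ A
      · simp [hv, hA, expect_not_heads hr]
      · simp [hv, hA]
  simp_rw [h2]
  rw [prod_ite, prod_const_one, mul_one, filter_mem_eq_inter, univ_inter,
    ← mul_prod_erase _ _ hu, if_pos rfl]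
  congr 1
  rw [← card_erase_of_mem hu, ← prod_const]
  exact prod_congr rfl fun w hw => by simp [ne_of_mem_erase hw]

open Classical in
/-- A node with `A` as its set of neighbours that want to transmit receives something with
probability at least `1 / 8` if the transmission probability fits the size of `A`. -/
theorem expect_no_receive_le {i : Instr c S M} (hr : i.dens ≤ c) (h1 : 1 ≤ i.dens) {σ : V → S}
    {v : V} {A : Finset V} (hA : ∀ u, u ∈ A ↔ G.Adj v u ∧ (i.tx (σ u)).isSome)
    (hA1 : 2 ^ i.dens ≤ 2 * #A) (hA2 : #A < 2 ^ i.dens) :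
    𝔼 ω : V → Fin c → Bool,
      (if (radioReceive G (sent i σ ω) v).isSome then (0 : ℝ) else 1) ≤ 7 / 8 := by
  set r := i.dens with hrdef
  have hv : v ∉ A := fun h => G.irrefl ((hA v).1 h).1
  -- For distinct `u` the events of being the only node with heads are disjoint, and each of them
  -- causes a reception. The node `v` is inserted because it receives only while it is silent
  -- itself.
  have hpt : ∀ ω : V → Fin c → Bool,
      (if (radioReceive G (sent i σ ω) v).isSome then (0 : ℝ) else 1) +
        ∑ u ∈ A, (if Heads r (ω u) ∧ ∀ w ∈ insert v A, w ≠ u → ¬ Heads r (ω w)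
          then (1 : ℝ) else 0) ≤ 1 := by
    intro ω
    by_cases hex : ∃ u ∈ A, Heads r (ω u) ∧ ∀ w ∈ insert v A, w ≠ u → ¬ Heads r (ω w)
    · obtain ⟨u, hu, hu1, hu2⟩ := hex
      have hs : ∑ u' ∈ A, (if Heads r (ω u') ∧ ∀ w ∈ insert v A, w ≠ u' → ¬ Heads r (ω w)
          then (1 : ℝ) else 0) = 1 := by
        rw [sum_eq_single_of_mem u hu fun u' hu' hne => ?_, if_pos ⟨hu1, hu2⟩]
        rw [if_neg]
        rintro ⟨h, -⟩
        exact hu2 u' (mem_insert_of_mem hu') hne h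
      have hrec : (radioReceive G (sent i σ ω) v).isSome := by
        have hc : sent i σ ω v = none ∧ ∃! u, G.Adj v u ∧ (sent i σ ω u).isSome := by
          refine ⟨?_, u, ⟨((hA u).1 hu).1, ?_⟩, ?_⟩
          · rw [sent_eq, if_neg]
            exact hu2 v (mem_insert_self _ _) fun h => hv (h ▸ hu)
          · rw [sent_eq, if_pos hu1]
            exact ((hA u).1 hu).2
          · rintro w ⟨hw1, hw2⟩
            by_contra hne
            rw [sent_eq] at hw2
            split_ifs at hw2 with hh
            · exact hu2 w (mem_insert_of_mem ((hA w).2 ⟨hw1, hw2⟩)) hne hh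
            · simp at hw2
        unfold radioReceive
        rw [dif_pos hc]
        exact hc.2.exists.choose_spec.2
      rw [hs, if_pos hrec, zero_add]
    · rw [sum_eq_zero, add_zero]
      · split_ifs <;> norm_num
      · intro u hu
        rw [if_neg]
        exact fun h => hex ⟨u, hu, h⟩
  have hE := expect_le_expect (s := univ) (fun ω _ => hpt ω)
  rw [expect_add_distrib, expect_sum_comm, Fintype.expect_const] at hE
  have hs : ∑ u ∈ A, 𝔼 ω : V → Fin c → Bool,
      (if Heads r (ω u) ∧ ∀ w ∈ insert v A, w ≠ u → ¬ Heads r (ω w) then (1 : ℝ) else 0) =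
      #A * (2⁻¹ ^ r * (1 - 2⁻¹ ^ r) ^ #A) := by
    rw [sum_congr rfl fun u hu => expect_only hr (insert v A) (mem_insert_of_mem hu),
      sum_const, card_insert_of_notMem hv, nsmul_eq_mul, Nat.add_sub_cancel]
  rw [hs] at hE
  -- The success probability is at least `(#A * 2^(-r)) * (1 - 2^(-r))^#A ≥ 1/2 * 1/4`.
  have hq := quarter_le_pow h1 hA2.le
  have hp : (1 : ℝ) / 2 ≤ #A * 2⁻¹ ^ r := by
    rw [inv_pow, ← div_eq_mul_inv, le_div_iff₀ (by positivity)]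
    have : ((2 : ℝ) ^ r) ≤ 2 * #A := by exact_mod_cast hA1
    linarith
  have : (1 : ℝ) / 2 * (1 / 4) ≤ #A * 2⁻¹ ^ r * (1 - 2⁻¹ ^ r) ^ #A :=
    mul_le_mul hp hq (by norm_num) (by positivity)
  linarith

-- A reception needs some neighbour whose coins show heads; union bound over the neighbours.
open Classical in
theorem expect_receive_le {i : Instr c S M} (hr : i.dens ≤ c) (σ : V → S) (v : V) :
    𝔼 ω : V → Fin c → Bool,
      (if (radioReceive G (sent i σ ω) v).isSome then (1 : ℝ) else 0) ≤
        G.degree v * 2⁻¹ ^ i.dens := by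
  calc _ ≤ 𝔼 ω : V → Fin c → Bool, ∑ u ∈ G.neighborFinset v,
        (if Heads i.dens (ω u) then (1 : ℝ) else 0) := by
        refine expect_le_expect fun ω _ => ?_
        split_ifs with h
        · obtain ⟨m, hm⟩ := Option.isSome_iff_exists.1 h
          obtain ⟨u, hu, hh, -⟩ := exists_of_receive hm
          calc (1 : ℝ) = if Heads i.dens (ω u) then 1 else 0 := by simp [hh]
            _ ≤ _ := single_le_sum (f := fun u => if Heads i.dens (ω u) then (1 : ℝ) else 0)
              (fun u _ => by split_ifs <;> norm_num) (by simpa using hu)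
        · exact sum_nonneg fun u _ => by split_ifs <;> norm_num
    _ = ∑ u ∈ G.neighborFinset v, 2⁻¹ ^ i.dens := by
        rw [expect_sum_comm]
        refine sum_congr rfl fun u _ => ?_
        have := expect_only hr {u} (mem_singleton_self u)
        simpa using this
    _ = _ := by simp

/-- A round in which a reception establishes `Q` for good. -/
theorem failProb_le_of_receive {p₁ p₂ : List (Instr c S M)} {i : Instr c S M} (hr : i.dens ≤ c)
    (h1 : 1 ≤ i.dens) {σ : V → S} {Q : (V → S) → Prop} {v : V}
    (h : ∀ τ, Reach G p₁ σ τ →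
      (∃ A : Finset V, (∀ u, u ∈ A ↔ G.Adj v u ∧ (i.tx (τ u)).isSome) ∧
        2 ^ i.dens ≤ 2 * #A ∧ #A < 2 ^ i.dens) ∧
      ∀ ω, (radioReceive G (sent i τ ω) v).isSome →
        ∀ σ', Reach G p₂ (step G i τ ω) σ' → Q σ') :
    failProb G (p₁ ++ i :: p₂) Q σ ≤ 7 / 8 := by
  classical
  rw [failProb, ex_append]
  refine ex_le fun τ hτ => ?_
  obtain ⟨⟨A, hA, hA1, hA2⟩, hω⟩ := h τ hτ
  refine le_trans (expect_le_expect fun ω _ => ?_) (expect_no_receive_le hr h1 hA hA1 hA2)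
  split_ifs with hrec
  · exact (failProb_eq_zero (hω ω hrec)).le
  · exact failProb_le_one _ _ _

end Receive

/-! ### The algorithm -/

/-- The part of a local state that is fixed in the first stage. -/
structure Info (c : ℕ) where
  /-- is the node the source? -/
  src : Bool
  /-- the identifier -/
  id : Fin c → Bool
  /-- an estimate of the binary logarithm of the degree -/
  cls : ℕ

/-- The local states. -/
structure Node (c : ℕ) where
  /-- the results of the first stage -/
  info : Info c
  /-- a counter of receptions -/
  cnt : ℕ
  /-- the phase in which the node was informed -/
  time : Option ℕ
  /-- the distances to the sets of nodes informed early, with the identifiers of predecessors -/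
  tab : ℕ → Option (ℕ × (Fin c → Bool))
  /-- has the node terminated? -/
  done : Bool

/-- Packets: an identifier and an index. -/
abbrev Msg (c k : ℕ) : Type := (Fin c → Bool) × Fin (2 ^ k)

section Programs

variable {c k : ℕ}

/-- A silent round with a local computation. -/
def localInstr (f : Node c → Node c) : Instr c (Node c) (Msg c k) :=
  ⟨0, fun _ => none, fun s _ _ => f s⟩

/-- The coins of the round become the identifier. -/
def idInstr : Instr c (Node c) (Msg c k) :=
  ⟨0, fun _ => none, fun s x _ => { s with info := { s.info with id := x } }⟩

/-- All nodes transmit with probability `2 ^ (-i)` and count receptions. -/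
def countInstr (i : ℕ) : Instr c (Node c) (Msg c k) :=
  ⟨i, fun s => some (s.info.id, 0), fun s _ r =>
    if r.isSome then { s with cnt := s.cnt + 1 } else s⟩

/-- Adopt the estimate `i` if the counter has reached the threshold `θ`. -/
def testNode (θ i : ℕ) (s : Node c) : Node c :=
  { s with cnt := 0, info := { s.info with cls := if θ ≤ s.cnt then i else s.info.cls } }

/-- The estimation of degrees with the densities `1, …, n`. -/
def degreeProg (N θ : ℕ) : ℕ → List (Instr c (Node c) (Msg c k))
  | 0 => []
  | n + 1 => degreeProg N θ n ++
      (List.replicate N (countInstr (n + 1)) ++ [localInstr (testNode θ (n + 1))])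

/-- The delay of a node. -/
def wt (q lam e : ℕ) : ℕ := 2 ^ min (e - lam) q

/-- The number of rounds of phase `m`. -/
def phaseLen (L q lam m : ℕ) : ℕ :=
  if 2 ^ q ∣ m then L else min L (lam + padicValNat 2 m)

/-- A round of phase `m` of a flood: all nodes informed long enough ago transmit. -/
def floodInstr (q lam m r : ℕ) : Instr c (Node c) (Msg c k) :=
  ⟨r, fun s => match s.time with
    | some a => if a + wt q lam s.info.cls ≤ m then some (s.info.id, 0) else none
    | none => none,
   fun s _ x => if s.time = none ∧ x.isSome then { s with time := some m } else s⟩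

/-- Phase `m` of a flood. -/
def phase (L q lam m : ℕ) : List (Instr c (Node c) (Msg c k)) :=
  (List.range (phaseLen L q lam m)).map fun r => floodInstr q lam m (r + 1)

/-- The phases `m, …, m + n - 1` of a flood. -/
def flood (L q lam : ℕ) : ℕ → ℕ → List (Instr c (Node c) (Msg c k))
  | _, 0 => []
  | m, n + 1 => phase L q lam m ++ flood L q lam (m + 1) n

/-- The distance of a node to the set of nodes informed in the first `j * X` phases. -/
def level (X j : ℕ) (s : Node c) : Option ℕ :=
  match s.time with
  | some a => if (a + X - 1) / X = j then some 0 else (s.tab j).map Prod.fst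
  | none => none

open Classical in
/-- A round of a breadth-first search: nodes at distance `d` from a set with an index in the
residue class `l` transmit. -/
noncomputable def bfsInstr (X md d l r : ℕ) : Instr c (Node c) (Msg c k) :=
  ⟨r, fun s => if h : ∃ j, j % md = l ∧ level X j s = some d then
      some (s.info.id, Fin.ofNat (2 ^ k) h.choose) else none,
   fun s _ x => match x with
    | some (i, j) => if s.tab j = none ∧ ∃ a, s.time = some a ∧ j * X < a then
        { s with tab := Function.update s.tab j (some (d + 1, i)) } else s
    | none => s⟩

/-- One step of the breadth-first searches for a residue class. -/
noncomputable def bfsDecay (L X md d l : ℕ) : List (Instr c (Node c) (Msg c k)) :=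
  (List.range L).map fun r => bfsInstr X md d l (r + 1)

/-- The steps for distance `d` and the first `n` residue classes. -/
noncomputable def bfsLayer (N L X md d : ℕ) : ℕ → List (Instr c (Node c) (Msg c k))
  | 0 => []
  | n + 1 => bfsLayer N L X md d n ++ (List.replicate N (bfsDecay L X md d n)).flatten

/-- The breadth-first searches up to distance `n`. -/
noncomputable def bfsProg (N L X md : ℕ) : ℕ → List (Instr c (Node c) (Msg c k))
  | 0 => []
  | n + 1 => bfsProg N L X md n ++ bfsLayer N L X md n md

/-- The source starts a flood. -/
def startNode (s : Node c) : Node c :=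
  { s with time := if s.info.src then some 0 else none }

/-- The nodes that have not been informed start a flood. -/
def alarmNode (s : Node c) : Node c :=
  { s with time := if s.time = none then some 0 else none }

/-- The source starts a flood unless it has been alarmed. -/
def confirmNode (s : Node c) : Node c :=
  { s with time := if s.info.src = true ∧ s.time = none then some 0 else none,
           tab := fun _ => none }

/-- Informed nodes terminate. -/
def finishNode (s : Node c) : Node c := { s with done := s.done || s.time.isSome }

/-- The parameters of the algorithm. -/
structure Params where
  /-- the bound on the logarithm of the number of nodes -/
  L : ℕ
  /-- the logarithm of the largest delay -/
  q : ℕ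
  /-- the number of phases of the first flood -/
  M₁ : ℕ
  /-- the number of phases of the alarm -/
  M₂ : ℕ
  /-- the number of phases per slab -/
  X : ℕ
  /-- the number of slabs -/
  J : ℕ
  /-- the number of residue classes -/
  md : ℕ
  /-- the number of repetitions of a step of breadth-first search -/
  N : ℕ
  /-- the number of trials per density in the estimation of degrees -/
  E : ℕ
  /-- the threshold in the estimation of degrees -/
  θ : ℕ

/-- The test whether `lam` is large enough. -/
def checkProg (P : Params) (lam : ℕ) : List (Instr c (Node c) (Msg c k)) :=
  localInstr startNode :: (flood P.L P.q lam 1 P.M₁ ++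
    (localInstr alarmNode :: (flood P.L P.q lam 1 P.M₂ ++ [localInstr confirmNode])))

/-- The construction of the layering. -/
noncomputable def buildProg (P : Params) (lam : ℕ) : List (Instr c (Node c) (Msg c k)) :=
  flood P.L P.q lam 1 (P.J * P.X) ++ bfsProg P.N P.L P.X P.md P.X

/-- The attempt with parameter `lam`. -/
noncomputable def attempt (P : Params) (lam : ℕ) : List (Instr c (Node c) (Msg c k)) :=
  (checkProg P lam ++ buildProg P lam) ++ [localInstr finishNode]

/-- The attempts `0, …, n - 1`. -/
noncomputable def attempts (P : Params) : ℕ → List (Instr c (Node c) (Msg c k))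
  | 0 => []
  | n + 1 => attempts P n ++ attempt P (2 ^ n)

/-- The first stage. -/
def setupProg (P : Params) : List (Instr c (Node c) (Msg c k)) :=
  idInstr :: degreeProg P.E P.θ P.L

/-- The whole program. -/
noncomputable def mainProg (P : Params) : List (Instr c (Node c) (Msg c k)) :=
  setupProg P ++ attempts P (P.L + 1)

/-- The initial state. -/
def initNode (x : Bool) : Node c := ⟨⟨x, fun _ => false, 0⟩, 0, none, fun _ => none, false⟩

end Programs

/-! ### Floods -/

/-- The total delay along a walk, without its first node. -/
def walkCost {V : Type*} {G : SimpleGraph V} (w : V → ℕ) : {u v : V} → G.Walk u v → ℕ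
  | _, _, .nil => 0
  | _, _, .cons (v := v) _ p => w v + walkCost w p

theorem walkCost_add {V : Type*} {G : SimpleGraph V} (w : V → ℕ) {u v : V} (p : G.Walk u v) :
    walkCost w p + w u = (p.support.map w).sum := by
  induction p with
  | nil => simp [walkCost]
  | cons h p ih => simp [walkCost, ← ih]; omega

/-- The cost omits the first node of a walk, so reversal exchanges the contributions of the two
ends. -/
theorem walkCost_reverse {V : Type*} {G : SimpleGraph V} (w : V → ℕ) {u v : V}
    (p : G.Walk u v) : walkCost w p.reverse + w v = walkCost w p + w u := by
  rw [walkCost_add, walkCost_add, SimpleGraph.Walk.support_reverse, List.map_reverse,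
    List.sum_reverse]

theorem wt_pos (q lam e : ℕ) : 1 ≤ wt q lam e := Nat.one_le_two_pow

theorem wt_le (q lam e : ℕ) : wt q lam e ≤ 2 ^ q := Nat.pow_le_pow_right (by norm_num) (by simp)

/-- If `2 ^ (e - lam)` divides `m`, then `v₂(m) ≥ e - lam`, so the phase has length at least `e`; if
the delay is capped at `2 ^ q`, the phase has full length. -/
theorem le_phaseLen {L q lam e m : ℕ} (he : e ≤ L) (hm : m ≠ 0) (h : wt q lam e ∣ m) :
    e ≤ phaseLen L q lam m := by
  unfold phaseLen
  split_ifs with hq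
  · exact he
  · refine le_min he ?_
    unfold wt at h
    by_cases hle : e - lam ≤ q
    · rw [min_eq_left hle] at h
      have := (padicValNat_dvd_iff_le hm).1 h
      omega
    · rw [min_eq_right (by omega)] at h
      exact absurd h hq

section Flood

variable {c k : ℕ} {V : Type*} {G : SimpleGraph V}

/-- The node transmits in phase `m`. -/
def Active (q lam m : ℕ) (s : Node c) : Prop :=
  ∃ a, s.time = some a ∧ a + wt q lam s.info.cls ≤ m

theorem floodInstr_tx_isSome {q lam m r : ℕ} {s : Node c} :
    ((floodInstr q lam m r : Instr c (Node c) (Msg c k)).tx s).isSome ↔ Active q lam m s := by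
  unfold floodInstr Active
  rcases h : s.time with _ | a
  · simp [h]
  · simp [h]

/-- The effect of (a part of) phase `m` of a flood. -/
def PhaseRel (G : SimpleGraph V) (q lam m : ℕ) (σ τ : V → Node c) : Prop :=
  ∀ v, τ v = σ v ∨ ((σ v).time = none ∧ (∃ u, G.Adj v u ∧ Active q lam m (σ u)) ∧
    τ v = { σ v with time := some m })

/-- Delays are positive, so a node informed during phase `m` stays silent until the phase is over.
The set of transmitters is therefore constant within a phase. -/
theorem PhaseRel.active_iff {q lam m : ℕ} {σ τ : V → Node c} (h : PhaseRel G q lam m σ τ) (v : V) :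
    Active q lam m (τ v) ↔ Active q lam m (σ v) := by
  rcases h v with h | ⟨h1, -, h2⟩
  · rw [h]
  · have := wt_pos q lam (σ v).info.cls
    constructor
    · rintro ⟨a, ha, hle⟩
      rw [h2] at ha hle
      simp only [Option.some.injEq] at ha hle
      omega
    · rintro ⟨a, ha, -⟩
      rw [h1] at ha
      cases ha

theorem floodInstr_step {q lam m r : ℕ} (σ : V → Node c) (ω : V → Fin c → Bool) (v : V) :
    step G (floodInstr q lam m r : Instr c (Node c) (Msg c k)) σ ω v =
      if (σ v).time = none ∧
        (radioReceive G (sent (floodInstr q lam m r : Instr c (Node c) (Msg c k)) σ ω) v).isSome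
      then { σ v with time := some m } else σ v := rfl

theorem PhaseRel.step {q lam m r : ℕ} {σ τ : V → Node c} (h : PhaseRel G q lam m σ τ)
    (ω : V → Fin c → Bool) :
    PhaseRel G q lam m σ
      (step G (floodInstr q lam m r : Instr c (Node c) (Msg c k)) τ ω) := by
  intro v
  rw [floodInstr_step]
  split_ifs with hs
  · right
    obtain ⟨x, hx⟩ := Option.isSome_iff_exists.1 hs.2
    obtain ⟨u, hu, -, htx⟩ := exists_of_receive hx
    have hact : Active q lam m (σ u) := by
      rw [← h.active_iff, ← floodInstr_tx_isSome (k := k) (r := r), htx]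
      rfl
    rcases h v with hv | ⟨h1, -, h2⟩
    · rw [hv] at hs ⊢
      exact ⟨hs.1, ⟨u, hu, hact⟩, rfl⟩
    · rw [h2] at hs
      simp at hs
  · exact h v

theorem PhaseRel.of_reach {q lam m : ℕ} {p : List (Instr c (Node c) (Msg c k))}
    (hp : ∀ i ∈ p, ∃ r, i = floodInstr q lam m r) {σ τ : V → Node c} (h : Reach G p σ τ) :
    PhaseRel G q lam m σ τ :=
  h.invariant (I := PhaseRel G q lam m σ) (fun i hi _ ω h => by
    obtain ⟨r, rfl⟩ := hp i hi
    exact h.step ω) fun _ => Or.inl rfl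

theorem mem_phase {L q lam m : ℕ} {i : Instr c (Node c) (Msg c k)} (h : i ∈ phase L q lam m) :
    ∃ r, i = floodInstr q lam m r := by
  obtain ⟨r, -, rfl⟩ := List.mem_map.1 h
  exact ⟨_, rfl⟩

theorem PhaseRel.of_phase {L q lam m : ℕ} {σ τ : V → Node c}
    (h : Reach G (phase L q lam m : List (Instr c (Node c) (Msg c k))) σ τ) :
    PhaseRel G q lam m σ τ :=
  .of_reach (fun _ => mem_phase) h

theorem PhaseRel.info {q lam m : ℕ} {σ τ : V → Node c} (h : PhaseRel G q lam m σ τ) (v : V) :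
    (τ v).info = (σ v).info := by
  rcases h v with h | ⟨-, -, h⟩ <;> rw [h]

theorem PhaseRel.time_eq {q lam m : ℕ} {σ τ : V → Node c} (h : PhaseRel G q lam m σ τ) {v : V}
    {a : ℕ} (ha : (σ v).time = some a) : (τ v).time = some a := by
  rcases h v with h | ⟨h1, -, -⟩
  · rw [h, ha]
  · rw [ha] at h1; cases h1

/-- Invariants of floods are those of their phases. -/
theorem Reach.flood_invariant {L q lam : ℕ} {I : ℕ → (V → Node c) → Prop}
    (hI : ∀ m σ τ, I m σ → PhaseRel G q lam m σ τ → I (m + 1) τ) {m n : ℕ} {σ τ : V → Node c}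
    (h : Reach G (flood L q lam m n : List (Instr c (Node c) (Msg c k))) σ τ) (h0 : I m σ) :
    I (m + n) τ := by
  induction n generalizing m σ with
  | zero => exact h.symm ▸ h0
  | succ n ih =>
    obtain ⟨ρ, h1, h2⟩ := Reach.append h
    have := ih h2 (hI m σ ρ h0 (.of_phase h1))
    rwa [add_right_comm, add_assoc] at this

theorem flood_add (L q lam m n n' : ℕ) :
    (flood L q lam m (n + n') : List (Instr c (Node c) (Msg c k))) =
      flood L q lam m n ++ flood L q lam (m + n) n' := by
  induction n generalizing m with
  | zero => simp [flood]
  | succ n ih =>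
    rw [Nat.add_right_comm, flood, flood, ih, List.append_assoc, add_right_comm m, add_assoc m n 1]

variable [Fintype V] [DecidableEq V] [DecidableRel G.Adj]

/-- A phase that is long enough for the degree of `v` informs `v` with probability at least
`1 / 8` if `v` has an active neighbour. -/
theorem failProb_phase_le {L q lam m : ℕ} (hL : L ≤ c) {σ : V → Node c} {u v : V} {e : ℕ}
    (huv : G.Adj v u) (hu : Active q lam m (σ u)) (he : e ≤ phaseLen L q lam m)
    (hd : G.degree v < 2 ^ e) :
    failProb G (phase L q lam m : List (Instr c (Node c) (Msg c k)))
      (fun τ => (τ v).time ≠ none) σ ≤ 7 / 8 := by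
  classical
  set A : Finset V := {u | G.Adj v u ∧ Active q lam m (σ u)} with hA
  have hApos : #A ≠ 0 := (card_pos.2 ⟨u, by simp [hA, huv, hu]⟩).ne'
  have hAle : #A ≤ G.degree v := card_le_card fun w hw => by
    simp only [hA, mem_filter] at hw
    simpa using hw.2.1
  -- The density `r + 1` fits the number of active neighbours, and it occurs in the phase because
  -- `#A ≤ deg v < 2 ^ e`.
  set r := Nat.log 2 #A with hr
  have hr1 : 2 ^ r ≤ #A := Nat.pow_log_le_self 2 hApos
  have hr2 : #A < 2 ^ (r + 1) := Nat.lt_pow_succ_log_self (by norm_num) _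
  have hre : r < e := (Nat.pow_lt_pow_iff_right (by norm_num : 1 < 2)).1 (by omega)
  have hmem : (floodInstr q lam m (r + 1) : Instr c (Node c) (Msg c k)) ∈ phase L q lam m :=
    List.mem_map.2 ⟨r, List.mem_range.2 (by omega), rfl⟩
  have hlen : phaseLen L q lam m ≤ L := by
    unfold phaseLen; split_ifs <;> simp
  obtain ⟨p₁, p₂, hp⟩ := List.append_of_mem hmem
  have hsub : ∀ i ∈ p₁ ++ p₂, ∃ r, i = (floodInstr q lam m r : Instr c (Node c) (Msg c k)) := by
    intro i hi
    refine mem_phase (L := L) ?_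
    rw [hp]
    rcases List.mem_append.1 hi with h | h <;> simp [h]
  rw [hp]
  refine failProb_le_of_receive (v := v) (i := floodInstr q lam m (r + 1))
    (show r + 1 ≤ c by omega) (show 1 ≤ r + 1 by omega) fun τ hτ => ?_
  have hrel : PhaseRel G q lam m σ τ :=
    .of_reach (fun i hi => hsub i (List.mem_append_left _ hi)) hτ
  refine ⟨⟨A, fun w => ?_, ?_, ?_⟩, fun ω hω σ' hσ' => ?_⟩
  · rw [floodInstr_tx_isSome, hrel.active_iff]
    simp [hA]
  · show 2 ^ (r + 1) ≤ _
    rw [pow_succ]; omega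
  · exact hr2
  · have hrel' : PhaseRel G q lam m (step G (floodInstr q lam m (r + 1)) τ ω) σ' :=
      .of_reach (fun i hi => hsub i (List.mem_append_right _ hi)) hσ'
    have hne : (step G (floodInstr q lam m (r + 1) : Instr c (Node c) (Msg c k)) τ ω v).time
        ≠ none := by
      rw [floodInstr_step]
      split_ifs with hs
      · simp
      · exact fun h => hs ⟨h, hω⟩
    obtain ⟨a, ha⟩ := Option.ne_none_iff_exists'.1 hne
    rw [hrel'.time_eq ha]
    simp

/-- The induction step of the potential argument, with `x = z ^ wt`: a useful phase fails with
probability at most `7/8` and leaves the potential `x^19`, and it succeeds with the potential `x^2`.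
The exponent 18 and the bound `17/16` are chosen to make this work through Bernoulli's inequality
for `x^16`. -/
theorem pow_progress {x : ℝ} (h1 : 1 ≤ x) (h2 : x ≤ 17 / 16) :
    7 / 8 * x ^ 19 + 1 / 8 * x ^ 2 ≤ x ^ 18 := by
  have hb : 1 + 16 * (x - 1) ≤ x ^ 16 := by
    have := one_add_mul_le_pow (a := x - 1) (by linarith) 16
    simpa using this
  have h3 : 1 ≤ x ^ 16 * (8 - 7 * x) := by
    calc 1 ≤ (1 + 16 * (x - 1)) * (8 - 7 * x) := by nlinarith
      _ ≤ _ := mul_le_mul_of_nonneg_right hb (by linarith)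
  have : x ^ 18 - (7 / 8 * x ^ 19 + 1 / 8 * x ^ 2) =
      x ^ 2 / 8 * (x ^ 16 * (8 - 7 * x) - 1) := by ring
  have h4 : 0 ≤ x ^ 2 / 8 * (x ^ 16 * (8 - 7 * x) - 1) :=
    mul_nonneg (by positivity) (by linarith)
  linarith

/-- Exponential bound on the probability that a flood does not reach the end of a walk. -/
theorem pow_mul_failProb_flood_le {L q lam : ℕ} (hL : L ≤ c) {z : ℝ} (hz1 : 1 ≤ z)
    (hz : z ^ 2 ^ q = 17 / 16) {b : V → Info c} (hb : ∀ v, (b v).cls ≤ L)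
    (hd : ∀ v, G.degree v < 2 ^ (b v).cls) (n : ℕ) {u x : V} (p : G.Walk u x) {m a t : ℕ}
    (hm : 1 ≤ m) {σ : V → Node c} (hσ : ∀ v, (σ v).info = b v)
    (hlt : ∀ v a, (σ v).time = some a → a < m) (ha : (σ u).time = some a)
    (hat : a + wt q lam (b u).cls ≤ t)
    (ht : ∀ i, t ≤ i → i < m → ¬ p.Nil → ¬ wt q lam (b p.snd).cls ∣ i) :
    z ^ (m + n) * failProb G (flood L q lam m n : List (Instr c (Node c) (Msg c k)))
      (fun τ => (τ x).time ≠ none) σ ≤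
      z ^ (18 * walkCost (fun v => wt q lam (b v).cls) p + t) := by
  classical
  set w : V → ℕ := fun v => wt q lam (b v).cls with hw
  have hz0 : (0 : ℝ) < z := by linarith
  induction n generalizing u p m a t σ with
  | zero =>
    cases p with
    | nil =>
      have : failProb G (flood L q lam m 0 : List (Instr c (Node c) (Msg c k)))
          (fun τ => (τ x).time ≠ none) σ = 0 :=
        failProb_eq_zero fun τ hτ => by rw [hτ, ha]; simp
      rw [this, mul_zero]
      positivity
    | cons h p =>
      rename_i v
      have hwv : 1 ≤ w v := wt_pos _ _ _
      -- The interval `[t, t + w v)` contains a multiple of `w v`; by `ht` it has not passed yet.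
      have hmt : m ≤ t + w v := by
        by_contra! hcon
        have h1 : t ≤ w v * ((t + w v - 1) / w v) := by
          have := Nat.div_add_mod (t + w v - 1) (w v)
          have := Nat.mod_lt (t + w v - 1) hwv
          omega
        have h2 : w v * ((t + w v - 1) / w v) ≤ t + w v - 1 := Nat.mul_div_le _ _
        exact ht _ h1 (by omega) (by simp) (by simp [hw])
      calc _ ≤ z ^ (m + 0) * 1 := by
            gcongr
            exact failProb_le_one _ _ _
        _ ≤ _ := by
            rw [mul_one]
            refine pow_le_pow_right₀ hz1 ?_
            simp only [walkCost]
            omega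
  | succ n ih =>
    cases p with
    | nil =>
      have : failProb G (flood L q lam m (n + 1) : List (Instr c (Node c) (Msg c k)))
          (fun τ => (τ x).time ≠ none) σ = 0 := by
        refine failProb_eq_zero fun τ hτ => ?_
        have := hτ.flood_invariant (I := fun _ τ => (τ x).time = some a)
          (fun m σ τ h hr => hr.time_eq h) ha
        rw [this]; simp
      rw [this, mul_zero]
      positivity
    | cons h p =>
      rename_i v
      have hwv : 1 ≤ w v := wt_pos _ _ _
      have hcost : walkCost w (.cons h p) = w v + walkCost w p := rfl
      have hrelI : ∀ ρ, PhaseRel G q lam m σ ρ → (∀ v, (ρ v).info = b v) ∧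
          (∀ v a, (ρ v).time = some a → a < m + 1) ∧ (ρ u).time = some a := by
        intro ρ hρ
        refine ⟨fun v => (hρ.info v).trans (hσ v), fun v a' ha' => ?_, hρ.time_eq ha⟩
        rcases hρ v with h | ⟨-, -, h⟩
        · rw [h] at ha'
          have := hlt v a' ha'
          omega
        · rw [h] at ha'
          simp only [Option.some.injEq] at ha'
          omega
      have hexp : m + (n + 1) = (m + 1) + n := by omega
      have hsplit : failProb G (flood L q lam m (n + 1) : List (Instr c (Node c) (Msg c k)))
          (fun τ => (τ x).time ≠ none) σ =
            ex G (phase L q lam m : List (Instr c (Node c) (Msg c k)))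
            (failProb G (flood L q lam (m + 1) n : List (Instr c (Node c) (Msg c k)))
              (fun τ => (τ x).time ≠ none)) σ := by
        rw [flood, failProb, ex_append]; rfl
      have hmt : t ≤ m → m < t + w v := by
        intro htm
        by_contra! hcon
        have h1 : t ≤ w v * ((t + w v - 1) / w v) := by
          have := Nat.div_add_mod (t + w v - 1) (w v)
          have := Nat.mod_lt (t + w v - 1) hwv
          omega
        have h2 : w v * ((t + w v - 1) / w v) ≤ t + w v - 1 := Nat.mul_div_le _ _
        exact ht _ h1 (by omega) (by simp) (by simp [hw])
      rw [hsplit, hexp, ← ex_const_mul]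
      -- Phase `m` is useful if `u` is already active and the phase is long enough for the degree of
      -- `v`.
      by_cases hgood : t ≤ m ∧ w v ∣ m
      · obtain ⟨htm, hdvd⟩ := hgood
        have hmt := hmt htm
        -- the estimate when `v` has been informed
        have hinf : ∀ ρ, PhaseRel G q lam m σ ρ → (ρ v).time ≠ none →
            z ^ (m + 1 + n) * failProb G (flood L q lam (m + 1) n :
              List (Instr c (Node c) (Msg c k))) (fun τ => (τ x).time ≠ none) ρ ≤
            z ^ (18 * walkCost w p + (m + w v)) := by
          intro ρ hρ hne
          obtain ⟨h1, h2, h3⟩ := hrelI ρ hρ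
          obtain ⟨a', ha'⟩ := Option.ne_none_iff_exists'.1 hne
          have := h2 v a' ha'
          exact ih p (by omega) h1 h2 ha' (by show a' + w v ≤ _; omega)
            fun i hi1 hi2 => by omega
        by_cases hv : (σ v).time = none
        · have hninf : ∀ ρ, PhaseRel G q lam m σ ρ →
              z ^ (m + 1 + n) * failProb G (flood L q lam (m + 1) n :
                List (Instr c (Node c) (Msg c k))) (fun τ => (τ x).time ≠ none) ρ ≤
              z ^ (18 * walkCost w (.cons h p) + (m + 1)) := by
            intro ρ hρ
            obtain ⟨h1, h2, h3⟩ := hrelI ρ hρ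
            exact ih (.cons h p) (by omega) h1 h2 h3 (by omega) fun i hi1 hi2 => by omega
          set A := z ^ (18 * walkCost w (.cons h p) + (m + 1)) with hA
          set B := z ^ (18 * walkCost w p + (m + w v)) with hB
          have hBA : B ≤ A := pow_le_pow_right₀ hz1 (by rw [hcost]; omega)
          have hphase : failProb G (phase L q lam m : List (Instr c (Node c) (Msg c k)))
              (fun τ => (τ v).time ≠ none) σ ≤ 7 / 8 := by
            refine failProb_phase_le hL h.symm ⟨a, ha, ?_⟩ ?_ (hd v)
            · rw [hσ]; omega
            · exact le_phaseLen (hb v) (by omega) hdvd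
          -- After the phase the potential is at most `B` if `v` has been informed and at most `A`
          -- otherwise.
          calc _ ≤ ex G (phase L q lam m : List (Instr c (Node c) (Msg c k)))
                (fun τ => B + (A - B) * (if (τ v).time ≠ none then 0 else 1)) σ := by
                refine ex_mono fun ρ hρ => ?_
                split_ifs with hne
                · rw [mul_zero, add_zero]; exact hinf ρ (.of_phase hρ) hne
                · rw [mul_one, add_sub_cancel]; exact hninf ρ (.of_phase hρ)
            _ = B + (A - B) * failProb G (phase L q lam m : List (Instr c (Node c) (Msg c k)))
                (fun τ => (τ v).time ≠ none) σ := by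
                rw [ex_add, ex_const, ex_const_mul, failProb]
                congr!
            _ ≤ B + (A - B) * (7 / 8) := by
                gcongr
            _ = 7 / 8 * A + 1 / 8 * B := by ring
            _ ≤ z ^ (18 * walkCost w p + t) * (7 / 8 * (z ^ w v) ^ 19 + 1 / 8 * (z ^ w v) ^ 2) := by
                have e1 : A ≤ z ^ (18 * walkCost w p + t) * (z ^ w v) ^ 19 := by
                  rw [← pow_mul, ← pow_add]
                  exact pow_le_pow_right₀ hz1 (by rw [hcost]; omega)
                have e2 : B ≤ z ^ (18 * walkCost w p + t) * (z ^ w v) ^ 2 := by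
                  rw [← pow_mul, ← pow_add]
                  exact pow_le_pow_right₀ hz1 (by omega)
                linarith
            _ ≤ z ^ (18 * walkCost w p + t) * (z ^ w v) ^ 18 := by
                refine mul_le_mul_of_nonneg_left (pow_progress (one_le_pow₀ hz1) ?_)
                  (by positivity)
                rw [← hz]
                exact pow_le_pow_right₀ hz1 (wt_le _ _ _)
            _ = _ := by
                rw [← pow_mul, ← pow_add, hcost]
                congr 1
                ring
        · refine ex_le fun ρ hρ => ?_
          have hρ := PhaseRel.of_phase hρ
          obtain ⟨a', ha'⟩ := Option.ne_none_iff_exists'.1 hv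
          refine (hinf ρ hρ (by rw [hρ.time_eq ha']; simp)).trans ?_
          exact pow_le_pow_right₀ hz1 (by rw [hcost]; omega)
      · refine ex_le fun ρ hρ => ?_
        obtain ⟨h1, h2, h3⟩ := hrelI ρ (.of_phase hρ)
        -- The phase is not useful: `t` is kept, and still no useful phase has passed.
        refine ih (.cons h p) (by omega) h1 h2 h3 hat fun i hi1 hi2 hn hdvd => ?_
        by_cases him : i = m
        · subst him
          exact hgood ⟨hi1, by simpa [hw] using hdvd⟩
        · exact ht i hi1 (by omega) hn hdvd

/-- A flood with enough phases reaches the end of a walk that starts at an informed node. -/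
theorem failProb_flood_le {L q lam : ℕ} (hL : L ≤ c) {b : V → Info c}
    (hb : ∀ v, (b v).cls ≤ L) (hd : ∀ v, G.degree v < 2 ^ (b v).cls) {n n₀ m : ℕ} {u x : V}
    (p : G.Walk u x) (hm : 1 ≤ m) {σ : V → Node c} (hσ : ∀ v, (σ v).info = b v)
    (hlt : ∀ v a, (σ v).time = some a → a < m) (hu : (σ u).time ≠ none)
    (hn : 18 * walkCost (fun v => wt q lam (b v).cls) p + 2 ^ q + 2 ^ q * n₀ ≤ n) :
    failProb G (flood L q lam m n : List (Instr c (Node c) (Msg c k)))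
      (fun τ => (τ x).time ≠ none) σ ≤ (16 / 17) ^ n₀ := by
  obtain ⟨a, ha⟩ := Option.ne_none_iff_exists'.1 hu
  -- Normalised so that `2 ^ q` phases, the largest delay, gain the factor `17/16`.
  set z : ℝ := (17 / 16 : ℝ) ^ ((2 ^ q : ℕ) : ℝ)⁻¹ with hzdef
  have hz : z ^ 2 ^ q = 17 / 16 := Real.rpow_inv_natCast_pow (by norm_num) (by positivity)
  have hz1 : 1 ≤ z := Real.one_le_rpow (by norm_num) (by positivity)
  have key := pow_mul_failProb_flood_le (k := k) (lam := lam) hL hz1 hz hb hd n p hm hσ hlt ha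
    (t := m + 2 ^ q)
    (by have := wt_le q lam (b u).cls; have := hlt u a ha; omega) (fun i h1 h2 => absurd (h1.trans_lt h2) (by simp))
  set C := walkCost (fun v => wt q lam (b v).cls) p
  set f := failProb G (flood L q lam m n : List (Instr c (Node c) (Msg c k)))
      (fun τ => (τ x).time ≠ none) σ
  have hf : 0 ≤ f := failProb_nonneg _ _ _
  have h2 : z ^ (18 * C + (m + 2 ^ q)) * (17 / 16) ^ n₀ ≤ z ^ (m + n) := by
    rw [← hz, ← pow_mul, ← pow_add]
    exact pow_le_pow_right₀ hz1 (by omega)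
  have hzp : 0 < z ^ (18 * C + (m + 2 ^ q)) := by positivity
  have h3 : (17 / 16 : ℝ) ^ n₀ * f ≤ 1 := by
    by_contra! hcon
    have := mul_lt_mul_of_pos_left hcon hzp
    have := mul_le_mul_of_nonneg_right h2 hf
    nlinarith
  have h4 : (16 / 17 : ℝ) ^ n₀ * (17 / 16 : ℝ) ^ n₀ = 1 := by
    rw [← mul_pow]; norm_num
  have h5 : (0 : ℝ) < (16 / 17 : ℝ) ^ n₀ := by positivity
  calc f = (16 / 17 : ℝ) ^ n₀ * ((17 / 16 : ℝ) ^ n₀ * f) := by rw [← mul_assoc, h4, one_mul]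
    _ ≤ (16 / 17 : ℝ) ^ n₀ * 1 := by gcongr
    _ = _ := mul_one _

end Flood

/-! ### Identifiers and degrees -/

section Setup

variable {c k : ℕ} {V : Type*} {G : SimpleGraph V}

theorem countInstr_cnt (i : ℕ) (σ : V → Node c) (ω : V → Fin c → Bool) (v : V) :
    (step G (countInstr i : Instr c (Node c) (Msg c k)) σ ω v).cnt =
      if (radioReceive G (sent (countInstr i : Instr c (Node c) (Msg c k)) σ ω) v).isSome
      then (σ v).cnt + 1 else (σ v).cnt := by
  unfold step countInstr
  dsimp only
  split_ifs <;> rfl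

theorem step_count_eq (i : ℕ) (σ : V → Node c) (ω : V → Fin c → Bool) (v : V) :
    (step G (countInstr i : Instr c (Node c) (Msg c k)) σ ω v).info = (σ v).info ∧
      (step G (countInstr i : Instr c (Node c) (Msg c k)) σ ω v).done = (σ v).done := by
  unfold step countInstr
  dsimp only
  split_ifs <;> simp

variable [Fintype V] [DecidableEq V]

/-- There are `2 ^ c` possible common values, and each is taken by both nodes with probability
`2^(-c) * 2^(-c)`. -/
theorem expect_coins_eq {u v : V} (huv : u ≠ v) :
    𝔼 ω : V → Fin c → Bool, (if ω u = ω v then (1 : ℝ) else 0) = 2⁻¹ ^ c := by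
  have h1 : ∀ ω : V → Fin c → Bool, (if ω u = ω v then (1 : ℝ) else 0) =
      ∑ x : Fin c → Bool, ∏ w, (if w = u ∨ w = v then (if ω w = x then 1 else 0) else 1) := by
    intro ω
    have h2 : ∀ x : Fin c → Bool,
        ∏ w, (if w = u ∨ w = v then (if ω w = x then (1 : ℝ) else 0) else 1) =
          if ω u = x ∧ ω v = x then 1 else 0 := by
      intro x
      by_cases hu : ω u = x
      · by_cases hv : ω v = x
        · rw [if_pos ⟨hu, hv⟩, prod_eq_one]
          intro w _
          split_ifs with h1 h2
          · rfl
          · rcases h1 with rfl | rfl <;> contradiction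
          · rfl
        · rw [if_neg (by tauto)]
          exact prod_eq_zero (mem_univ v) (by simp [hv])
      · rw [if_neg (by tauto)]
        exact prod_eq_zero (mem_univ u) (by simp [hu])
    simp_rw [h2]
    by_cases h : ω u = ω v
    · rw [if_pos h, sum_eq_single_of_mem (ω u) (mem_univ _) fun x _ hx => if_neg fun h => hx h.1.symm]
      simp [h]
    · rw [if_neg h, sum_eq_zero]
      intro x _
      rw [if_neg]
      rintro ⟨rfl, h'⟩
      exact h h'.symm
  simp_rw [h1]
  rw [expect_sum_comm]
  have h3 : ∀ x : Fin c → Bool, (𝔼 ω : V → Fin c → Bool,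
      ∏ w, (if w = u ∨ w = v then (if ω w = x then (1 : ℝ) else 0) else 1)) =
      2⁻¹ ^ c * 2⁻¹ ^ c := by
    intro x
    rw [expect_prod_apply fun (w : V) (y : Fin c → Bool) =>
      (if w = u ∨ w = v then (if y = x then (1 : ℝ) else 0) else 1)]
    have h4 : ∀ w : V, (𝔼 y : Fin c → Bool,
        if w = u ∨ w = v then (if y = x then (1 : ℝ) else 0) else 1) =
        if w ∈ ({u, v} : Finset V) then 2⁻¹ ^ c else 1 := by
      intro w
      by_cases hw : w = u ∨ w = v
      · simp [hw]
      · simp [hw]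
    simp_rw [h4]
    rw [prod_ite_mem, univ_inter, prod_const, card_pair huv, sq]
  simp_rw [h3]
  rw [sum_const, card_univ, Fintype.card_fun, Fintype.card_bool, Fintype.card_fin, nsmul_eq_mul,
    ← mul_assoc]
  push_cast
  rw [← mul_pow]
  norm_num

theorem failProb_idInstr_le (σ : V → Node c) :
    failProb G [(idInstr : Instr c (Node c) (Msg c k))]
      (fun τ => Function.Injective fun v => (τ v).info.id) σ ≤
      (Fintype.card V : ℝ) ^ 2 * 2⁻¹ ^ c := by
  classical
  calc _ ≤ 𝔼 ω : V → Fin c → Bool, ∑ x ∈ (univ : Finset (V × V)).filter (fun x => x.1 ≠ x.2),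
        (if ω x.1 = ω x.2 then (1 : ℝ) else 0) := by
        refine expect_le_expect fun ω _ => ?_
        simp only [ex]
        split_ifs with h
        · exact sum_nonneg fun x _ => by split_ifs <;> norm_num
        · have : ∃ u v, ω u = ω v ∧ u ≠ v := by
            by_contra! hcon
            exact h fun u v huv => hcon u v huv
          obtain ⟨u, v, h1, h2⟩ := this
          calc (1 : ℝ) = if ω (u, v).1 = ω (u, v).2 then 1 else 0 := by simp [h1]
            _ ≤ _ := single_le_sum (f := fun x : V × V => if ω x.1 = ω x.2 then (1 : ℝ) else 0)
              (fun x _ => by split_ifs <;> norm_num) (by simp [h2])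
    _ = ∑ x ∈ (univ : Finset (V × V)).filter (fun x => x.1 ≠ x.2), (2⁻¹ : ℝ) ^ c := by
        rw [expect_sum_comm]
        exact sum_congr rfl fun x hx => expect_coins_eq (mem_filter.1 hx).2
    _ ≤ ∑ x : V × V, (2⁻¹ : ℝ) ^ c :=
        sum_le_sum_of_subset_of_nonneg (filter_subset _ _) fun _ _ _ => by positivity
    _ = _ := by simp [sq]

/-- Exponential moments of the counter. -/
theorem ex_pow_cnt_le {i : ℕ} {x ρ : ℝ} (hx : 0 ≤ x) (hρ : 0 ≤ ρ) (v : V)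
    (h : ∀ σ : V → Node c, 𝔼 ω : V → Fin c → Bool,
      (if (radioReceive G (sent (countInstr i : Instr c (Node c) (Msg c k)) σ ω) v).isSome
        then x else 1) ≤ ρ) (N : ℕ) (σ : V → Node c) :
    ex G (List.replicate N (countInstr i : Instr c (Node c) (Msg c k)))
      (fun τ => x ^ (τ v).cnt) σ ≤ ρ ^ N * x ^ (σ v).cnt := by
  induction N generalizing σ with
  | zero => simp [ex]
  | succ N ih =>
    rw [List.replicate_succ, ex]
    calc _ ≤ 𝔼 ω : V → Fin c → Bool, (ρ ^ N * x ^ (σ v).cnt) *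
          (if (radioReceive G (sent (countInstr i : Instr c (Node c) (Msg c k)) σ ω) v).isSome
            then x else 1) := by
          refine expect_le_expect fun ω _ => (ih _).trans_eq ?_
          rw [countInstr_cnt]
          split_ifs
          · rw [pow_succ, mul_assoc]
          · rw [mul_one]
      _ ≤ (ρ ^ N * x ^ (σ v).cnt) * ρ := by
          rw [← mul_expect]
          exact mul_le_mul_of_nonneg_left (h σ) (by positivity)
      _ = _ := by rw [pow_succ]; ring

variable [DecidableRel G.Adj]

/-- Chernoff bound with base `1/2`: a round receives with probability at least `1/8`, so it
multiplies the moment by at most `15/16`, and `2 * (15/16)^32 ≤ 1/2`. -/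
theorem failProb_count_ge {i n : ℕ} (hi1 : 1 ≤ i) (hic : i ≤ c) {v : V}
    (h1 : 2 ^ i ≤ 2 * G.degree v) (h2 : G.degree v < 2 ^ i) (σ : V → Node c)
    (hσ : (σ v).cnt = 0) :
    failProb G (List.replicate (32 * n) (countInstr i : Instr c (Node c) (Msg c k)))
      (fun τ => n ≤ (τ v).cnt) σ ≤ 2⁻¹ ^ n := by
  classical
  have key := ex_pow_cnt_le (G := G) (k := k) (i := i) (x := 1 / 2) (ρ := 15 / 16) (by norm_num)
    (by norm_num) v (fun σ => by
      have := expect_no_receive_le (G := G) (i := (countInstr i : Instr c (Node c) (Msg c k)))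
        (σ := σ) (v := v) (A := G.neighborFinset v) hic hi1 (fun u => by simp [countInstr])
        (by simpa [countInstr] using h1) (by simpa [countInstr] using h2)
      calc _ = 𝔼 ω : V → Fin c → Bool, ((1 / 2 : ℝ) + 1 / 2 *
            (if (radioReceive G (sent (countInstr i : Instr c (Node c) (Msg c k)) σ ω) v).isSome
              then 0 else 1)) := expect_congr rfl fun ω _ => by split_ifs <;> norm_num
        _ ≤ 15 / 16 := by
            rw [expect_add_distrib, ← mul_expect, Fintype.expect_const]
            linarith) (32 * n) σ
  rw [hσ, pow_zero, mul_one] at key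
  calc _ ≤ ex G (List.replicate (32 * n) (countInstr i : Instr c (Node c) (Msg c k)))
        (fun τ => 2 ^ n * (1 / 2 : ℝ) ^ (τ v).cnt) σ := by
        refine ex_mono fun τ _ => ?_
        split_ifs with h
        · positivity
        · push Not at h
          rw [one_div, inv_pow, ← div_eq_mul_inv, one_le_div (by positivity)]
          exact pow_le_pow_right₀ (by norm_num) h.le
    _ ≤ 2 ^ n * (15 / 16 : ℝ) ^ (32 * n) := by
        rw [ex_const_mul]
        gcongr
    _ = (2 * (15 / 16 : ℝ) ^ 32) ^ n := by rw [pow_mul, mul_pow]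
    _ ≤ _ := by
        gcongr
        norm_num

/-- Chernoff bound with base `8`: a round receives with probability at most `1/256`, so it
multiplies the moment by at most `1 + 7/256`, and `(1 + 7/256)^32 / 8 ≤ 1/2`. -/
theorem failProb_count_lt {i n : ℕ} (hic : i ≤ c) {v : V}
    (h1 : 256 * G.degree v ≤ 2 ^ i) (σ : V → Node c)
    (hσ : (σ v).cnt = 0) :
    failProb G (List.replicate (32 * n) (countInstr i : Instr c (Node c) (Msg c k)))
      (fun τ => (τ v).cnt < n) σ ≤ 2⁻¹ ^ n := by
  classical
  have key := ex_pow_cnt_le (G := G) (k := k) (i := i) (x := 8) (ρ := 1 + 7 / 256) (by norm_num)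
    (by norm_num) v (fun σ => by
      have := expect_receive_le (G := G) (i := (countInstr i : Instr c (Node c) (Msg c k)))
        hic σ v
      have hd : (G.degree v : ℝ) * 2⁻¹ ^ i ≤ 1 / 256 := by
        rw [inv_pow, ← div_eq_mul_inv, div_le_iff₀ (by positivity)]
        have : (256 : ℝ) * G.degree v ≤ 2 ^ i := by exact_mod_cast h1
        linarith
      have this' : 𝔼 ω : V → Fin c → Bool,
          (if (radioReceive G (sent (countInstr i : Instr c (Node c) (Msg c k)) σ ω) v).isSome
            then (1 : ℝ) else 0) ≤ 1 / 256 := by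
        refine this.trans (le_trans (le_of_eq ?_) hd)
        congr!
      calc _ = 𝔼 ω : V → Fin c → Bool, ((1 : ℝ) + 7 *
            (if (radioReceive G (sent (countInstr i : Instr c (Node c) (Msg c k)) σ ω) v).isSome
              then 1 else 0)) := expect_congr rfl fun ω _ => by split_ifs <;> norm_num
        _ ≤ 1 + 7 / 256 := by
            rw [expect_add_distrib, ← mul_expect, Fintype.expect_const]
            linarith) (32 * n) σ
  rw [hσ, pow_zero, mul_one] at key
  calc _ ≤ ex G (List.replicate (32 * n) (countInstr i : Instr c (Node c) (Msg c k)))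
        (fun τ => (1 / 8 : ℝ) ^ n * (8 : ℝ) ^ (τ v).cnt) σ := by
        refine ex_mono fun τ _ => ?_
        split_ifs with h
        · positivity
        · push Not at h
          rw [one_div, inv_pow, mul_comm, ← div_eq_mul_inv, one_le_div (by positivity)]
          exact pow_le_pow_right₀ (by norm_num) h
    _ ≤ (1 / 8 : ℝ) ^ n * (1 + 7 / 256 : ℝ) ^ (32 * n) := by
        rw [ex_const_mul]
        gcongr
    _ = (1 / 8 * (1 + 7 / 256 : ℝ) ^ 32) ^ n := by rw [pow_mul, mul_pow]
    _ ≤ _ := by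
        gcongr
        norm_num

/-- The state of the estimation of degrees after the densities `1, …, n`. -/
structure Estimating (G : SimpleGraph V) [DecidableRel G.Adj] (s : V) (n : ℕ)
    (σ : V → Node c) : Prop where
  src : ∀ v, (σ v).info.src = decide (v = s)
  done : ∀ v, (σ v).done = false
  inj : Function.Injective fun v => (σ v).info.id
  cnt : ∀ v, (σ v).cnt = 0
  cls_le : ∀ v, (σ v).info.cls ≤ n
  lower : ∀ v, Nat.log 2 (G.degree v) + 1 ≤ n → Nat.log 2 (G.degree v) + 1 ≤ (σ v).info.cls
  upper : ∀ v, 2 ^ (σ v).info.cls ≤ 256 * G.degree v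

/-- Only two kinds of tests have a prescribed outcome: the density just above the degree must pass,
and densities too high by a factor of 256 must not. The outcomes of the others do not matter: a test
that passes only raises the estimate, and it stays within the upper bound. -/
theorem triple_degree_step {s : V} {n N : ℕ} (hn : n + 1 ≤ c) (hdeg : ∀ v, 1 ≤ G.degree v) :
    Triple G (List.replicate (32 * N) (countInstr (n + 1)) ++
        [(localInstr (testNode N (n + 1)) : Instr c (Node c) (Msg c k))])
      (Estimating G s n) (Estimating G s (n + 1)) (Fintype.card V * 2⁻¹ ^ N) := by
  classical
  intro σ hσ
  set T : V → (V → Node c) → Prop := fun v τ =>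
    (n = Nat.log 2 (G.degree v) → N ≤ (τ v).cnt) ∧
    (256 * G.degree v ≤ 2 ^ (n + 1) → (τ v).cnt < N) with hT
  have h1 : failProb G (List.replicate (32 * N)
      (countInstr (n + 1) : Instr c (Node c) (Msg c k))) (fun τ => ∀ v, T v τ) σ ≤
      Fintype.card V * 2⁻¹ ^ N := by
    refine failProb_forall_le fun v => ?_
    have hd := hdeg v
    by_cases hl : n = Nat.log 2 (G.degree v)
    · have e1 : 2 ^ n ≤ G.degree v := by rw [hl]; exact Nat.pow_log_le_self 2 (by omega)
      have e2 : G.degree v < 2 ^ (n + 1) := by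
        rw [hl]; exact Nat.lt_pow_succ_log_self (by norm_num) _
      refine le_trans (failProb_mono fun τ _ h => ?_) (failProb_count_ge (by omega) hn
        (by rw [pow_succ]; omega) e2 σ (hσ.cnt v))
      exact ⟨fun _ => h, fun h' => by rw [pow_succ] at h'; omega⟩
    · by_cases hu : 256 * G.degree v ≤ 2 ^ (n + 1)
      · refine le_trans (failProb_mono fun τ _ h => ?_) (failProb_count_lt hn hu σ (hσ.cnt v))
        exact ⟨fun h' => absurd h' hl, fun _ => h⟩
      · rw [failProb_eq_zero fun τ _ => ⟨fun h => absurd h hl, fun h => absurd h hu⟩]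
        positivity
  have h2 := failProb_append_le (G := G) (q := [(localInstr (testNode N (n + 1)) :
    Instr c (Node c) (Msg c k))]) (R := Estimating G s (n + 1)) le_rfl (fun τ hτ hTτ => ?_)
    (p := List.replicate (32 * N) (countInstr (n + 1) : Instr c (Node c) (Msg c k)))
    (Q := fun τ => ∀ v, T v τ) (σ := σ)
  · linarith
  · have hinv : ∀ v, (τ v).info = (σ v).info ∧ (τ v).done = (σ v).done :=
      hτ.invariant (I := fun τ => ∀ v, (τ v).info = (σ v).info ∧ (τ v).done = (σ v).done)
        (fun i hi ρ ω h v => by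
          rw [List.eq_of_mem_replicate hi]
          have := step_count_eq (G := G) (k := k) (n + 1) ρ ω v
          exact ⟨this.1.trans (h v).1, this.2.trans (h v).2⟩) fun v => ⟨rfl, rfl⟩
    refine (failProb_eq_zero fun ρ hρ => ?_).le
    obtain ⟨ω, rfl⟩ := hρ
    have hst : ∀ v, step G (localInstr (testNode N (n + 1)) : Instr c (Node c) (Msg c k)) τ ω v =
        testNode N (n + 1) (τ v) := fun v => rfl
    constructor
    · intro v; rw [hst]; simp [testNode, (hinv v).1, hσ.src v]
    · intro v; rw [hst]; simp [testNode, (hinv v).2, hσ.done v]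
    · simp only [hst, testNode, (hinv _).1]; exact hσ.inj
    · intro v; rw [hst]; rfl
    · intro v
      rw [hst]
      simp only [testNode, (hinv v).1]
      have := hσ.cls_le v
      split_ifs <;> omega
    · intro v hv
      rw [hst]
      simp only [testNode, (hinv v).1]
      split_ifs with h
      · exact hv
      · refine hσ.lower v ?_
        by_contra hcon
        exact h ((hTτ v).1 (by omega))
    · intro v
      rw [hst]
      simp only [testNode, (hinv v).1]
      split_ifs with h
      · by_contra! hcon
        have := (hTτ v).2 hcon.le
        omega
      · exact hσ.upper v

theorem triple_degreeProg {s : V} {n N : ℕ} (hn : n ≤ c) (hdeg : ∀ v, 1 ≤ G.degree v) :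
    Triple G (degreeProg (32 * N) N n : List (Instr c (Node c) (Msg c k)))
      (Estimating G s 0) (Estimating G s n) (n * (Fintype.card V * 2⁻¹ ^ N)) := by
  induction n with
  | zero => simpa [degreeProg] using Triple.of_reach fun σ τ h h' => by rw [h']; exact h
  | succ n ih =>
    refine ((ih (by omega)).seq (triple_degree_step hn hdeg) (by positivity)).weaken
      (fun _ h => h) (fun _ h => h) (le_of_eq ?_)
    push_cast
    ring

/-- The information gathered in the first stage is correct. -/
structure GoodInfo (G : SimpleGraph V) [DecidableRel G.Adj] (s : V) (L : ℕ)
    (b : V → Info c) : Prop where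
  src : ∀ v, (b v).src = decide (v = s)
  inj : Function.Injective fun v => (b v).id
  cls_le : ∀ v, (b v).cls ≤ L
  lower : ∀ v, G.degree v < 2 ^ (b v).cls
  upper : ∀ v, 2 ^ (b v).cls ≤ 256 * G.degree v

/-- The nodes have the information `b` and have not terminated. -/
def Ready (b : V → Info c) (σ : V → Node c) : Prop :=
  ∀ v, (σ v).info = b v ∧ (σ v).done = false

theorem triple_setupProg {P : Params} {s : V} (hc : P.L ≤ c) (hE : P.E = 32 * P.θ)
    (hdeg : ∀ v, 1 ≤ G.degree v) (hcard : Fintype.card V ≤ 2 ^ P.L) :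
    Triple G (setupProg P : List (Instr c (Node c) (Msg c k)))
      (fun σ => σ = fun v => initNode (decide (v = s)))
      (fun σ => ∃ b, GoodInfo G s P.L b ∧ Ready b σ)
      ((Fintype.card V : ℝ) ^ 2 * 2⁻¹ ^ c + P.L * (Fintype.card V * 2⁻¹ ^ P.θ)) := by
  have h1 : Triple G [(idInstr : Instr c (Node c) (Msg c k))]
      (fun σ => σ = fun v => initNode (decide (v = s))) (Estimating G s 0)
      ((Fintype.card V : ℝ) ^ 2 * 2⁻¹ ^ c) := by
    rintro σ rfl
    refine le_trans (failProb_mono fun τ hτ hinj => ?_) (failProb_idInstr_le _)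
    obtain ⟨ω, rfl⟩ := hτ
    refine ⟨fun v => rfl, fun v => rfl, hinj, fun v => rfl, fun v => le_rfl, fun v h => by omega,
      fun v => ?_⟩
    have := hdeg v
    show 2 ^ 0 ≤ _
    omega
  have h2 := h1.seq (triple_degreeProg (k := k) (N := P.θ) hc hdeg) (by positivity)
  rw [← hE] at h2
  refine h2.weaken (fun _ h => h) (fun σ h => ⟨fun v => (σ v).info, ⟨h.src, h.inj, h.cls_le,
    fun v => ?_, h.upper⟩, fun v => ⟨rfl, h.done v⟩⟩) le_rfl
  have hlt : G.degree v < 2 ^ P.L := (G.degree_lt_card_verts v).trans_le hcard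
  have hd := hdeg v
  -- Hence the density that must pass is among `1, …, L`.
  have hlog : Nat.log 2 (G.degree v) < P.L := Nat.log_lt_of_lt_pow (by omega) hlt
  exact (Nat.lt_pow_succ_log_self (by norm_num) _).trans_le
    (Nat.pow_le_pow_right (by norm_num) (h.lower v hlog))

end Setup

/-! ### The distance to a set of nodes -/

section SetDist

variable {V : Type*} {G : SimpleGraph V}

/-- The distance of a node to a set of nodes. -/
noncomputable def setDist (G : SimpleGraph V) (U : Set V) (v : V) : ℕ := sInf (G.dist v '' U)

theorem setDist_le {U : Set V} {u : V} (hu : u ∈ U) (v : V) : setDist G U v ≤ G.dist v u :=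
  Nat.sInf_le ⟨u, hu, rfl⟩

theorem exists_setDist_eq {U : Set V} (hU : U.Nonempty) (v : V) :
    ∃ u ∈ U, G.dist v u = setDist G U v :=
  Nat.sInf_mem (hU.image _)

theorem setDist_eq_zero_of_mem {U : Set V} {v : V} (hv : v ∈ U) : setDist G U v = 0 := by
  have := setDist_le (G := G) hv v
  simpa using this

theorem setDist_eq_zero_iff (hG : G.Connected) {U : Set V} (hU : U.Nonempty) {v : V} :
    setDist G U v = 0 ↔ v ∈ U := by
  refine ⟨fun h => ?_, setDist_eq_zero_of_mem⟩
  obtain ⟨u, hu, h'⟩ := exists_setDist_eq (G := G) hU v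
  rw [h, hG.dist_eq_zero_iff] at h'
  exact h' ▸ hu

theorem setDist_le_add (hG : G.Connected) {U : Set V} (hU : U.Nonempty) (v w : V) :
    setDist G U v ≤ G.dist v w + setDist G U w := by
  obtain ⟨u, hu, h⟩ := exists_setDist_eq (G := G) hU w
  rw [← h]
  exact (setDist_le hu v).trans hG.dist_triangle

theorem setDist_le_of_adj (hG : G.Connected) {U : Set V} (hU : U.Nonempty) {v w : V}
    (h : G.Adj v w) : setDist G U v ≤ setDist G U w + 1 := by
  have := setDist_le_add hG hU v w
  rw [SimpleGraph.dist_eq_one_iff_adj.2 h] at this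
  omega

theorem exists_adj_setDist (hG : G.Connected) {U : Set V} (hU : U.Nonempty) {v : V} {d : ℕ}
    (h : setDist G U v = d + 1) : ∃ y, G.Adj v y ∧ setDist G U y = d := by
  obtain ⟨u, hu, hd⟩ := exists_setDist_eq (G := G) hU v
  obtain ⟨p, hp⟩ := hG.exists_walk_length_eq_dist v u
  cases p with
  | nil => simp at hd; omega
  | cons hvy p =>
    rename_i y
    refine ⟨y, hvy, ?_⟩
    have h1 := setDist_le_of_adj hG hU hvy
    have h2 := (setDist_le (G := G) hu y).trans (SimpleGraph.dist_le p)
    simp only [SimpleGraph.Walk.length_cons] at hp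
    omega

theorem exists_dist_le_setDist (hG : G.Connected) {U : Set V} (hU : U.Nonempty) {v : V}
    {d r : ℕ} (h : setDist G U v = d + r) : ∃ y, G.dist v y ≤ r ∧ setDist G U y = d := by
  induction r generalizing v with
  | zero => exact ⟨v, by simp, h⟩
  | succ r ih =>
    obtain ⟨w, hvw, hw⟩ := exists_adj_setDist hG hU (d := d + r) h
    obtain ⟨y, hy, hd⟩ := ih hw
    refine ⟨y, ?_, hd⟩
    have := hG.dist_triangle (u := v) (v := w) (w := y)
    rw [SimpleGraph.dist_eq_one_iff_adj.2 hvw] at this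
    omega

end SetDist

/-! ### Slabs -/

section Slabs

variable {V : Type*} {G : SimpleGraph V}

/-- The nodes with time at most `j * X`. -/
def slab (t : V → ℕ) (X j : ℕ) : Set V := {v | t v ≤ j * X}

/-- The times at which the nodes have been informed in a flood from `s` that has proceeded by at
least `ρ` hops in every `X` phases. -/
structure Timing (G : SimpleGraph V) (s : V) (ρ X J : ℕ) (t : V → ℕ) : Prop where
  zero : ∀ v, t v = 0 ↔ v = s
  pred : ∀ v, v ≠ s → ∃ u, G.Adj v u ∧ t u < t v
  le : ∀ v, t v ≤ J * X
  thick : ∀ j u v, t u ≤ j * X → G.dist v u ≤ ρ → t v ≤ (j + 1) * X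

namespace Timing

variable {s : V} {ρ X J : ℕ} {t : V → ℕ}

theorem nonempty (h : Timing G s ρ X J t) (j : ℕ) : (slab t X j).Nonempty :=
  ⟨s, by simp [slab, (h.zero s).2 rfl]⟩

theorem slab_mono {i j : ℕ} (hij : i ≤ j) : slab t X i ⊆ slab t X j := fun _ hv =>
  le_trans (show _ ≤ i * X from hv) (Nat.mul_le_mul_right _ hij)

/-- Every node other than the source has a neighbour informed strictly earlier; following these
neighbours leads into the slab, and each hop lowers the time by at least one. -/
theorem setDist_le_sub (hG : G.Connected) (h : Timing G s ρ X J t) (j : ℕ) (v : V) :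
    setDist G (slab t X j) v ≤ t v - j * X := by
  induction ht : t v using Nat.strong_induction_on generalizing v with
  | _ n ih =>
    by_cases hv : t v ≤ j * X
    · rw [setDist_eq_zero_of_mem (show v ∈ slab t X j from hv)]
      exact Nat.zero_le _
    · have hvs : v ≠ s := fun hvs => by
        rw [(h.zero v).2 hvs] at hv
        exact hv (Nat.zero_le _)
      obtain ⟨u, hu, hlt⟩ := h.pred v hvs
      have h1 := ih (t u) (by omega) u rfl
      have h2 := setDist_le_of_adj hG (h.nonempty j) hu
      omega

/-- By thickness, `ρ` hops towards slab `j` from outside slab `j + k + 1` end outside slab `j + k`;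
so `k` layers of thickness `ρ` have to be crossed. -/
theorem lt_setDist (hG : G.Connected) (h : Timing G s ρ X J t) {j k : ℕ} {v : V}
    (hv : v ∉ slab t X (j + k)) : k * ρ < setDist G (slab t X j) v := by
  induction k generalizing v with
  | zero =>
    rw [zero_mul, Nat.pos_iff_ne_zero, Ne, setDist_eq_zero_iff hG (h.nonempty j)]
    exact hv
  | succ k ih =>
    by_cases hd : ρ ≤ setDist G (slab t X j) v
    · obtain ⟨d, hd⟩ := Nat.exists_eq_add_of_le' hd
      obtain ⟨w, hw, hwd⟩ := exists_dist_le_setDist hG (h.nonempty j) hd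
      have := ih (v := w) fun hw' => hv (h.thick (j + k) w v hw' hw)
      rw [hwd] at this
      rw [hd, add_mul, one_mul]
      omega
    · exfalso
      obtain ⟨u, hu, hdu⟩ := exists_setDist_eq (G := G) (h.nonempty j) v
      exact hv (slab_mono (by omega) (h.thick j u v hu (by omega) : v ∈ slab t X (j + 1)))

/-- The quotient is `a / X` rounded up, that is, the index of the first slab that contains a node
with time `a`. -/
theorem slab_index_iff (hX : 1 ≤ X) {a j : ℕ} :
    (a + X - 1) / X = j ↔ a ≤ j * X ∧ ∀ i, i < j → i * X < a := by
  have h1 := Nat.div_add_mod (a + X - 1) X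
  have h2 := Nat.mod_lt (a + X - 1) hX
  rw [mul_comm] at h1
  constructor
  · rintro rfl
    refine ⟨by omega, fun i hi => ?_⟩
    have := Nat.mul_le_mul_right X (Nat.succ_le_of_lt hi)
    rw [Nat.succ_mul] at this
    omega
  · rintro ⟨h3, h4⟩
    by_contra hne
    rcases lt_or_gt_of_ne hne with hlt | hlt
    · have := h4 _ hlt
      omega
    · have := Nat.mul_le_mul_right X (Nat.succ_le_of_lt hlt)
      rw [Nat.succ_mul] at this
      omega

/-- The smallest `j` such that the distance to the slab `j` is at most `X`. -/
noncomputable def index (G : SimpleGraph V) (t : V → ℕ) (X : ℕ) (v : V) : ℕ :=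
  sInf {j | setDist G (slab t X j) v ≤ X}

theorem index_spec (h : Timing G s ρ X J t) (v : V) :
    setDist G (slab t X (index G t X v)) v ≤ X :=
  Nat.sInf_mem (s := {j | setDist G (slab t X j) v ≤ X}) ⟨J, by
    rw [Set.mem_ofPred_eq, setDist_eq_zero_of_mem (show v ∈ slab t X J from h.le v)]
    exact Nat.zero_le _⟩

theorem index_le {v : V} {j : ℕ} (h : setDist G (slab t X j) v ≤ X) : index G t X v ≤ j :=
  Nat.sInf_le h

theorem index_le_count (h : Timing G s ρ X J t) (v : V) : index G t X v ≤ J :=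
  index_le (by
    rw [setDist_eq_zero_of_mem (show v ∈ slab t X J from h.le v)]
    exact Nat.zero_le _)

/-- A node of slab `j + 1` is within distance `X` of slab `j`, so `j + 1` is not minimal; and slab
`0` contains only the source. Hence the distance that enters the layer is positive. -/
theorem notMem_slab_index (hG : G.Connected) (h : Timing G s ρ X J t) {v : V} (hv : v ≠ s) :
    v ∉ slab t X (index G t X v) := by
  intro hmem
  rcases hi : index G t X v with _ | j
  · rw [hi] at hmem
    have : t v ≤ 0 * X := hmem
    rw [zero_mul, Nat.le_zero, h.zero] at this
    exact hv this
  · rw [hi] at hmem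
    have h1 := h.setDist_le_sub hG j v
    have h2 : t v ≤ (j + 1) * X := hmem
    rw [add_mul, one_mul] at h2
    have := index_le (G := G) (t := t) (v := v) (h1.trans (by omega))
    omega

theorem index_source (h : Timing G s ρ X J t) : index G t X s = 0 :=
  Nat.le_zero.1 (index_le (by
    rw [setDist_eq_zero_of_mem (show s ∈ slab t X 0 by simp [slab, (h.zero s).2 rfl])]
    exact Nat.zero_le _))

/-- Slab `j + 1` contains everything within `ρ ≥ 2` hops of slab `j`. Passing to it shortens the
distance of `u` by two, which pays for the way from `v` to `u`. -/
theorem index_le_succ (hG : G.Connected) (h : Timing G s ρ X J t) (hρ : 2 ≤ ρ) (hX : 2 ≤ X)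
    {u v : V} (huv : G.dist v u ≤ 2) : index G t X v ≤ index G t X u + 1 := by
  set j := index G t X u
  refine index_le ?_
  have hu : setDist G (slab t X j) u ≤ X := h.index_spec u
  have hle := setDist_le_add hG (h.nonempty (j + 1)) v u
  by_cases hd : 2 ≤ setDist G (slab t X j) u
  · obtain ⟨d, hd⟩ := Nat.exists_eq_add_of_le hd
    obtain ⟨w, hw, hwd⟩ := exists_dist_le_setDist hG (h.nonempty j) hd
    obtain ⟨x, hx, hxd⟩ := exists_setDist_eq (G := G) (h.nonempty j) w
    have hmem : w ∈ slab t X (j + 1) := h.thick j x w hx (by omega)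
    have := setDist_le (G := G) hmem u
    omega
  · obtain ⟨x, hx, hxd⟩ := exists_setDist_eq (G := G) (h.nonempty j) u
    have hmem : u ∈ slab t X (j + 1) := h.thick j x u hx (by omega)
    rw [setDist_eq_zero_of_mem hmem] at hle
    omega

/-- The layer of a node. -/
noncomputable def layer (G : SimpleGraph V) (t : V → ℕ) (X : ℕ) (v : V) : ℕ :=
  index G t X v * (X + 1) + setDist G (slab t X (index G t X v)) v

theorem layer_eq_zero_iff (hG : G.Connected) (h : Timing G s ρ X J t) (v : V) :
    layer G t X v = 0 ↔ v = s := by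
  constructor
  · intro hl
    by_contra hv
    have h1 := h.notMem_slab_index hG hv
    rw [← setDist_eq_zero_iff hG (h.nonempty _)] at h1
    unfold layer at hl
    omega
  · rintro rfl
    unfold layer
    rw [h.index_source, setDist_eq_zero_of_mem (show v ∈ slab t X 0 by
      simp [slab, (h.zero v).2 rfl])]
    simp

/-- The node `y` is within range of the same slab, so its index is not larger. If it is smaller, the
layer drops as well, since a block has `X + 1` layers and distances are at most `X`. -/
theorem layer_lt_of_setDist (h : Timing G s ρ X J t) {v y : V}
    (hy : setDist G (slab t X (index G t X v)) y + 1 =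
      setDist G (slab t X (index G t X v)) v) : layer G t X y < layer G t X v := by
  have h1 := h.index_spec v
  have h2 : index G t X y ≤ index G t X v := index_le (by omega)
  have h3 := h.index_spec y
  rcases h2.eq_or_lt with h2 | h2
  · unfold layer
    rw [h2]
    omega
  · unfold layer
    have := Nat.mul_le_mul_right (X + 1) (Nat.succ_le_of_lt h2)
    rw [Nat.succ_mul] at this
    omega

theorem layer_le (h : Timing G s ρ X J t) (v : V) : layer G t X v ≤ J * (X + 1) + X :=
  add_le_add (Nat.mul_le_mul_right _ (h.index_le_count v)) (h.index_spec v)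

/-- The colour of a node. -/
noncomputable def color (G : SimpleGraph V) (t : V → ℕ) (X : ℕ) (v : V) : ℕ :=
  3 * (index G t X v % 2) + setDist G (slab t X (index G t X v)) v % 3

/-- With equal indices the distances are to the same slab, so they differ by one or two and hence
modulo three. With different indices these differ by exactly one, hence in parity. -/
theorem color_ne (hG : G.Connected) (h : Timing G s ρ X J t) (hρ : 2 ≤ ρ) (hX : 2 ≤ X) {u v : V}
    (huv : G.dist u v ≤ 2) (hne : layer G t X u ≠ layer G t X v) :
    color G t X u ≠ color G t X v := by
  have h1 := h.index_le_succ hG hρ hX huv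
  have h2 := h.index_le_succ hG hρ hX (u := v) (v := u) huv
  have h3 := h.index_le_succ hG hρ hX (u := u) (v := v) (by rwa [SimpleGraph.dist_comm])
  unfold color
  by_cases hi : index G t X u = index G t X v
  · unfold layer at hne
    rw [hi] at hne ⊢
    have h4 := setDist_le_add hG (h.nonempty (index G t X v)) u v
    have h5 := setDist_le_add hG (h.nonempty (index G t X v)) v u
    rw [SimpleGraph.dist_comm] at h5
    omega
  · omega

end Timing

end Slabs

/-! ### Breadth-first searches from the slabs -/

section Bfs

variable {c k : ℕ} {V : Type*} {G : SimpleGraph V}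

/-- The state of the breadth-first searches up to distance `d`. -/
structure Bfs (G : SimpleGraph V) (b : V → Info c) (t : V → ℕ) (X d : ℕ) (σ : V → Node c) :
    Prop where
  info : ∀ v, (σ v).info = b v
  done : ∀ v, (σ v).done = false
  time : ∀ v, (σ v).time = some (t v)
  sound : ∀ v j e i, (σ v).tab j = some (e, i) → v ∉ slab t X j ∧
    e = setDist G (slab t X j) v ∧
    ∃ y, G.Adj v y ∧ setDist G (slab t X j) y + 1 = e ∧ i = (b y).id
  complete : ∀ v j, v ∉ slab t X j → setDist G (slab t X j) v ≤ d → (σ v).tab j ≠ none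

variable {s : V} {ρ X J d md l r : ℕ} {t : V → ℕ} {b : V → Info c} {σ : V → Node c}

theorem Bfs.of_level (hX : 1 ≤ X) (hσ : Bfs G b t X d σ) {v : V} {j e : ℕ}
    (h : level X j (σ v) = some e) :
    setDist G (slab t X j) v = e ∧ ∀ i, i < j → v ∉ slab t X i := by
  simp only [level, hσ.time] at h
  split_ifs at h with hs
  · obtain ⟨h1, h2⟩ := (Timing.slab_index_iff hX).1 hs
    refine ⟨?_, fun i hi => not_le.2 (h2 i hi)⟩
    rw [setDist_eq_zero_of_mem (show v ∈ slab t X j from h1)]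
    simpa using h
  · obtain ⟨⟨e', i⟩, h1, rfl⟩ := Option.map_eq_some_iff.1 h
    obtain ⟨h2, h3, -⟩ := hσ.sound v j e' i h1
    exact ⟨h3.symm, fun i hi hv => h2 (Timing.slab_mono hi.le hv)⟩

theorem Bfs.level_eq (hX : 1 ≤ X) (hσ : Bfs G b t X d σ) {v : V} {j : ℕ}
    (h1 : setDist G (slab t X j) v = d) (h2 : ∀ i, i < j → v ∉ slab t X i) :
    level X j (σ v) = some d := by
  simp only [level, hσ.time]
  by_cases hv : v ∈ slab t X j
  · rw [if_pos ((Timing.slab_index_iff hX).2 ⟨hv, fun i hi => not_le.1 (h2 i hi)⟩)]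
    rw [setDist_eq_zero_of_mem hv] at h1
    rw [h1]
  · rw [if_neg fun hs => hv ((Timing.slab_index_iff hX).1 hs).1]
    obtain ⟨⟨e, i⟩, he⟩ := Option.ne_none_iff_exists'.1 (hσ.complete v j hv h1.le)
    obtain ⟨-, h3, -⟩ := hσ.sound v j e i he
    rw [he, Option.map_some, h3, h1]

/-- The packets of a round of a breadth-first search. -/
theorem Bfs.of_tx (hX : 1 ≤ X) (ht : Timing G s ρ X J t) (hJ : J < 2 ^ k)
    (hσ : Bfs G b t X d σ) {u : V} {m : Msg c k}
    (h : (bfsInstr X md d l r : Instr c (Node c) (Msg c k)).tx (σ u) = some m) :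
    m.1 = (b u).id ∧ (m.2 : ℕ) % md = l ∧ setDist G (slab t X m.2) u = d ∧
      ∀ i, i < (m.2 : ℕ) → u ∉ slab t X i := by
  simp only [bfsInstr] at h
  split_ifs at h with hex
  obtain rfl := Option.some.inj h
  obtain ⟨h1, h2⟩ := hex.choose_spec
  obtain ⟨h3, h4⟩ := hσ.of_level hX h2
  have h5 : hex.choose ≤ J := by
    by_contra! hcon
    exact h4 J hcon (ht.le u)
  -- A root or searched node of index `j` lies in no earlier slab, while slab `J` contains all
  -- nodes; so the index fits into the packet without wrapping around.
  have h6 : ((Fin.ofNat (2 ^ k) hex.choose : Fin (2 ^ k)) : ℕ) = hex.choose := by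
    simp only [Fin.val_ofNat]
    exact Nat.mod_eq_of_lt (by omega)
  refine ⟨by rw [hσ.info], ?_⟩
  simp only [h6]
  exact ⟨h1, h3, h4⟩

theorem Bfs.tx_isSome_iff (hX : 1 ≤ X) (hσ : Bfs G b t X d σ) {u : V} :
    ((bfsInstr X md d l r : Instr c (Node c) (Msg c k)).tx (σ u)).isSome ↔
      ∃ j, j % md = l ∧ setDist G (slab t X j) u = d ∧ ∀ i, i < j → u ∉ slab t X i := by
  have : ((bfsInstr X md d l r : Instr c (Node c) (Msg c k)).tx (σ u)).isSome ↔
      ∃ j, j % md = l ∧ level X j (σ u) = some d := by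
    simp only [bfsInstr]
    split_ifs with h
    · simpa using h
    · simpa using h
  rw [this]
  refine exists_congr fun j => and_congr_right fun _ => ⟨hσ.of_level hX, fun h => ?_⟩
  exact hσ.level_eq hX h.1 h.2

theorem bfsInstr_step_of_none (v : V) (ω : V → Fin c → Bool)
    (h : radioReceive G (sent (bfsInstr X md d l r : Instr c (Node c) (Msg c k)) σ ω) v = none) :
    step G (bfsInstr X md d l r : Instr c (Node c) (Msg c k)) σ ω v = σ v := by
  simp only [step, h]
  rfl

open Classical in
theorem Bfs.step_of_some (hσ : Bfs G b t X d σ) {v : V} {ω : V → Fin c → Bool} {m : Msg c k}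
    (h : radioReceive G (sent (bfsInstr X md d l r : Instr c (Node c) (Msg c k)) σ ω) v =
      some m) :
    step G (bfsInstr X md d l r : Instr c (Node c) (Msg c k)) σ ω v =
      if (σ v).tab m.2 = none ∧ v ∉ slab t X m.2 then
        { σ v with tab := Function.update (σ v).tab m.2 (some (d + 1, m.1)) } else σ v := by
  have h' : (∃ a, (σ v).time = some a ∧ (m.2 : ℕ) * X < a) ↔ v ∉ slab t X m.2 := by
    rw [hσ.time]
    simp [slab]
  simp only [step, h]
  simp only [bfsInstr, h']

theorem Bfs.step_tab_ne_none (hσ : Bfs G b t X d σ) (ω : V → Fin c → Bool) {v : V} {j : ℕ}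
    (h : (σ v).tab j ≠ none) :
    (step G (bfsInstr X md d l r : Instr c (Node c) (Msg c k)) σ ω v).tab j ≠ none := by
  rcases hr : radioReceive G
    (sent (bfsInstr X md d l r : Instr c (Node c) (Msg c k)) σ ω) v with _ | m
  · rwa [bfsInstr_step_of_none v ω hr]
  · rw [hσ.step_of_some hr]
    split_ifs with hs
    · simp only [Function.update_apply]
      split_ifs
      · simp
      · exact h
    · exact h

/-- A node without an entry has distance greater than `d` by completeness, and the sender of the
packet has distance `d`. So the distance written is exactly right, whoever was heard. -/
theorem Bfs.step (hG : G.Connected) (hX : 1 ≤ X) (ht : Timing G s ρ X J t) (hJ : J < 2 ^ k)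
    (hσ : Bfs G b t X d σ) (ω : V → Fin c → Bool) :
    Bfs G b t X d (step G (bfsInstr X md d l r : Instr c (Node c) (Msg c k)) σ ω) := by
  have key : ∀ v, RadioLayering.step G
      (bfsInstr X md d l r : Instr c (Node c) (Msg c k)) σ ω v = σ v ∨
      ∃ m : Msg c k, v ∉ slab t X m.2 ∧ setDist G (slab t X m.2) v = d + 1 ∧
        (∃ y, G.Adj v y ∧ setDist G (slab t X m.2) y = d ∧ m.1 = (b y).id) ∧
        RadioLayering.step G (bfsInstr X md d l r : Instr c (Node c) (Msg c k)) σ ω v =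
          { σ v with tab := Function.update (σ v).tab m.2 (some (d + 1, m.1)) } := by
    intro v
    rcases hr : radioReceive G
      (sent (bfsInstr X md d l r : Instr c (Node c) (Msg c k)) σ ω) v with _ | m
    · exact Or.inl (bfsInstr_step_of_none v ω hr)
    · rw [hσ.step_of_some hr]
      split_ifs with hs
      · obtain ⟨y, hy, -, htx⟩ := exists_of_receive hr
        obtain ⟨h1, -, h2, -⟩ := hσ.of_tx hX ht hJ htx
        refine Or.inr ⟨m, hs.2, ?_, ⟨y, hy, h2, h1⟩, rfl⟩
        have h3 := setDist_le_of_adj hG (ht.nonempty m.2) hy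
        have h4 : ¬ setDist G (slab t X m.2) v ≤ d := fun h => hσ.complete v _ hs.2 h hs.1
        omega
      · exact Or.inl rfl
  constructor
  · intro v
    rcases key v with h | ⟨m, -, -, -, h⟩ <;> rw [h] <;> exact hσ.info v
  · intro v
    rcases key v with h | ⟨m, -, -, -, h⟩ <;> rw [h] <;> exact hσ.done v
  · intro v
    rcases key v with h | ⟨m, -, -, -, h⟩ <;> rw [h] <;> exact hσ.time v
  · intro v j e i he
    rcases key v with h | ⟨m, h1, h2, ⟨y, h3, h4, h5⟩, h⟩
    · rw [h] at he
      exact hσ.sound v j e i he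
    · rw [h] at he
      simp only [Function.update_apply] at he
      split_ifs at he with hj
      · subst hj
        simp only [Option.some.injEq, Prod.mk.injEq] at he
        obtain ⟨rfl, rfl⟩ := he
        exact ⟨h1, h2.symm, y, h3, by rw [h4], h5⟩
      · exact hσ.sound v j e i he
  · intro v j h1 h2
    exact hσ.step_tab_ne_none ω (hσ.complete v j h1 h2)

/-- Searches from slabs whose indices are congruent do not interfere. -/
theorem Bfs.eq_of_receive (hG : G.Connected) (hX : 1 ≤ X) (ht : Timing G s ρ X J t)
    (hJ : J < 2 ^ k) (hd : d < X) (hmd : X + 1 ≤ (md - 1) * ρ) (hσ : Bfs G b t X d σ)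
    {v : V} {j : ℕ} (hj : j % md = l) (hv : v ∉ slab t X j)
    (hvd : setDist G (slab t X j) v = d + 1) {ω : V → Fin c → Bool} {m : Msg c k}
    (h : radioReceive G (sent (bfsInstr X md d l r : Instr c (Node c) (Msg c k)) σ ω) v =
      some m) : (m.2 : ℕ) = j := by
  obtain ⟨u, huv, -, htx⟩ := exists_of_receive h
  obtain ⟨-, h1, h2, h3⟩ := hσ.of_tx hX ht hJ htx
  have hmd1 : 1 ≤ md := by
    by_contra! hcon
    rw [Nat.lt_one_iff] at hcon
    simp [hcon] at hmd
  have hmod : ∀ x y : ℕ, x % md = l → y % md = l → x < y → x + md ≤ y := by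
    intro x y hx hy hxy
    have e1 := Nat.div_add_mod x md
    have e2 := Nat.div_add_mod y md
    have : x / md < y / md := by
      by_contra! hcon
      have := Nat.mul_le_mul_left md hcon
      omega
    have := Nat.mul_le_mul_left md (Nat.succ_le_of_lt this)
    rw [Nat.mul_succ] at this
    omega
  by_contra hne
  rcases lt_or_gt_of_ne hne with hlt | hlt
  -- The packet belongs to an earlier slab, at least `md` indices before `j`. As `v` is outside slab
  -- `j`, it is more than `md * ρ > X` hops away from that slab, but the packet shows at most `d + 1
  -- ≤ X`.
  · have h4 := hmod _ _ h1 hj hlt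
    obtain ⟨e, rfl⟩ := Nat.exists_eq_add_of_le h4
    have h5 := ht.lt_setDist hG (j := m.2) (k := md) (v := v)
      fun h => hv (Timing.slab_mono (by omega) h)
    have h6 := setDist_le_of_adj hG (ht.nonempty m.2) huv
    have : (md - 1) * ρ ≤ md * ρ := Nat.mul_le_mul_right _ (by omega)
    omega
  -- The packet belongs to a later slab. Its sender lies outside all slabs before that one, in
  -- particular outside slab `j + (md - 1)`, so it is more than `(md - 1) * ρ ≥ X + 1` hops from
  -- slab `j`; but it is a neighbour of `v`, hence at most `d + 2 ≤ X + 1` hops away.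
  · have h4 := hmod _ _ hj h1 hlt
    have h5 := ht.lt_setDist hG (j := j) (k := md - 1) (v := u)
      (h3 (j + (md - 1)) (by omega))
    have h6 := setDist_le_of_adj hG (ht.nonempty j) huv.symm
    omega

theorem Bfs.of_reach_decay {L : ℕ} (hG : G.Connected) (hX : 1 ≤ X) (ht : Timing G s ρ X J t)
    (hJ : J < 2 ^ k) {p : List (Instr c (Node c) (Msg c k))}
    (hp : ∀ i ∈ p, i ∈ (bfsDecay L X md d l : List (Instr c (Node c) (Msg c k))))
    {τ : V → Node c} (h : Reach G p σ τ) (hσ : Bfs G b t X d σ) :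
    Bfs G b t X d τ ∧ ∀ v j, (σ v).tab j ≠ none → (τ v).tab j ≠ none := by
  refine h.invariant (I := fun τ => Bfs G b t X d τ ∧
    ∀ v j, (σ v).tab j ≠ none → (τ v).tab j ≠ none) (fun i hi τ ω hτ => ?_) ⟨hσ, fun _ _ h => h⟩
  obtain ⟨r, -, rfl⟩ := List.mem_map.1 (hp i hi)
  exact ⟨hτ.1.step hG hX ht hJ ω, fun v j h => hτ.1.step_tab_ne_none ω (hτ.2 v j h)⟩

variable [Fintype V] [DecidableEq V] [DecidableRel G.Adj]

/-- The next node on a shortest path from `v` to the slab transmits, and one of the densities fits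
the number of transmitting neighbours. By `Bfs.eq_of_receive` whatever `v` then receives concerns
slab `j`. -/
theorem Bfs.failProb_decay_le {L : ℕ} (hL : L ≤ c) (hG : G.Connected) (hX : 1 ≤ X)
    (ht : Timing G s ρ X J t) (hJ : J < 2 ^ k) (hρ : 1 ≤ ρ) (hd : d < X)
    (hmd : X + 1 ≤ (md - 1) * ρ)
    (hσ : Bfs G b t X d σ) {v : V} {j : ℕ} (hj : j % md = l) (hv : v ∉ slab t X j)
    (hvd : setDist G (slab t X j) v = d + 1) (hdeg : G.degree v < 2 ^ L) :
    failProb G (bfsDecay L X md d l : List (Instr c (Node c) (Msg c k)))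
      (fun τ => (τ v).tab j ≠ none) σ ≤ 7 / 8 := by
  classical
  set A : Finset V := {u | G.Adj v u ∧
    ∃ j, j % md = l ∧ setDist G (slab t X j) u = d ∧ ∀ i, i < j → u ∉ slab t X i} with hA
  obtain ⟨y, hvy, hy⟩ := exists_adj_setDist hG (ht.nonempty j) hvd
  have hyA : y ∈ A := by
    simp only [hA, mem_filter, mem_univ, true_and]
    -- Roots act only for the first slab that contains them. If `y` were in an earlier slab, its
    -- neighbour `v` would lie in slab `j` by thickness.
    refine ⟨hvy, j, hj, hy, fun i hi hyi => hv ?_⟩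
    have := ht.thick i y v hyi (by rw [SimpleGraph.dist_eq_one_iff_adj.2 hvy]; exact hρ)
    exact Timing.slab_mono (show i + 1 ≤ j from hi) this
  have hApos : #A ≠ 0 := (card_pos.2 ⟨y, hyA⟩).ne'
  have hAle : #A ≤ G.degree v := card_le_card fun w hw => by
    simp only [hA, mem_filter] at hw
    simpa using hw.2.1
  set r := Nat.log 2 #A with hr
  have hr1 : 2 ^ r ≤ #A := Nat.pow_log_le_self 2 hApos
  have hr2 : #A < 2 ^ (r + 1) := Nat.lt_pow_succ_log_self (by norm_num) _
  have hre : r < L := (Nat.pow_lt_pow_iff_right (by norm_num : 1 < 2)).1 (by omega)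
  have hmem : (bfsInstr X md d l (r + 1) : Instr c (Node c) (Msg c k)) ∈ bfsDecay L X md d l :=
    List.mem_map.2 ⟨r, List.mem_range.2 (by omega), rfl⟩
  obtain ⟨p₁, p₂, hp⟩ := List.append_of_mem hmem
  rw [hp]
  refine failProb_le_of_receive (v := v) (i := bfsInstr X md d l (r + 1))
    (show r + 1 ≤ c by omega) (show 1 ≤ r + 1 by omega) fun τ hτ => ?_
  have hτ := (Bfs.of_reach_decay hG hX ht hJ (fun i hi => by rw [hp]; simp [hi]) hτ hσ).1
  refine ⟨⟨A, fun w => ?_, ?_, ?_⟩, fun ω hω σ' hσ' => ?_⟩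
  · rw [hτ.tx_isSome_iff hX]
    simp [hA]
  · show 2 ^ (r + 1) ≤ _
    rw [pow_succ]; omega
  · exact hr2
  · refine (Bfs.of_reach_decay hG hX ht hJ (L := L) (fun i hi => by rw [hp]; simp [hi]) hσ'
      (hτ.step hG hX ht hJ ω)).2 v j ?_
    obtain ⟨m, hm⟩ := Option.isSome_iff_exists.1 hω
    have hmj := hτ.eq_of_receive hG hX ht hJ hd hmd hj hv hvd hm
    rw [hτ.step_of_some hm, hmj]
    split_ifs with hs
    · simp
    · exact fun h => hs ⟨h, hv⟩

/-- The searches for the first `n` residue classes have reached distance `d + 1`. -/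
def BfsClass (G : SimpleGraph V) (b : V → Info c) (t : V → ℕ) (X md d n : ℕ) (σ : V → Node c) :
    Prop :=
  Bfs G b t X d σ ∧ ∀ v j, j % md < n → v ∉ slab t X j → setDist G (slab t X j) v = d + 1 →
    (σ v).tab j ≠ none

theorem triple_bfsClass {L N : ℕ} (hL : L ≤ c) (hG : G.Connected) (hX : 1 ≤ X)
    (ht : Timing G s ρ X J t) (hJ : J < 2 ^ k) (hρ : 1 ≤ ρ) (hd : d < X)
    (hmd : X + 1 ≤ (md - 1) * ρ) (hdeg : ∀ v, G.degree v < 2 ^ L) :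
    Triple G ((List.replicate N (bfsDecay L X md d l)).flatten :
        List (Instr c (Node c) (Msg c k)))
      (BfsClass G b t X md d l) (BfsClass G b t X md d (l + 1))
      (Fintype.card V * J * (7 / 8) ^ N) := by
  classical
  intro σ hσ
  have hinv : ∀ τ, Reach G ((List.replicate N (bfsDecay L X md d l)).flatten :
      List (Instr c (Node c) (Msg c k))) σ τ →
      Bfs G b t X d τ ∧ ∀ v j, (σ v).tab j ≠ none → (τ v).tab j ≠ none := fun τ hτ =>
    Bfs.of_reach_decay hG hX ht hJ (fun i hi => by
      obtain ⟨q, hq, hi⟩ := List.mem_flatten.1 hi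
      rwa [List.eq_of_mem_replicate hq] at hi) hτ hσ.1
  have h1 : ∀ x : V × Fin J, failProb G ((List.replicate N (bfsDecay L X md d l)).flatten :
      List (Instr c (Node c) (Msg c k))) (fun τ => (x.2 : ℕ) % md = l → x.1 ∉ slab t X x.2 →
        setDist G (slab t X x.2) x.1 = d + 1 → (τ x.1).tab x.2 ≠ none) σ ≤ (7 / 8) ^ N := by
    rintro ⟨v, j⟩
    by_cases hx : (j : ℕ) % md = l ∧ v ∉ slab t X j ∧ setDist G (slab t X j) v = d + 1
    · have := failProb_replicate_le (G := G) (p := bfsDecay L X md d l)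
        (I := Bfs G b t X d) (Q := fun τ : V → Node c => (τ v).tab j ≠ none)
        (δ := 7 / 8) (by norm_num)
        (fun σ τ h1 h2 => (Bfs.of_reach_decay hG hX ht hJ (fun _ h => h) h2 h1).1)
        (fun σ τ h1 h3 h2 => (Bfs.of_reach_decay hG hX ht hJ (fun _ h => h) h2 h1).2 v j h3)
        (fun σ h1 _ => h1.failProb_decay_le (k := k) hL hG hX ht hJ hρ hd hmd hx.1 hx.2.1 hx.2.2
          (hdeg v)) N σ hσ.1
      refine (failProb_mono fun τ _ h _ _ _ => h).trans (this.trans ?_)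
      split_ifs
      · positivity
      · exact le_rfl
    · rw [failProb_eq_zero fun τ _ h1 h2 h3 => absurd ⟨h1, h2, h3⟩ hx]
      positivity
  have h2 := failProb_forall_le h1
  rw [Fintype.card_prod, Fintype.card_fin, Nat.cast_mul] at h2
  refine (failProb_mono fun τ hτ h => ⟨(hinv τ hτ).1, fun v j hj hv hvd => ?_⟩).trans h2
  rcases (Nat.lt_succ_iff_lt_or_eq.1 hj) with hj | hj
  · exact (hinv τ hτ).2 v j (hσ.2 v j hj hv hvd)
  -- The union bound runs over finitely many indices only, since slab `J` contains every node.
  · have hjJ : j < J := by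
      by_contra! hcon
      exact hv (Timing.slab_mono hcon (ht.le v))
    exact h (v, ⟨j, hjJ⟩) hj hv hvd

theorem triple_bfsLayer {L N : ℕ} (hL : L ≤ c) (hG : G.Connected) (hX : 1 ≤ X)
    (ht : Timing G s ρ X J t) (hJ : J < 2 ^ k) (hρ : 1 ≤ ρ) (hd : d < X)
    (hmd : X + 1 ≤ (md - 1) * ρ) (hdeg : ∀ v, G.degree v < 2 ^ L) (n : ℕ) :
    Triple G (bfsLayer N L X md d n : List (Instr c (Node c) (Msg c k)))
      (Bfs G b t X d) (BfsClass G b t X md d n)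
      (n * (Fintype.card V * J * (7 / 8) ^ N)) := by
  induction n with
  | zero =>
    simpa [bfsLayer] using Triple.of_reach (G := G) fun σ τ h h' => by
      rw [h']; exact ⟨h, fun v j hj => absurd hj (by simp)⟩
  | succ n ih =>
    refine (ih.seq (triple_bfsClass hL hG hX ht hJ hρ hd hmd hdeg) (by positivity)).weaken
      (fun _ h => h) (fun _ h => h) (le_of_eq ?_)
    push_cast
    ring

theorem triple_bfsProg {L N : ℕ} (hL : L ≤ c) (hG : G.Connected)
    (ht : Timing G s ρ X J t) (hJ : J < 2 ^ k) (hρ : 1 ≤ ρ)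
    (hmd : X + 1 ≤ (md - 1) * ρ) (hdeg : ∀ v, G.degree v < 2 ^ L) {n : ℕ} (hn : n ≤ X) :
    Triple G (bfsProg N L X md n : List (Instr c (Node c) (Msg c k)))
      (Bfs G b t X 0) (Bfs G b t X n)
      (n * (md * (Fintype.card V * J * (7 / 8) ^ N))) := by
  induction n with
  | zero => simpa [bfsProg] using Triple.of_reach (G := G) fun σ τ h h' => by rw [h']; exact h
  | succ n ih =>
    have hmd1 : 0 < md := by
      by_contra! hcon
      rw [Nat.le_zero] at hcon
      simp [hcon] at hmd
    refine ((ih (by omega)).seq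
      (triple_bfsLayer hL hG (by omega) ht hJ hρ (by omega) hmd hdeg md)
      (by positivity)).weaken (fun _ h => h) (fun σ h => ?_) (le_of_eq ?_)
    · refine ⟨h.1.info, h.1.done, h.1.time, h.1.sound, fun v j hv hvd => ?_⟩
      rcases hvd.eq_or_lt with hvd | hvd
      · exact h.2 v j (Nat.mod_lt _ hmd1) hv hvd
      · exact h.1.complete v j hv (by omega)
    · push_cast
      ring

end Bfs

/-! ### The analysis of an attempt -/

section Attempt

variable {c k : ℕ} {V : Type*} {G : SimpleGraph V}

/-- Exactly the nodes of `A` are informed, and they start a flood. -/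
structure Start (b : V → Info c) (A : Set V) (σ : V → Node c) : Prop where
  ready : Ready b σ
  time_of_mem : ∀ v, v ∈ A → (σ v).time = some 0
  time_of_notMem : ∀ v, v ∉ A → (σ v).time = none

/-- The configurations of a flood from `A` before phase `m`. -/
structure FloodInv (G : SimpleGraph V) (b : V → Info c) (q lam : ℕ) (A : Set V) (m : ℕ)
    (σ : V → Node c) : Prop where
  ready : Ready b σ
  lt : ∀ v a, (σ v).time = some a → a < m
  zero : ∀ v, (σ v).time = some 0 ↔ v ∈ A
  pred : ∀ v a, (σ v).time = some a → a = 0 ∨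
    ∃ u a', G.Adj v u ∧ (σ u).time = some a' ∧ a' + wt q lam (b u).cls ≤ a

variable {b : V → Info c} {A : Set V} {q lam m n L : ℕ} {σ τ : V → Node c}

theorem Start.floodInv (h : Start b A σ) : FloodInv G b q lam A 1 σ := by
  have h0 : ∀ v a, (σ v).time = some a → a = 0 ∧ v ∈ A := by
    intro v a ha
    by_cases hv : v ∈ A
    · rw [h.time_of_mem v hv] at ha
      exact ⟨(Option.some.inj ha).symm, hv⟩
    · rw [h.time_of_notMem v hv] at ha
      cases ha
  exact ⟨h.ready, fun v a ha => by have := (h0 v a ha).1; omega,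
    fun v => ⟨fun hv => (h0 v 0 hv).2, h.time_of_mem v⟩, fun v a ha => Or.inl (h0 v a ha).1⟩

theorem FloodInv.phase (hm : 1 ≤ m) (h : FloodInv G b q lam A m σ)
    (hr : PhaseRel G q lam m σ τ) : FloodInv G b q lam A (m + 1) τ := by
  constructor
  · intro v
    refine ⟨(hr.info v).trans (h.ready v).1, ?_⟩
    rcases hr v with hv | ⟨-, -, hv⟩ <;> rw [hv] <;> exact (h.ready v).2
  · intro v a ha
    rcases hr v with hv | ⟨-, -, hv⟩
    · rw [hv] at ha
      exact (h.lt v a ha).trans (Nat.lt_succ_self m)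
    · rw [hv] at ha
      have := Option.some.inj ha
      omega
  · intro v
    rw [← h.zero]
    rcases hr v with hv | ⟨h1, -, hv⟩
    · rw [hv]
    · rw [hv, h1]
      simp only [Option.some.injEq, reduceCtorEq, iff_false]
      omega
  · intro v a ha
    rcases hr v with hv | ⟨-, ⟨u, hu, a', ha', hle⟩, hv⟩
    · rw [hv] at ha
      rcases h.pred v a ha with h0 | ⟨u, a', hu, ha', hle⟩
      · exact Or.inl h0
      · exact Or.inr ⟨u, a', hu, hr.time_eq ha', hle⟩
    · rw [hv] at ha
      rw [(h.ready u).1] at hle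
      exact Or.inr ⟨u, a', hu, hr.time_eq ha', by have := Option.some.inj ha; omega⟩

theorem FloodInv.of_reach (hm : 1 ≤ m) (h : FloodInv G b q lam A m σ)
    (hr : Reach G (flood L q lam m n : List (Instr c (Node c) (Msg c k))) σ τ) :
    FloodInv G b q lam A (m + n) τ :=
  (hr.flood_invariant (I := fun m σ => 1 ≤ m ∧ FloodInv G b q lam A m σ)
    (fun _ _ _ h hr => ⟨by omega, h.2.phase h.1 hr⟩) ⟨hm, h⟩).2

/-- Going back to the informant lowers the time by at least the delay of the informant, and these
delays are what the cost counts. No randomness is involved, which is what makes the test of `lam`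
reliable. -/
theorem FloodInv.exists_walk (h : FloodInv G b q lam A m σ) {v : V} {a : ℕ}
    (ha : (σ v).time = some a) :
    ∃ u ∈ A, ∃ p : G.Walk v u, walkCost (fun v => wt q lam (b v).cls) p ≤ a := by
  induction a using Nat.strong_induction_on generalizing v with
  | _ a ih =>
    rcases h.pred v a ha with rfl | ⟨u, a', hu, ha', hle⟩
    · exact ⟨v, (h.zero v).1 ha, .nil, le_rfl⟩
    · have := wt_pos q lam (b u).cls
      obtain ⟨x, hx, p, hp⟩ := ih a' (by omega) ha'
      exact ⟨x, hx, .cons hu p, by simp only [walkCost]; omega⟩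

theorem flood_tab (hr : Reach G (flood L q lam m n : List (Instr c (Node c) (Msg c k))) σ τ)
    (v : V) : (τ v).tab = (σ v).tab :=
  hr.flood_invariant (I := fun _ τ => (τ v).tab = (σ v).tab) (fun _ ρ τ h hr => by
    rcases hr v with hv | ⟨-, -, hv⟩ <;> rw [hv] <;> exact h) rfl

theorem flood_time_eq (hr : Reach G (flood L q lam m n : List (Instr c (Node c) (Msg c k))) σ τ)
    {v : V} {a : ℕ} (ha : (σ v).time = some a) : (τ v).time = some a :=
  hr.flood_invariant (I := fun _ τ => (τ v).time = some a) (fun _ _ _ h hr => hr.time_eq h) ha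

theorem flood_le_time (hr : Reach G (flood L q lam m n : List (Instr c (Node c) (Msg c k))) σ τ)
    {v : V} {a : ℕ} (hv : (σ v).time = none) (ha : (τ v).time = some a) : m ≤ a :=
  (hr.flood_invariant (I := fun m' τ => m ≤ m' ∧ ∀ a, (τ v).time = some a → m ≤ a)
    (fun m' ρ τ h hr => ⟨by omega, fun a ha => by
      rcases hr v with h' | ⟨-, -, h'⟩
      · rw [h'] at ha
        exact h.2 a ha
      · rw [h'] at ha
        have := Option.some.inj ha
        omega⟩) ⟨le_rfl, fun a ha => by rw [hv] at ha; cases ha⟩).2 a ha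

/-- The conditions on the parameters. -/
structure Params.Valid (P : Params) (c k n₀ ρ R : ℕ) : Prop where
  L_le : P.L ≤ c
  J_lt : P.J < 2 ^ k
  two_le_ρ : 2 ≤ ρ
  two_le_X : 2 ≤ P.X
  M₁_ge : 18 * R + 2 ^ P.q + 2 ^ P.q * n₀ ≤ P.M₁
  M₂_ge : 18 * (P.M₁ + 2 ^ P.q) + 2 ^ P.q + 2 ^ P.q * n₀ ≤ P.M₂
  JX_ge : 18 * (P.M₁ + 2 ^ P.q) + 2 ^ P.q + 2 ^ P.q * n₀ ≤ P.J * P.X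
  X_ge : 18 * (ρ * 2 ^ P.q) + 2 ^ P.q + 2 ^ P.q * n₀ ≤ P.X
  md_ge : P.X + 1 ≤ (P.md - 1) * ρ
  E_eq : P.E = 32 * P.θ

/-- The attempt has not been successful, and no node will terminate. -/
structure Idle (b : V → Info c) (σ : V → Node c) : Prop where
  ready : Ready b σ
  time : ∀ v, (σ v).time = none

/-- A layering has been constructed. -/
def Built (G : SimpleGraph V) (P : Params) (s : V) (ρ : ℕ) (b : V → Info c) (σ : V → Node c) :
    Prop :=
  ∃ t, Timing G s ρ P.X P.J t ∧ Bfs G b t P.X P.X σ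

theorem bfsProg_mem {N X md n : ℕ} {i : Instr c (Node c) (Msg c k)}
    (hi : i ∈ bfsProg N L X md n) : ∃ d l r, i = bfsInstr X md d l r := by
  induction n with
  | zero => simp [bfsProg] at hi
  | succ n ih =>
    rcases List.mem_append.1 hi with hi | hi
    · exact ih hi
    · have key : ∀ l, i ∈ bfsLayer N L X md n l → ∃ d l r, i = bfsInstr X md d l r := by
        intro l hi
        induction l with
        | zero => simp [bfsLayer] at hi
        | succ l ihl =>
        rcases List.mem_append.1 hi with hi | hi
        · exact ihl hi
        · obtain ⟨p, hp, hi⟩ := List.mem_flatten.1 hi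
          rw [List.eq_of_mem_replicate hp] at hi
          obtain ⟨r, -, rfl⟩ := List.mem_map.1 hi
          exact ⟨_, _, _, rfl⟩
      exact key md hi

theorem bfsInstr_upd {X md d l r : ℕ} (s : Node c) (x : Fin c → Bool) (y : Option (Msg c k)) :
    ((bfsInstr X md d l r : Instr c (Node c) (Msg c k)).upd s x y).info = s.info ∧
    ((bfsInstr X md d l r : Instr c (Node c) (Msg c k)).upd s x y).done = s.done ∧
    ((bfsInstr X md d l r : Instr c (Node c) (Msg c k)).upd s x y).time = s.time := by
  unfold bfsInstr
  rcases y with _ | ⟨i, j⟩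
  · simp
  · dsimp only
    split_ifs <;> simp

/-- Without an informed node a flood never starts, and the searches do not change times; so no node
terminates at the end. -/
theorem Idle.build {P : Params} (h : Idle b σ)
    (hr : Reach G (buildProg P lam : List (Instr c (Node c) (Msg c k))) σ τ) : Idle b τ := by
  obtain ⟨ρ, h1, h2⟩ := Reach.append hr
  have hs : Start b ∅ σ := ⟨h.ready, fun v hv => absurd hv (by simp), fun v _ => h.time v⟩
  have hf := (hs.floodInv (G := G) (q := P.q) (lam := lam)).of_reach le_rfl h1
  have hρ : Idle b ρ := ⟨hf.ready, fun v => by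
    by_contra hv
    obtain ⟨a, ha⟩ := Option.ne_none_iff_exists'.1 hv
    obtain ⟨u, hu, -⟩ := hf.exists_walk ha
    exact hu⟩
  refine h2.invariant (I := Idle b) (fun i hi σ ω h => ?_) hρ
  obtain ⟨d, l, r, rfl⟩ := bfsProg_mem hi
  have := fun v => bfsInstr_upd (X := P.X) (md := P.md) (d := d) (l := l) (r := r) (σ v) (ω v)
    (radioReceive G (sent (bfsInstr P.X P.md d l r : Instr c (Node c) (Msg c k)) σ ω) v)
  exact ⟨fun v => ⟨(this v).1.trans (h.ready v).1, (this v).2.1.trans (h.ready v).2⟩,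
    fun v => (this v).2.2.trans (h.time v)⟩

theorem Ready.alarm (hσ : Ready b σ) :
    Start b {v | (σ v).time = none} fun v => alarmNode (σ v) :=
  ⟨hσ, fun _ hv => if_pos hv, fun _ hv => if_neg hv⟩

theorem walkCost_le {w : V → ℕ} {W : ℕ} (hw : ∀ v, w v ≤ W) {u v : V} (p : G.Walk u v) :
    walkCost w p ≤ p.length * W := by
  induction p with
  | nil => simp [walkCost]
  | cons h p ih =>
    simp only [walkCost, SimpleGraph.Walk.length_cons, add_mul, one_mul]
    rw [add_comm]
    exact add_le_add ih (hw _)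

/-- If some node cannot be reached cheaply, then some node that can be reached at a moderate cost
cannot be reached cheaply. -/
theorem exists_walk_moderate {w : V → ℕ} {W M : ℕ} (hw : ∀ v, w v ≤ W) {v s : V}
    (p : G.Walk v s) (hv : ¬ ∃ p : G.Walk v s, walkCost w p ≤ M) :
    ∃ x, (¬ ∃ p : G.Walk x s, walkCost w p ≤ M) ∧ ∃ p : G.Walk x s, walkCost w p ≤ M + W := by
  induction p with
  | nil => exact absurd ⟨.nil, Nat.zero_le _⟩ hv
  | cons h p ih =>
    rename_i x y z
    by_cases hy : ∃ p : G.Walk y z, walkCost w p ≤ M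
    · obtain ⟨p', hp'⟩ := hy
      refine ⟨x, hv, .cons h p', ?_⟩
      simp only [walkCost]
      have := hw y
      omega
    · exact ih hy

variable [Fintype V] [DecidableEq V]

theorem failProb_localInstr_cons (f : Node c → Node c) (p : List (Instr c (Node c) (Msg c k)))
    (Q : (V → Node c) → Prop) (σ : V → Node c) :
    failProb G (localInstr f :: p) Q σ = failProb G p Q fun v => f (σ v) := by
  have h : ∀ ω, step G (localInstr f : Instr c (Node c) (Msg c k)) σ ω = fun v => f (σ v) :=
    fun _ => rfl
  simp only [failProb, ex, h, Fintype.expect_const]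

variable [DecidableRel G.Adj] {s : V} {P : Params} {n₀ ρ R : ℕ}

/-- The bound on the failure probability of the construction of the layering. -/
noncomputable def buildError (P : Params) (n n₀ : ℕ) : ℝ :=
  n * (16 / 17) ^ n₀ + P.J * (n * n) * (16 / 17) ^ n₀ + P.X * (P.md * (n * P.J * (7 / 8) ^ P.N))

theorem buildError_nonneg (P : Params) (n n₀ : ℕ) : 0 ≤ buildError P n n₀ := by
  unfold buildError; positivity

/-- A flood proceeds by at least `ρ` hops in `X` phases. -/
theorem failProb_thick_le (hP : P.Valid c k n₀ ρ R) (hG : G.Connected)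
    (hb : GoodInfo G s P.L b) (hσ : Start b {s} σ) {j : ℕ} (hj : j < P.J) {u v : V}
    (huv : G.dist u v ≤ ρ) :
    failProb G (flood P.L P.q lam 1 (P.J * P.X) : List (Instr c (Node c) (Msg c k)))
      (fun τ => ∀ a, (τ u).time = some a → a ≤ j * P.X →
        ∃ a', (τ v).time = some a' ∧ a' ≤ (j + 1) * P.X) σ ≤ (16 / 17) ^ n₀ := by
  -- The phases of the first `j` slabs, the `X` phases that have to cover `ρ` hops, and the rest.
  have hsplit : P.J * P.X = j * P.X + (P.X + (P.J - (j + 1)) * P.X) := by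
    obtain ⟨e, he⟩ := Nat.exists_eq_add_of_lt hj
    rw [he, Nat.add_sub_add_right, Nat.add_sub_cancel_left]
    ring
  rw [hsplit, flood_add]
  refine (failProb_append_le (Q := fun _ => True) (ε := (16 / 17) ^ n₀) (by positivity)
    fun τ hτ _ => ?_).trans (by rw [failProb_eq_zero fun _ _ => trivial, zero_add])
  have hfτ := (hσ.floodInv (G := G) (q := P.q) (lam := lam)).of_reach le_rfl hτ
  rw [flood_add]
  -- A node not informed in the first `j * X` phases has a time of at least `1 + j * X`, so nothing
  -- is claimed about it.
  by_cases hu : (τ u).time = none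
  · rw [← flood_add, failProb_eq_zero]
    · positivity
    · intro τ' hτ' a ha hle
      have := flood_le_time hτ' hu ha
      omega
  · refine (failProb_append_le (Q := fun τ => (τ v).time ≠ none) le_rfl fun τ' hτ' hv => ?_).trans
      (add_zero (failProb G _ _ τ)).le |>.trans ?_
    · refine (failProb_eq_zero fun τ'' hτ'' a _ _ => ?_).le
      obtain ⟨a', ha'⟩ := Option.ne_none_iff_exists'.1 hv
      refine ⟨a', flood_time_eq hτ'' ha', ?_⟩
      have := (hfτ.of_reach (by omega) hτ').lt v a' ha'
      rw [add_mul, one_mul]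
      omega
    · obtain ⟨p, hp⟩ := hG.exists_walk_length_eq_dist u v
      refine failProb_flood_le hP.L_le hb.cls_le hb.lower p (by omega)
        (fun v => (hfτ.ready v).1) hfτ.lt hu (le_trans ?_ hP.X_ge)
      have h2 := walkCost_le (fun v => wt_le P.q lam (b v).cls) p
      have h3 : p.length * 2 ^ P.q ≤ ρ * 2 ^ P.q := Nat.mul_le_mul_right _ (by omega)
      omega

/-- Three sources of failure: a node is not reached, a slab is too thin for some pair of nodes, or a
search misses an entry. The first two give a `Timing`, on which the searches rely. -/
theorem Start.failProb_build_le (hP : P.Valid c k n₀ ρ R) (hG : G.Connected)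
    (hb : GoodInfo G s P.L b) (hcard : Fintype.card V ≤ 2 ^ P.L)
    (hσ : Start b {s} σ) (htab : ∀ v, (σ v).tab = fun _ => none)
    (hwalk : ∀ v, ∃ p : G.Walk v s, walkCost (fun v => wt P.q lam (b v).cls) p ≤ P.M₁) :
    failProb G (buildProg P lam : List (Instr c (Node c) (Msg c k))) (Built G P s ρ b) σ ≤
      buildError P (Fintype.card V) n₀ := by
  have h1 : failProb G (flood P.L P.q lam 1 (P.J * P.X) : List (Instr c (Node c) (Msg c k)))
      (fun τ => ∀ v, (τ v).time ≠ none) σ ≤ Fintype.card V * (16 / 17) ^ n₀ := by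
    refine failProb_forall_le fun v => ?_
    obtain ⟨p, hp⟩ := hwalk v
    -- The flood runs from `s`, the given walk towards `s`; reversal costs at most one further
    -- delay, which explains `M₁ + 2 ^ q` in `JX_ge`.
    have hrev := walkCost_reverse (fun v => wt P.q lam (b v).cls) p
    have hws : wt P.q lam (b v).cls ≤ 2 ^ P.q := wt_le _ _ _
    have := hP.JX_ge
    exact failProb_flood_le hP.L_le hb.cls_le hb.lower p.reverse le_rfl
      (fun v => (hσ.ready v).1) (hσ.floodInv (G := G) (q := P.q) (lam := lam)).lt
      (by rw [hσ.time_of_mem s rfl]; simp) (by omega)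
  have h2 : failProb G (flood P.L P.q lam 1 (P.J * P.X) : List (Instr c (Node c) (Msg c k)))
      (fun τ => ∀ x : Fin P.J × (V × V), G.dist x.2.2 x.2.1 ≤ ρ →
        ∀ a, (τ x.2.1).time = some a → a ≤ (x.1 : ℕ) * P.X →
        ∃ a', (τ x.2.2).time = some a' ∧ a' ≤ ((x.1 : ℕ) + 1) * P.X) σ ≤
      (P.J * (Fintype.card V * Fintype.card V)) * (16 / 17) ^ n₀ := by
    refine (failProb_forall_le (ε := (16 / 17) ^ n₀) fun x => ?_).trans (le_of_eq (by simp))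
    by_cases hx : G.dist x.2.2 x.2.1 ≤ ρ
    · refine (failProb_mono fun τ _ h _ => h).trans
        (failProb_thick_le hP hG hb hσ x.1.2 (u := x.2.1) (v := x.2.2) ?_)
      rwa [SimpleGraph.dist_comm]
    · rw [failProb_eq_zero fun τ _ h => absurd h hx]
      positivity
  have h3 := Triple.and (G := G) (P := fun τ => τ = σ) (fun τ hτ => (congrArg _ hτ).trans_le h1)
    (fun τ hτ => (congrArg _ hτ).trans_le h2) σ rfl
  refine (failProb_append_le (ε := P.X * (P.md * (Fintype.card V * P.J * (7 / 8) ^ P.N)))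
    (by positivity) fun τ hτ hQ => ?_).trans (add_le_add h3 le_rfl)
  have hf := (hσ.floodInv (G := G) (q := P.q) (lam := lam)).of_reach le_rfl hτ
  choose t ht using fun v => Option.ne_none_iff_exists'.1 (hQ.1 v)
  have hzero : ∀ v, t v = 0 ↔ v = s := fun v => by
    rw [← Set.mem_singleton_iff (b := s), ← hf.zero, ht, Option.some.injEq]
  have hT : Timing G s ρ P.X P.J t := by
    refine ⟨hzero, ?_, ?_, ?_⟩
    · intro v hv
      rcases hf.pred v _ (ht v) with h0 | ⟨u, a, hu, ha, hle⟩
      · exact absurd ((hzero v).1 h0) hv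
      · rw [ht, Option.some.injEq] at ha
        have := wt_pos P.q lam (b u).cls
        exact ⟨u, hu, by omega⟩
    · intro v
      have := hf.lt v _ (ht v)
      omega
    · intro j u v hu huv
      by_cases hj : j < P.J
      · obtain ⟨a, ha, hle⟩ := hQ.2 (⟨j, hj⟩, (u, v)) huv _ (ht u) hu
        rw [ht, Option.some.injEq] at ha
        rwa [ha]
      -- From slab `J` on there is nothing to show, as every time is at most `J * X`.
      · have := hf.lt v _ (ht v)
        have : P.J * P.X ≤ (j + 1) * P.X := Nat.mul_le_mul_right _ (by omega)
        omega
  refine (failProb_mono fun τ _ h => ?_).trans (triple_bfsProg (t := t) (b := b) (N := P.N)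
    hP.L_le hG hT hP.J_lt (by have := hP.two_le_ρ; omega) hP.md_ge
    (fun v => (G.degree_lt_card_verts v).trans_le hcard) (le_refl P.X) τ ?_)
  · exact ⟨t, hT, h⟩
  -- The searches start with empty tables: a node at distance zero belongs to the slab and needs no
  -- entry.
  · have hnone : ∀ v j, (τ v).tab j = none := fun v j => by rw [flood_tab hτ, htab]
    refine ⟨fun v => (hf.ready v).1, fun v => (hf.ready v).2, ht, fun v j e i h => ?_,
      fun v j hv h => ?_⟩
    · rw [hnone] at h; cases h
    · rw [Nat.le_zero, setDist_eq_zero_iff hG (hT.nonempty j)] at h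
      exact absurd h hv

theorem Ready.start (hb : GoodInfo G s L b) (hσ : Ready b σ) :
    Start b {s} fun v => startNode (σ v) := by
  refine ⟨hσ, fun v hv => ?_, fun v hv => ?_⟩
  · rw [Set.mem_singleton_iff] at hv
    subst hv
    simp [startNode, (hσ v).1, hb.src]
  · rw [Set.mem_singleton_iff] at hv
    simp [startNode, (hσ v).1, hb.src, hv]

theorem Ready.confirm (hb : GoodInfo G s L b) (hσ : Ready b σ) (hs : (σ s).time = none) :
    Start b {s} fun v => confirmNode (σ v) := by
  refine ⟨hσ, fun v hv => ?_, fun v hv => ?_⟩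
  · rw [Set.mem_singleton_iff] at hv
    subst hv
    simp [confirmNode, (hσ v).1, hb.src, hs]
  · rw [Set.mem_singleton_iff] at hv
    simp [confirmNode, (hσ v).1, hb.src, hv]

theorem Ready.confirm_idle (hb : GoodInfo G s L b) (hσ : Ready b σ) (hs : (σ s).time ≠ none) :
    Idle b fun v => confirmNode (σ v) := by
  refine ⟨hσ, fun v => ?_⟩
  by_cases hv : v = s
  · subst hv
    simp [confirmNode, hs]
  · simp [confirmNode, (hσ v).1, hb.src, hv]

/-- The result of the test. -/
def Checked (b : V → Info c) (s : V) (σ : V → Node c) : Prop :=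
  Start b {s} σ ∧ ∀ v, (σ v).tab = fun _ => none

/-- Once all nodes are informed, nobody starts the alarm and the source surely hears none. So only
the first flood can fail. -/
theorem triple_check_of_cheap (hP : P.Valid c k n₀ ρ R) (hb : GoodInfo G s P.L b)
    (hwalk : ∀ v, ∃ p : G.Walk s v, walkCost (fun v => wt P.q lam (b v).cls) p ≤ R) :
    Triple G (checkProg P lam : List (Instr c (Node c) (Msg c k))) (Ready b) (Checked b s)
      (Fintype.card V * (16 / 17) ^ n₀) := by
  intro σ hσ
  have hst := hσ.start hb
  rw [checkProg, failProb_localInstr_cons]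
  refine (failProb_append_le (Q := fun τ => ∀ v, (τ v).time ≠ none) le_rfl
    fun τ hτ hall => ?_).trans ((add_zero _).le.trans (failProb_forall_le fun v => ?_))
  · rw [failProb_localInstr_cons]
    refine (failProb_eq_zero fun τ₂ hτ₂ => ?_).le
    have hfτ := (hst.floodInv (G := G) (q := P.q) (lam := lam)).of_reach le_rfl hτ
    obtain ⟨τ₁, hτ₁, ω, rfl⟩ := Reach.append hτ₂
    have hf₁ := (hfτ.ready.alarm.floodInv (G := G) (q := P.q) (lam := lam)).of_reach le_rfl hτ₁
    refine ⟨hf₁.ready.confirm hb ?_, fun v => rfl⟩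
    by_contra hs
    obtain ⟨a, ha⟩ := Option.ne_none_iff_exists'.1 hs
    obtain ⟨u, hu, -⟩ := hf₁.exists_walk ha
    exact hall u hu
  · obtain ⟨p, hp⟩ := hwalk v
    have := hP.M₁_ge
    exact failProb_flood_le hP.L_le hb.cls_le hb.lower p le_rfl
      (fun v => (hst.ready v).1) (hst.floodInv (G := G) (q := P.q) (lam := lam)).lt
      (by rw [hst.time_of_mem s rfl]; simp) (by omega)

/-- A node more expensive than `M₁` is uninformed with certainty, and one such node can reach the
source at a cost of at most `M₁ + 2 ^ q`. So only the alarm can fail. -/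
theorem triple_check_of_not_cheap (hP : P.Valid c k n₀ ρ R) (hG : G.Connected)
    (hb : GoodInfo G s P.L b)
    (hwalk : ¬ ∀ v, ∃ p : G.Walk v s, walkCost (fun v => wt P.q lam (b v).cls) p ≤ P.M₁) :
    Triple G (checkProg P lam : List (Instr c (Node c) (Msg c k))) (Ready b) (Idle b)
      ((16 / 17) ^ n₀) := by
  intro σ hσ
  have hst := hσ.start hb
  obtain ⟨v, hv⟩ := not_forall.1 hwalk
  obtain ⟨p₀⟩ := hG.preconnected v s
  obtain ⟨x, hx, p, hp⟩ := exists_walk_moderate (fun v => wt_le P.q lam (b v).cls) p₀ hv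
  rw [checkProg, failProb_localInstr_cons]
  refine (failProb_append_le (Q := fun _ => True) (ε := (16 / 17) ^ n₀) (by positivity)
    fun τ hτ _ => ?_).trans (by rw [failProb_eq_zero fun _ _ => trivial, zero_add])
  have hfτ := (hst.floodInv (G := G) (q := P.q) (lam := lam)).of_reach le_rfl hτ
  -- After `M₁` phases all times are at most `M₁`, so an informed `x` would have a walk of cost at
  -- most `M₁`.
  have hxτ : (τ x).time = none := by
    by_contra hne
    obtain ⟨a, ha⟩ := Option.ne_none_iff_exists'.1 hne
    obtain ⟨u, rfl, p', hp'⟩ := hfτ.exists_walk ha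
    have := hfτ.lt x a ha
    exact hx ⟨p', by omega⟩
  have hal := hfτ.ready.alarm
  rw [failProb_localInstr_cons]
  refine (failProb_append_le (Q := fun τ => (τ s).time ≠ none) le_rfl
    fun τ₁ hτ₁ hs => ?_).trans ((add_zero _).le.trans ?_)
  · refine (failProb_eq_zero fun τ₂ hτ₂ => ?_).le
    obtain ⟨ω, rfl⟩ := hτ₂
    exact ((hal.floodInv (G := G) (q := P.q) (lam := lam)).of_reach le_rfl
      hτ₁).ready.confirm_idle hb hs
  · have := hP.M₂_ge
    exact failProb_flood_le hP.L_le hb.cls_le hb.lower p le_rfl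
      (fun v => (hal.ready v).1) (hal.floodInv (G := G) (q := P.q) (lam := lam)).lt
      (by rw [hal.time_of_mem x hxτ]; simp) (by omega)

theorem triple_check (hb : GoodInfo G s P.L b) :
    Triple G (checkProg P lam : List (Instr c (Node c) (Msg c k))) (Ready b)
      (fun σ => Checked b s σ ∨ Idle b σ) 0 := by
  refine Triple.of_reach fun σ σ' hσ hr => ?_
  obtain ⟨ω, hr⟩ := hr
  obtain ⟨τ, hτ, ω', hr⟩ := Reach.append hr
  obtain ⟨τ₁, hτ₁, ω'', rfl⟩ := Reach.append hr
  have hfτ := ((hσ.start hb).floodInv (G := G) (q := P.q) (lam := lam)).of_reach le_rfl hτ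
  have hf₁ := (hfτ.ready.alarm.floodInv (G := G) (q := P.q) (lam := lam)).of_reach le_rfl hτ₁
  by_cases hs : (τ₁ s).time = none
  · exact Or.inl ⟨hf₁.ready.confirm hb hs, fun v => rfl⟩
  · exact Or.inr (hf₁.ready.confirm_idle hb hs)

/-- The bound on the failure probability of an attempt. -/
noncomputable def attemptError (P : Params) (n n₀ : ℕ) : ℝ :=
  n * (16 / 17) ^ n₀ + buildError P n n₀

theorem attemptError_nonneg (P : Params) (n n₀ : ℕ) : 0 ≤ attemptError P n n₀ :=
  add_nonneg (by positivity) (buildError_nonneg P n n₀)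

theorem triple_attempt_of_cheap (hP : P.Valid c k n₀ ρ R) (hG : G.Connected)
    (hb : GoodInfo G s P.L b) (hcard : Fintype.card V ≤ 2 ^ P.L)
    (hwalk : ∀ v, ∃ p : G.Walk s v, walkCost (fun v => wt P.q lam (b v).cls) p ≤ R) :
    Triple G (checkProg P lam ++ buildProg P lam : List (Instr c (Node c) (Msg c k)))
      (Ready b) (Built G P s ρ b) (attemptError P (Fintype.card V) n₀) := by
  refine (triple_check_of_cheap hP hb hwalk).seq (fun σ hσ =>
    hσ.1.failProb_build_le hP hG hb hcard hσ.2 fun v => ?_) (buildError_nonneg _ _ _)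
  obtain ⟨p, hp⟩ := hwalk v
  refine ⟨p.reverse, ?_⟩
  have hrev := walkCost_reverse (fun v => wt P.q lam (b v).cls) p
  have hws : wt P.q lam (b s).cls ≤ 2 ^ P.q := wt_le _ _ _
  have := hP.M₁_ge
  omega

/-- Safety for every `lam`. If all costs are at most `M₁`, the verdict of the test may be either,
but the construction works whenever it starts; otherwise the alarm prevents it. -/
theorem triple_attempt (hP : P.Valid c k n₀ ρ R) (hG : G.Connected)
    (hb : GoodInfo G s P.L b) (hcard : Fintype.card V ≤ 2 ^ P.L) :
    Triple G (checkProg P lam ++ buildProg P lam : List (Instr c (Node c) (Msg c k)))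
      (Ready b) (fun σ => Idle b σ ∨ Built G P s ρ b σ)
      (attemptError P (Fintype.card V) n₀) := by
  have hn : (1 : ℝ) ≤ Fintype.card V := by
    exact_mod_cast Fintype.card_pos_iff.2 ⟨s⟩
  have hδ : (0 : ℝ) ≤ (16 / 17) ^ n₀ := by positivity
  have hB := buildError_nonneg P (Fintype.card V) n₀
  have hE : (16 / 17 : ℝ) ^ n₀ ≤ Fintype.card V * (16 / 17) ^ n₀ := le_mul_of_one_le_left hδ hn
  have hidle : ∀ σ, Idle b σ → failProb G (buildProg P lam : List (Instr c (Node c) (Msg c k)))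
      (fun σ => Idle b σ ∨ Built G P s ρ b σ) σ = 0 := fun σ h =>
    failProb_eq_zero fun τ hτ => Or.inl (h.build hτ)
  by_cases hwalk : ∀ v, ∃ p : G.Walk v s, walkCost (fun v => wt P.q lam (b v).cls) p ≤ P.M₁
  · refine ((triple_check hb).seq (R := fun σ => Idle b σ ∨ Built G P s ρ b σ)
      (δ := buildError P (Fintype.card V) n₀) (fun σ hσ => ?_) hB).weaken (fun _ h => h)
      (fun _ h => h) (by unfold attemptError; linarith)
    rcases hσ with hσ | hσ
    · exact (failProb_mono fun τ _ h => Or.inr h).trans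
        (hσ.1.failProb_build_le hP hG hb hcard hσ.2 hwalk)
    · rw [hidle σ hσ]
      exact hB
  · refine ((triple_check_of_not_cheap hP hG hb hwalk).seq
      (R := fun σ => Idle b σ ∨ Built G P s ρ b σ) (δ := 0)
      (fun σ hσ => (hidle σ hσ).le) le_rfl).weaken (fun _ h => h)
      (fun _ h => h) (by unfold attemptError; linarith)

end Attempt

/-! ### The results of the nodes -/

section Result

variable {c k B : ℕ} {V : Type*} {G : SimpleGraph V}

/-- The distance of a node to slab `j`, as far as the node knows it. -/
def Node.dist (X : ℕ) (s : Node c) (j : ℕ) : Option ℕ :=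
  match s.time with
  | some a => if a ≤ j * X then some 0 else (s.tab j).map Prod.fst
  | none => none

/-- The smallest index of a slab within distance `X`. -/
noncomputable def Node.index (X : ℕ) (s : Node c) : ℕ := sInf {j | ∃ d ≤ X, s.dist X j = some d}

/-- The result of a node. -/
noncomputable def Node.result (X : ℕ) (enc : (Fin c → Bool) → BitString B) (s : Node c) :
    Option (LayerOutput B 6) :=
  if s.done = true then
    some
      { id := enc s.info.id
        layer := (s.index X * (X + 1) + (s.dist X (s.index X)).getD 0 : ℕ)
        color := ⟨3 * (s.index X % 2) + (s.dist X (s.index X)).getD 0 % 3, by omega⟩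
        parent := (s.tab (s.index X)).map fun x => enc x.2 }
  else none

theorem Node.isSome_result (X : ℕ) (enc : (Fin c → Bool) → BitString B) (s : Node c) :
    (s.result X enc).isSome = s.done := by
  unfold Node.result
  split_ifs with h <;> simp [h]

variable {b : V → Info c} {s : V} {ρ X J : ℕ} {t : V → ℕ} {σ : V → Node c}

theorem Bfs.dist_eq (h : Bfs G b t X X σ) {v : V} {j : ℕ}
    (hv : setDist G (slab t X j) v ≤ X) : (σ v).dist X j = some (setDist G (slab t X j) v) := by
  simp only [Node.dist, h.time]
  by_cases hm : v ∈ slab t X j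
  · rw [if_pos (show t v ≤ j * X from hm), setDist_eq_zero_of_mem hm]
  · rw [if_neg (show ¬ t v ≤ j * X from hm)]
    obtain ⟨⟨e, i⟩, he⟩ := Option.ne_none_iff_exists'.1 (h.complete v j hm hv)
    rw [he, Option.map_some, (h.sound v j e i he).2.1]

theorem Bfs.dist_eq_some (h : Bfs G b t X X σ) {v : V} {j d : ℕ}
    (hd : (σ v).dist X j = some d) : setDist G (slab t X j) v = d := by
  simp only [Node.dist, h.time] at hd
  split_ifs at hd with hm
  · rw [setDist_eq_zero_of_mem (show v ∈ slab t X j from hm)]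
    exact Option.some.inj hd
  · obtain ⟨⟨e, i⟩, he, rfl⟩ := Option.map_eq_some_iff.1 hd
    exact (h.sound v j e i he).2.1.symm

theorem Bfs.index_eq (h : Bfs G b t X X σ) (v : V) : (σ v).index X = Timing.index G t X v := by
  unfold Node.index Timing.index
  congr 1
  ext j
  exact ⟨fun ⟨d, hd, hj⟩ => (h.dist_eq_some hj).trans_le hd,
    fun hj => ⟨_, hj, h.dist_eq hj⟩⟩

/-- The results that are obtained from a finished breadth-first search form a layering. -/
theorem Bfs.isDistributedLayering [Finite V] (hG : G.Connected) (ht : Timing G s ρ X J t)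
    (hρ : 2 ≤ ρ) (hX : 2 ≤ X) (hb : Function.Injective fun v => (b v).id)
    (hσ : Bfs G b t X X σ) {enc : (Fin c → Bool) → BitString B} (henc : Function.Injective enc) :
    ∃ o : V → LayerOutput B 6,
      (∀ v, (finishNode (σ v)).result X enc = some (o v)) ∧
      IsDistributedLayering G s (J * (X + 1) + X : ℕ) o := by
  have hdist := fun v => hσ.dist_eq (ht.index_spec (G := G) v)
  have hcol : ∀ v, Timing.color G t X v < 6 := fun v => by unfold Timing.color; omega
  refine ⟨fun v => ⟨enc (b v).id, (Timing.layer G t X v : ℕ), ⟨Timing.color G t X v, hcol v⟩,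
    ((σ v).tab (Timing.index G t X v)).map fun x => enc x.2⟩, fun v => ?_, ?_⟩
  · have h1 : (finishNode (σ v)).done = true := by simp [finishNode, hσ.time]
    have h2 : (finishNode (σ v)).index X = Timing.index G t X v := hσ.index_eq v
    have h3 : (finishNode (σ v)).dist X (Timing.index G t X v) = _ := hdist v
    have h4 : (finishNode (σ v)).info = b v := hσ.info v
    have h5 : (finishNode (σ v)).tab = (σ v).tab := rfl
    simp only [Node.result, if_pos h1, h2, h3, h4, h5]
    rfl
  have hpar : ∀ u, u ≠ s → ∃ v, G.Adj u v ∧ Timing.layer G t X v < Timing.layer G t X u ∧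
      ((σ u).tab (Timing.index G t X u)).map (fun x => enc x.2) = some (enc (b v).id) := by
    intro u hu
    obtain ⟨⟨e, i⟩, he⟩ := Option.ne_none_iff_exists'.1
      (hσ.complete u _ (ht.notMem_slab_index hG hu) (ht.index_spec u))
    obtain ⟨-, h1, y, h2, h3, h4⟩ := hσ.sound u _ e i he
    exact ⟨y, h2, ht.layer_lt_of_setDist (h3.trans h1), by rw [he, Option.map_some, h4]⟩
  constructor
  · exact henc.comp hb
  · refine ⟨⟨s, ?_, fun v hv => ?_⟩, fun u hu => ?_⟩
    · exact Nat.cast_eq_zero.2 ((ht.layer_eq_zero_iff hG s).2 rfl)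
    · exact (ht.layer_eq_zero_iff hG v).1 (Nat.cast_eq_zero.1 hv)
    · obtain ⟨v, h1, h2, -⟩ := hpar u fun h => hu
        (Nat.cast_eq_zero.2 ((ht.layer_eq_zero_iff hG u).2 h))
      exact ⟨v, h1, Nat.cast_lt.2 h2⟩
  · exact Nat.cast_eq_zero.2 ((ht.layer_eq_zero_iff hG s).2 rfl)
  · intro u hu
    obtain ⟨v, h1, h2, h3⟩ := hpar u hu
    exact ⟨v, h1, Nat.cast_lt.2 h2, h3⟩
  · intro u v hne hd hcol
    refine ht.color_ne hG hρ hX (u := u) (v := v) ?_ (fun h => hne (by simp [h]))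
      (congrArg Fin.val hcol)
    have h1 := (hG.preconnected u v).coe_dist_eq_edist
    rw [← h1] at hd
    exact_mod_cast hd
  · have : Nonempty V := ⟨s⟩
    have h1 : layeringDepth (fun v => ((Timing.layer G t X v : ℕ) : ℤ)) ≤
        ((J * (X + 1) + X : ℕ) : ℤ) := ciSup_le fun v => Nat.cast_le.2 (ht.layer_le v)
    exact_mod_cast h1

end Result

/-! ### The analysis of the whole program -/

section Main

variable {c k : ℕ} {V : Type*} {G : SimpleGraph V}

theorem Idle.finish {b : V → Info c} {τ : V → Node c} (h : Idle b τ) : Ready b fun v => finishNode (τ v) :=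
  fun v => ⟨(h.ready v).1, by simp [finishNode, h.time, (h.ready v).2]⟩

variable [Fintype V] [DecidableEq V]

theorem gex_le_one {S M : Type} {done : S → Bool} {p : List (Instr c S M)} {f : (V → S) → ℝ}
    (hf : ∀ σ, f σ ≤ 1) (σ : V → S) : gex done G p f σ ≤ 1 :=
  (gex_le hf).trans_eq (gex_const done p 1 σ)

-- While no node is frozen both semantics agree, so the Hoare-style bounds carry over to the
-- executed protocol.
open Classical in
theorem gex_le_failProb_add {S M : Type} {done : S → Bool} {p : List (Instr c S M)}
    {f : (V → S) → ℝ} {Q : (V → S) → Prop} {σ : V → S} {δ : ℝ}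
    (hp : ∀ i ∈ p, ∀ s x r, done s = false → done (i.upd s x r) = false)
    (h : ∀ v, done (σ v) = false) (hδ : 0 ≤ δ) (hf : ∀ τ, f τ ≤ 1) (hQ : ∀ τ, Q τ → f τ ≤ δ) :
    gex done G p f σ ≤ failProb G p Q σ + δ := by
  rw [gex_eq_ex hp h]
  have : ex G p f σ ≤ ex G p (fun τ => (if Q τ then 0 else 1) + δ) σ := by
    refine ex_mono fun τ _ => ?_
    split_ifs with hq
    · rw [zero_add]
      exact hQ τ hq
    · linarith [hf τ]
  rwa [ex_add, ex_const] at this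

theorem flood_done {L q lam m n : ℕ} {i : Instr c (Node c) (Msg c k)}
    (hi : i ∈ flood L q lam m n) (s : Node c) (x : Fin c → Bool) (r : Option (Msg c k)) :
    (i.upd s x r).done = s.done := by
  induction n generalizing m with
  | zero => simp [flood] at hi
  | succ n ih =>
    rcases List.mem_append.1 hi with hi | hi
    · obtain ⟨r', rfl⟩ := mem_phase hi
      simp only [floodInstr]
      split_ifs <;> rfl
    · exact ih hi

theorem test_done {P : Params} {lam : ℕ} {i : Instr c (Node c) (Msg c k)}
    (hi : i ∈ checkProg P lam ++ buildProg P lam) (s : Node c) (x : Fin c → Bool)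
    (r : Option (Msg c k)) : (i.upd s x r).done = s.done := by
  simp only [checkProg, buildProg, List.mem_append, List.mem_cons, List.not_mem_nil,
    or_false] at hi
  rcases hi with (rfl | hi | rfl | hi | rfl) | hi | hi
  · rfl
  · exact flood_done hi s x r
  · rfl
  · exact flood_done hi s x r
  · rfl
  · exact flood_done hi s x r
  · obtain ⟨d, l, r', rfl⟩ := bfsProg_mem hi
    exact (bfsInstr_upd s x r).2.1

theorem setupProg_done {P : Params} {i : Instr c (Node c) (Msg c k)}
    (hi : i ∈ setupProg P) (s : Node c) (x : Fin c → Bool) (r : Option (Msg c k)) :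
    (i.upd s x r).done = s.done := by
  rcases List.mem_cons.1 hi with rfl | hi
  · rfl
  · generalize P.L = n at hi
    induction n with
    | zero => simp [degreeProg] at hi
    | succ n ih =>
      simp only [degreeProg, List.mem_append, List.mem_singleton] at hi
      rcases hi with hi | hi | rfl
      · exact ih hi
      · rw [List.eq_of_mem_replicate hi]
        simp only [countInstr]
        split_ifs <;> rfl
      · rfl

theorem gex_finish {h : (V → Node c) → ℝ} {τ : V → Node c} (hτ : ∀ v, (τ v).done = false) :
    gex Node.done G [(localInstr finishNode : Instr c (Node c) (Msg c k))] h τ =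
      h fun v => finishNode (τ v) := by
  have : ∀ ω, gstep Node.done G (localInstr finishNode : Instr c (Node c) (Msg c k)) τ ω =
      fun v => finishNode (τ v) := fun ω => by rw [gstep_eq_step hτ]; rfl
  simp only [gex, this, Fintype.expect_const]

variable [DecidableRel G.Adj] {s : V} {P : Params} {n₀ ρ R lam : ℕ} {b : V → Info c}

/-- All nodes have terminated with a layering. -/
def Finished (G : SimpleGraph V) [DecidableRel G.Adj] (P : Params) (s : V) (ρ : ℕ)
    (σ : V → Node c) : Prop :=
  ∃ b τ, GoodInfo G s P.L b ∧ Built G P s ρ b τ ∧ σ = fun v => finishNode (τ v)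

theorem Finished.done {σ : V → Node c} (h : Finished G P s ρ σ) (v : V) : (σ v).done = true := by
  obtain ⟨b, τ, -, ⟨t, -, hτ⟩, rfl⟩ := h
  simp [finishNode, hτ.time]

/-- Here `h` stands for the expected failure in the rest of the program. Both good outcomes, all
nodes ready again or all finished, are uniform over the nodes, so no mixture of frozen and running
nodes has to be considered. -/
theorem gex_attempt_le (hP : P.Valid c k n₀ ρ R) (hG : G.Connected)
    (hb : GoodInfo G s P.L b) (hcard : Fintype.card V ≤ 2 ^ P.L) {h : (V → Node c) → ℝ} {δ : ℝ}
    (hδ : 0 ≤ δ) (h1 : ∀ σ, h σ ≤ 1) (hready : ∀ σ, Ready b σ → h σ ≤ δ)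
    (hfin : ∀ σ, Finished G P s ρ σ → h σ ≤ δ) {σ : V → Node c} (hσ : Ready b σ) :
    gex Node.done G (attempt P lam : List (Instr c (Node c) (Msg c k))) h σ ≤
      attemptError P (Fintype.card V) n₀ + δ := by
  rw [attempt, gex_append]
  refine (gex_le_failProb_add (fun i hi s x r hs => (test_done hi s x r).trans hs)
    (fun v => (hσ v).2) hδ (gex_le_one h1) fun τ hτ => ?_).trans
    (add_le_add (triple_attempt hP hG hb hcard σ hσ) le_rfl)
  rcases hτ with hτ | hτ
  · rw [gex_finish fun v => (hτ.ready v).2]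
    exact hready _ hτ.finish
  · have hd : ∀ v, (τ v).done = false := by
      obtain ⟨t, -, hτ⟩ := hτ
      exact hτ.done
    rw [gex_finish hd]
    exact hfin _ ⟨b, τ, hb, hτ, rfl⟩

theorem gex_attempt_le_of_cheap (hP : P.Valid c k n₀ ρ R) (hG : G.Connected)
    (hb : GoodInfo G s P.L b) (hcard : Fintype.card V ≤ 2 ^ P.L)
    (hwalk : ∀ v, ∃ p : G.Walk s v, walkCost (fun v => wt P.q lam (b v).cls) p ≤ R)
    {h : (V → Node c) → ℝ} (h1 : ∀ σ, h σ ≤ 1) (hfin : ∀ σ, Finished G P s ρ σ → h σ ≤ 0)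
    {σ : V → Node c} (hσ : Ready b σ) :
    gex Node.done G (attempt P lam : List (Instr c (Node c) (Msg c k))) h σ ≤
      attemptError P (Fintype.card V) n₀ := by
  rw [attempt, gex_append, ← add_zero (attemptError P (Fintype.card V) n₀)]
  refine (gex_le_failProb_add (fun i hi s x r hs => (test_done hi s x r).trans hs)
    (fun v => (hσ v).2) le_rfl (gex_le_one h1) fun τ hτ => ?_).trans
    (add_le_add (triple_attempt_of_cheap hP hG hb hcard hwalk σ hσ) le_rfl)
  have hd : ∀ v, (τ v).done = false := by
    obtain ⟨t, -, hτ⟩ := hτ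
    exact hτ.done
  rw [gex_finish hd]
  exact hfin _ ⟨b, τ, hb, hτ, rfl⟩

/-- The last trial is absorbed into `h`, whence the induction over all `h` and `δ`. A finished
configuration just passes through it. -/
theorem gex_attempts_le (hP : P.Valid c k n₀ ρ R) (hG : G.Connected)
    (hb : GoodInfo G s P.L b) (hcard : Fintype.card V ≤ 2 ^ P.L) (n : ℕ)
    {h : (V → Node c) → ℝ} {δ : ℝ}
    (hδ : 0 ≤ δ) (h1 : ∀ σ, h σ ≤ 1) (hready : ∀ σ, Ready b σ → h σ ≤ δ)
    (hfin : ∀ σ, Finished G P s ρ σ → h σ ≤ δ) {σ : V → Node c} (hσ : Ready b σ) :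
    gex Node.done G (attempts P n : List (Instr c (Node c) (Msg c k))) h σ ≤
      n * attemptError P (Fintype.card V) n₀ + δ := by
  induction n generalizing h δ with
  | zero => simpa [attempts, gex] using hready σ hσ
  | succ n ih =>
    have he := attemptError_nonneg P (Fintype.card V) n₀
    rw [attempts, gex_append]
    refine (ih (h := gex Node.done G (attempt P (2 ^ n) : List (Instr c (Node c) (Msg c k))) h)
      (δ := attemptError P (Fintype.card V) n₀ + δ) (by linarith) (gex_le_one h1)
      (fun τ hτ => gex_attempt_le hP hG hb hcard hδ h1 hready hfin hτ) fun τ hτ => ?_).trans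
      (le_of_eq (by push_cast; ring))
    rw [gex_of_done _ hτ.done]
    linarith [hfin τ hτ]

/-- The failure probability of the program if a test value is large enough. -/
theorem gex_mainProg_le (hP : P.Valid c k n₀ ρ R) (hG : G.Connected)
    (hcard : Fintype.card V ≤ 2 ^ P.L) (hdeg : ∀ v, 1 ≤ G.degree v) {n : ℕ}
    (hwalk : ∀ b : V → Info c, GoodInfo G s P.L b → ∀ v, ∃ p : G.Walk s v,
      walkCost (fun v => wt P.q (2 ^ n) (b v).cls) p ≤ R)
    (r : List (Instr c (Node c) (Msg c k))) {f : (V → Node c) → ℝ} (h1 : ∀ σ, f σ ≤ 1)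
    (hfin : ∀ σ, Finished G P s ρ σ → f σ ≤ 0) :
    gex Node.done G ((setupProg P ++ attempts P (n + 1)) ++ r) f
      (fun v => initNode (decide (v = s))) ≤
      (Fintype.card V : ℝ) ^ 2 * 2⁻¹ ^ c + P.L * (Fintype.card V * 2⁻¹ ^ P.θ) +
        (n + 1) * attemptError P (Fintype.card V) n₀ := by
  have he := attemptError_nonneg P (Fintype.card V) n₀
  rw [gex_append, gex_append]
  refine (gex_le_failProb_add (Q := fun σ => ∃ b, GoodInfo G s P.L b ∧ Ready b σ)
    (fun i hi s x r hs => (setupProg_done hi s x r).trans hs) (fun v => rfl)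
    (by positivity : (0 : ℝ) ≤ (n + 1) * attemptError P (Fintype.card V) n₀)
    (gex_le_one (gex_le_one h1)) ?_).trans
    (add_le_add (triple_setupProg hP.L_le hP.E_eq hdeg hcard _ rfl) le_rfl)
  rintro σ ⟨b, hb, hσ⟩
  have hr : ∀ τ, Finished G P s ρ τ → gex Node.done G r f τ ≤ 0 := fun τ hτ => by
    rw [gex_of_done _ hτ.done]
    exact hfin τ hτ
  rw [attempts, gex_append]
  refine (gex_attempts_le hP hG hb hcard n he (gex_le_one (gex_le_one h1)) (fun τ hτ =>
    gex_attempt_le_of_cheap hP hG hb hcard (hwalk b hb) (gex_le_one h1) hr hτ)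
    (fun τ hτ => ?_) hσ).trans (le_of_eq (by ring))
  rw [gex_of_done _ hτ.done]
  linarith [hr τ hτ]

/-- Attempts are executed one after the other. -/
theorem attempts_eq_append (P : Params) {m n : ℕ} (h : m ≤ n) :
    ∃ r, (attempts P n : List (Instr c (Node c) (Msg c k))) = attempts P m ++ r := by
  induction n, h using Nat.le_induction with
  | base => exact ⟨[], by simp⟩
  | succ n _ ih =>
    obtain ⟨r, hr⟩ := ih
    exact ⟨r ++ attempt P (2 ^ n), by rw [attempts, hr, List.append_assoc]⟩

end Main

/-! ### Observing the protocol after a prescribed number of rounds -/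

section Truncate

variable {c b : ℕ} {S M Out : Type} {V : Type*} [Fintype V] [DecidableEq V]

open Classical in
/-- The failure probability of the protocol of a program after a part of the program. -/
theorem exists_prob_toProtocol {p r : List (Instr c S M)} {init : Bool → S} {res : S → Option Out}
    {enc : M → BitString b} {dec : BitString b → Option M} (hdec : ∀ m, dec (enc m) = some m)
    (G : SimpleGraph V) (s : V) {t : ℕ} (ht : p.length ≤ t) (E : Set (V → S)) :
    ∃ r', (toProtocol (p ++ r) init res enc dec).prob G s t {σ | (fun v => (σ v).2) ∈ E} =
      1 - gex (fun s => (res s).isSome) G (p ++ r')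
        (fun σ => if σ ∈ E then 0 else 1) fun v => init (decide (v = s)) := by
  -- What is executed after `p` is the rest of the program, cut off or padded with idle rounds to
  -- total length `t`.
  refine ⟨(List.range (t - p.length)).map fun j => r.getD j nop, ?_⟩
  set r' := (List.range (t - p.length)).map fun j => r.getD j nop with hr'
  rw [prob_eq]
  congr 1
  have := avg_iterate (prog := p ++ r) (init := init) (res := res) hdec G (p ++ r')
    (fun σ => if σ ∈ E then (0 : ℝ) else 1) 0 (fun j hj => ?_)
    (fun v => (0, init (decide (v = s)))) (fun _ _ => rfl)
  · have hl : (p ++ r').length = t := by simp [hr']; omega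
    rw [hl] at this
    convert this using 2
    funext τ
    simp only [Set.mem_ofPred_eq]
  · rw [zero_add]
    by_cases h : j < p.length
    · rw [List.getElem_append_left h, List.getD_append _ _ _ _ h, List.getD_eq_getElem _ _ h]
    · rw [List.getElem_append_right (by omega), List.getD_append_right _ _ _ _ (by omega)]
      simp [hr']

end Truncate

/-! ### The length of the program -/

section Length

variable {c k : ℕ}

theorem length_degreeProg (N θ n : ℕ) :
    (degreeProg N θ n : List (Instr c (Node c) (Msg c k))).length = n * (N + 1) := by
  induction n with
  | zero => simp [degreeProg]
  | succ n ih =>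
    simp only [degreeProg, List.length_append, ih, List.length_replicate, List.length_singleton]
    ring

theorem length_phase (L q lam m : ℕ) :
    (phase L q lam m : List (Instr c (Node c) (Msg c k))).length = phaseLen L q lam m := by
  simp [phase]

theorem length_flood_succ (L q lam n : ℕ) :
    (flood L q lam 1 (n + 1) : List (Instr c (Node c) (Msg c k))).length =
      (flood L q lam 1 n : List (Instr c (Node c) (Msg c k))).length +
        phaseLen L q lam (n + 1) := by
  rw [flood_add, List.length_append, flood, flood, List.append_nil, length_phase, add_comm 1 n]

theorem length_flood_le (L q lam n : ℕ) :
    (flood L q lam 1 n : List (Instr c (Node c) (Msg c k))).length ≤ n * L := by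
  induction n with
  | zero => simp [flood]
  | succ n ih =>
    rw [length_flood_succ, add_mul, one_mul]
    have : phaseLen L q lam (n + 1) ≤ L := by unfold phaseLen; split_ifs <;> simp
    omega

theorem padicValNat_factorial_le (n : ℕ) : padicValNat 2 n.factorial ≤ n := by
  have := sub_one_mul_padicValNat_factorial (p := 2) n
  omega

/-- The valuations `v₂(m)` sum to `v₂(n!) ≤ n` by Legendre's formula, and the phases of full length
contribute at most `n` because only one in `2 ^ q ≥ L` phases has it. -/
theorem length_flood_le' {L q : ℕ} (hL : L ≤ 2 ^ q) (lam n : ℕ) :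
    (flood L q lam 1 n : List (Instr c (Node c) (Msg c k))).length ≤ n * (lam + 2) := by
  have key : (flood L q lam 1 n : List (Instr c (Node c) (Msg c k))).length ≤
      n / 2 ^ q * L + n * lam + padicValNat 2 n.factorial := by
    induction n with
    | zero => simp [flood]
    | succ n ih =>
      have h1 : padicValNat 2 (n + 1).factorial =
          padicValNat 2 (n + 1) + padicValNat 2 n.factorial := by
        rw [Nat.factorial_succ, padicValNat.mul (by omega) (Nat.factorial_ne_zero n)]
      rw [length_flood_succ, h1, Nat.succ_div]
      unfold phaseLen
      split_ifs with h
      · rw [add_mul, add_mul]; omega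
      · rw [add_zero, add_mul]
        have := min_le_right L (lam + padicValNat 2 (n + 1))
        omega
  have h1 := padicValNat_factorial_le n
  have h2 : n / 2 ^ q * L ≤ n :=
    (Nat.mul_le_mul_left _ hL).trans (Nat.div_mul_le_self n _)
  rw [mul_add]
  omega

theorem length_bfsDecay (L X md d l : ℕ) :
    (bfsDecay L X md d l : List (Instr c (Node c) (Msg c k))).length = L := by
  simp [bfsDecay]

theorem length_bfsLayer (N L X md d n : ℕ) :
    (bfsLayer N L X md d n : List (Instr c (Node c) (Msg c k))).length = n * (N * L) := by
  induction n with
  | zero => simp [bfsLayer]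
  | succ n ih =>
    simp only [bfsLayer, List.length_append, ih, List.length_flatten, List.map_replicate,
      List.sum_replicate, length_bfsDecay, smul_eq_mul]
    ring

theorem length_bfsProg (N L X md n : ℕ) :
    (bfsProg N L X md n : List (Instr c (Node c) (Msg c k))).length = n * (md * (N * L)) := by
  induction n with
  | zero => simp [bfsProg]
  | succ n ih =>
    simp only [bfsProg, List.length_append, ih, length_bfsLayer]
    ring

theorem length_attempt (P : Params) (lam : ℕ) :
    (attempt P lam : List (Instr c (Node c) (Msg c k))).length =
      (flood P.L P.q lam 1 P.M₁ : List (Instr c (Node c) (Msg c k))).length +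
      (flood P.L P.q lam 1 P.M₂ : List (Instr c (Node c) (Msg c k))).length +
      (flood P.L P.q lam 1 (P.J * P.X) : List (Instr c (Node c) (Msg c k))).length +
      P.X * (P.md * (P.N * P.L)) + 4 := by
  simp only [attempt, checkProg, buildProg, List.length_append, List.length_cons,
    length_bfsProg, List.length_nil]
  ring

theorem length_setupProg (P : Params) :
    (setupProg P : List (Instr c (Node c) (Msg c k))).length = P.L * (P.E + 1) + 1 := by
  simp [setupProg, length_degreeProg]

/-- A geometric sum: all trials together cost no more than one trial with the doubled parameter
would be allowed. -/
theorem length_attempts_le {P : Params} {A n : ℕ}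
    (h : ∀ i, i < n → (attempt P (2 ^ i) : List (Instr c (Node c) (Msg c k))).length ≤ A * 2 ^ i) :
    (attempts P n : List (Instr c (Node c) (Msg c k))).length ≤ A * 2 ^ n := by
  induction n with
  | zero => simp [attempts]
  | succ n ih =>
    rw [attempts, List.length_append, pow_succ, mul_two, mul_add]
    exact add_le_add (ih fun i hi => h i (by omega)) (h n (by omega))

end Length

/-! ### The delay along a shortest path -/

section Geodesic

variable {V : Type*} {G : SimpleGraph V}

theorem nodup_dist_of_shortest (hG : G.Connected) {v s : V} (p : G.Walk v s)
    (hp : p.length = G.dist v s) : (p.support.map fun x => G.dist x s).Nodup := by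
  induction p with
  | nil => simp
  | cons h p ih =>
    rename_i x y z
    have h1 : ∀ {y z : V} (p : G.Walk y z), ∀ w ∈ p.support, G.dist w z ≤ p.length := by
      intro y z p
      induction p with
      | nil => intro w hw; simp at hw; simp [hw]
      | cons h p ih =>
        intro w hw
        rw [SimpleGraph.Walk.support_cons, List.mem_cons] at hw
        rcases hw with rfl | hw
        · exact SimpleGraph.dist_le (.cons h p)
        · exact (ih w hw).trans (by simp)
    have h2 : p.length = G.dist y z := by
      refine le_antisymm ?_ (SimpleGraph.dist_le p)
      have := hG.dist_triangle (u := x) (v := y) (w := z)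
      rw [SimpleGraph.dist_eq_one_iff_adj.2 h, ← hp, SimpleGraph.Walk.length_cons] at this
      omega
    rw [SimpleGraph.Walk.support_cons, List.map_cons, List.nodup_cons]
    refine ⟨fun hmem => ?_, ih h2⟩
    obtain ⟨w, hw, hwd⟩ := List.mem_map.1 hmem
    have := h1 p w hw
    rw [SimpleGraph.Walk.length_cons] at hp
    omega

theorem dist_le_diam [Finite V] (hG : G.Connected) (u v : V) : G.dist u v ≤ G.diam := by
  have : Nonempty V := ⟨u⟩
  exact SimpleGraph.dist_le_diam (SimpleGraph.connected_iff_ediam_ne_top.1 hG)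

/-- With truncated subtraction, `2 ^ (e - lam) * 2 ^ lam` is the maximum of `2 ^ e` and `2 ^ lam`.
-/
theorem wt_mul_le (q lam e : ℕ) : wt q lam e * 2 ^ lam ≤ 2 ^ lam + 2 ^ e := by
  have h1 : wt q lam e ≤ 2 ^ (e - lam) := Nat.pow_le_pow_right (by norm_num) (by simp)
  calc _ ≤ 2 ^ (e - lam) * 2 ^ lam := Nat.mul_le_mul_right _ h1
    _ = 2 ^ max e lam := by rw [← pow_add]; congr 1; omega
    _ ≤ _ := by rcases max_cases e lam with h | h <;> rw [h.1] <;> simp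

theorem exists_cheap_walk_zero [Finite V] (hG : G.Connected) {c lam : ℕ} {s : V} {b : V → Info c} (v : V) :
    ∃ p : G.Walk s v, walkCost (fun v => wt 0 lam (b v).cls) p ≤ 769 * G.diam := by
  obtain ⟨p, hp⟩ := hG.exists_walk_length_eq_dist s v
  have h1 := dist_le_diam hG s v
  have h2 := walkCost_le (fun v => wt_le 0 lam (b v).cls) p
  exact ⟨p, by omega⟩

variable [Fintype V] [DecidableEq V] [DecidableRel G.Adj]

/-- The degrees along a shortest path. -/
theorem sum_degree_shortest_le (hG : G.Connected) {v s : V} (p : G.Walk v s)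
    (hp : p.length = G.dist v s) :
    (p.support.map fun x => G.degree x).sum ≤ 3 * Fintype.card V := by
  have hnd := nodup_dist_of_shortest hG p hp
  have hnd' := hnd.of_map
  have hinj := List.inj_on_of_nodup_map hnd
  rw [← List.sum_toFinset _ hnd']
  calc ∑ x ∈ p.support.toFinset, G.degree x
      = ∑ x ∈ p.support.toFinset, ∑ y, if G.Adj x y then 1 else 0 := by
        refine sum_congr rfl fun x _ => ?_
        rw [sum_boole, Nat.cast_id, ← SimpleGraph.card_neighborFinset_eq_degree]
        congr 1
        ext y
        simp
    _ = ∑ y, #{x ∈ p.support.toFinset | G.Adj x y} := by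
        rw [sum_comm]
        exact sum_congr rfl fun y _ => by rw [sum_boole, Nat.cast_id]
    -- Neighbours of `y` have distances to `s` within one of that of `y`, and the path contains at
    -- most one node at each distance.
    _ ≤ ∑ _y : V, 3 := by
        refine sum_le_sum fun y _ => ?_
        calc _ ≤ #(Icc (G.dist y s - 1) (G.dist y s + 1)) := by
              refine card_le_card_of_injOn (fun x => G.dist x s) (fun x hx => ?_)
                fun x hx x' hx' h => ?_
              · rw [mem_coe, mem_filter] at hx
                have h1 := hG.dist_triangle (u := x) (v := y) (w := s)
                have h2 := hG.dist_triangle (u := y) (v := x) (w := s)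
                rw [SimpleGraph.dist_eq_one_iff_adj.2 hx.2] at h1
                rw [SimpleGraph.dist_eq_one_iff_adj.2 hx.2.symm] at h2
                simp only [mem_coe, mem_Icc]
                omega
              · rw [mem_coe, mem_filter, List.mem_toFinset] at hx hx'
                exact hinj hx.1 hx'.1 h
          _ ≤ 3 := by rw [Nat.card_Icc]; omega
    _ = _ := by simp [mul_comm]

/-- Multiplied by `2 ^ lam`, a delay is at most `2 ^ lam` plus 256 times the degree. The degrees on
a shortest path sum to at most `3n ≤ 3 D 2 ^ lam`, and `769 = 1 + 3 * 256`. -/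
theorem exists_cheap_walk (hG : G.Connected) {c L q lam : ℕ} {s : V} {b : V → Info c}
    (hb : GoodInfo G s L b) (hn : Fintype.card V ≤ G.diam * 2 ^ lam) (v : V) :
    ∃ p : G.Walk s v, walkCost (fun v => wt q lam (b v).cls) p ≤ 769 * G.diam := by
  obtain ⟨p, hp⟩ := hG.exists_walk_length_eq_dist v s
  refine ⟨p.reverse, ?_⟩
  set w : V → ℕ := fun v => wt q lam (b v).cls
  have h1 : walkCost w p.reverse + w s = (p.support.map w).sum := by
    rw [walkCost_add, SimpleGraph.Walk.support_reverse, List.map_reverse, List.sum_reverse]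
  have h2 : 1 ≤ w s := wt_pos _ _ _
  have h3 : ∀ l : List V, (l.map w).sum * 2 ^ lam ≤
      l.length * 2 ^ lam + 256 * (l.map fun x => G.degree x).sum := by
    intro l
    induction l with
    | nil => simp
    | cons x l ih =>
      simp only [List.map_cons, List.sum_cons, List.length_cons, add_mul, mul_add, one_mul]
      have := wt_mul_le q lam (b x).cls
      have := hb.upper x
      have h4 : w x * 2 ^ lam = wt q lam (b x).cls * 2 ^ lam := rfl
      omega
  have h4 := h3 p.support
  rw [← h1, SimpleGraph.Walk.length_support] at h4
  have h5 := sum_degree_shortest_le hG p hp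
  have h6 := dist_le_diam hG v s
  -- The path has `length + 1` nodes; the surplus one is compensated by the delay of `s`, which the
  -- cost omits and which is at least one.
  have h7 : (walkCost w p.reverse + 1) * 2 ^ lam ≤ (769 * G.diam + 1) * 2 ^ lam := by
    calc _ ≤ (walkCost w p.reverse + w s) * 2 ^ lam := Nat.mul_le_mul_right _ (by omega)
      _ ≤ (G.diam + 1) * 2 ^ lam + 256 * (3 * (G.diam * 2 ^ lam)) :=
          h4.trans (add_le_add (Nat.mul_le_mul_right _ (by omega)) (by omega))
      _ = _ := by ring
  have := Nat.le_of_mul_le_mul_right h7 (by positivity)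
  omega

end Geodesic

/-! ### The choice of the parameters -/

section Parameters

/-- The logarithm of the largest delay. -/
def delayLog (L D : ℕ) : ℕ := if D < L ^ 5 then 0 else Nat.clog 2 L

/-- The parameters for the estimates `L` and `D`, a bound `κ` on the quality of the latter, and a
constant `B` that controls the failure probability. -/
def params (κ B L D : ℕ) : Params where
  L := L
  q := delayLog L D
  M₁ := 18 * (769 * κ * D) + 2 ^ delayLog L D + 2 ^ delayLog L D * (12 * B * L)
  M₂ := 18 * (18 * (769 * κ * D) + 2 ^ delayLog L D + 2 ^ delayLog L D * (12 * B * L) +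
    2 ^ delayLog L D) + 2 ^ delayLog L D + 2 ^ delayLog L D * (12 * B * L)
  X := 2 ^ delayLog L D * (36 * L + 1 + 12 * B * L)
  J := (18 * (18 * (769 * κ * D) + 2 ^ delayLog L D + 2 ^ delayLog L D * (12 * B * L) +
    2 ^ delayLog L D) + 2 ^ delayLog L D + 2 ^ delayLog L D * (12 * B * L)) /
      (2 ^ delayLog L D * (36 * L + 1 + 12 * B * L)) + 1
  md := 2 ^ delayLog L D * (19 + 6 * B) + 1
  N := 6 * B * L
  E := 32 * (B * L)
  θ := B * L

/-- A constant that bounds the numbers of phases. -/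
def phaseConst (κ B : ℕ) : ℕ := 18 * (13842 * κ + 1 + 12 * B) + 56 + 24 * B

variable {κ B L D : ℕ}

theorem pow_delayLog_le (hL : 1 ≤ L) : 2 ^ delayLog L D ≤ 2 * L := by
  unfold delayLog
  split_ifs
  · omega
  · rcases hL.eq_or_lt with rfl | hL
    · simp
    · have h1 := Nat.pow_pred_clog_lt_self (by norm_num : 1 < 2) hL
      have h2 := Nat.clog_pos (by norm_num : 1 < 2) hL
      obtain ⟨e, he⟩ := Nat.exists_eq_add_of_lt h2
      rw [zero_add] at he
      rw [he] at h1 ⊢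
      rw [pow_succ]
      simp at h1
      omega

theorem params_X_le (hL : 1 ≤ L) :
    (params κ B L D).X ≤ phaseConst κ B * (2 ^ delayLog L D * L) := by
  show 2 ^ delayLog L D * (36 * L + 1 + 12 * B * L) ≤ _
  unfold phaseConst
  rw [show ∀ W : ℕ, (18 * (13842 * κ + 1 + 12 * B) + 56 + 24 * B) * (W * L) =
    W * ((18 * (13842 * κ + 1 + 12 * B) + 56 + 24 * B) * L) by intro W; ring]
  refine Nat.mul_le_mul_left _ ?_
  have : 0 ≤ κ * L := Nat.zero_le _
  have : 0 ≤ B * L := Nat.zero_le _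
  nlinarith

theorem params_X_pos : 1 ≤ (params κ B L D).X := by
  show 1 ≤ 2 ^ delayLog L D * (36 * L + 1 + 12 * B * L)
  exact Nat.mul_pos (by positivity) (by omega)

theorem params_M₁_le_M₂ : (params κ B L D).M₁ ≤ (params κ B L D).M₂ := by
  simp only [params]
  generalize 18 * (769 * κ * D) = x
  generalize 2 ^ delayLog L D * (12 * B * L) = y
  generalize 2 ^ delayLog L D = W
  omega

theorem params_M₂_le_JX : (params κ B L D).M₂ ≤ (params κ B L D).J * (params κ B L D).X := by
  have h := Nat.div_add_mod (params κ B L D).M₂ (params κ B L D).X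
  have h' := Nat.mod_lt (params κ B L D).M₂ (params_X_pos (κ := κ) (B := B) (L := L) (D := D))
  have hJ : (params κ B L D).J = (params κ B L D).M₂ / (params κ B L D).X + 1 := rfl
  rw [hJ, add_mul, one_mul, mul_comm]
  omega

/-- All floods have `O(D + 2 ^ q * L)` phases, and rounding up to whole slabs adds at most `X = O(2
^ q * L)`. In `phaseConst`, `13842 = 18 * 769`. -/
theorem params_JX_le (hL : 1 ≤ L) : (params κ B L D).J * (params κ B L D).X ≤
    phaseConst κ B * (D + 2 ^ delayLog L D * L) := by
  have hJ : (params κ B L D).J = (params κ B L D).M₂ / (params κ B L D).X + 1 := rfl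
  have h1 : (params κ B L D).J * (params κ B L D).X ≤
      (params κ B L D).M₂ + (params κ B L D).X := by
    rw [hJ, add_mul, one_mul]
    exact Nat.add_le_add_right (Nat.div_mul_le_self _ _) _
  refine h1.trans ?_
  simp only [params, phaseConst]
  generalize 2 ^ delayLog L D = W
  have e1 : W ≤ W * L := Nat.le_mul_of_pos_right _ hL
  have e2 : 0 ≤ κ * (W * L) := Nat.zero_le _
  have e3 : 0 ≤ B * D := Nat.zero_le _
  nlinarith

theorem params_J_le (hL : 1 ≤ L) : (params κ B L D).J ≤
    phaseConst κ B * (D + 2 ^ delayLog L D * L) :=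
  (Nat.le_mul_of_pos_right _ params_X_pos).trans (params_JX_le hL)

theorem params_md_le : (params κ B L D).md ≤ (20 + 6 * B) * 2 ^ delayLog L D := by
  have : 1 ≤ 2 ^ delayLog L D := Nat.one_le_two_pow
  show 2 ^ delayLog L D * (19 + 6 * B) + 1 ≤ _
  nlinarith

/-- The thickness `ρ = 2 * L` makes `X / ρ`, and with it the number of residue classes, `O(2 ^ q)`;
the excess `n₀ = 12 * B * L` yields failure probabilities of `2^(-B * L)`. -/
theorem params_valid (hL : 1 ≤ L) (hB : 1 ≤ B) {k : ℕ} (hJ : (params κ B L D).J < 2 ^ k) :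
    (params κ B L D).Valid (B * L) k (12 * B * L) (2 * L) (769 * κ * D) where
  L_le := Nat.le_mul_of_pos_left L hB
  J_lt := hJ
  two_le_ρ := by omega
  two_le_X := by
    show 2 ≤ 2 ^ delayLog L D * (36 * L + 1 + 12 * B * L)
    exact le_trans (by omega) (Nat.le_mul_of_pos_left _ (by positivity))
  M₁_ge := le_rfl
  M₂_ge := le_rfl
  JX_ge := params_M₂_le_JX
  X_ge := le_of_eq (by simp only [params]; ring)
  md_ge := by
    have : 1 ≤ 2 ^ delayLog L D := Nat.one_le_two_pow
    show 2 ^ delayLog L D * (36 * L + 1 + 12 * B * L) + 1 ≤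
      (2 ^ delayLog L D * (19 + 6 * B) + 1 - 1) * (2 * L)
    rw [Nat.add_sub_cancel]
    nlinarith
  E_eq := rfl

/-- A constant that bounds the lengths of attempts. -/
def attemptConst (κ B : ℕ) : ℕ :=
  27 * phaseConst κ B + 4 * phaseConst κ B * ((20 + 6 * B) * (6 * B)) + 4

/-- A constant that bounds the number of rounds. -/
def timeConst (κ B : ℕ) : ℕ := 2 * attemptConst κ B + 32 * B + 2

/-- There are `X = O(2 ^ q * L)` distances, `md = O(2 ^ q)` residue classes, and `O(L)` repetitions
of `L` rounds. With `2 ^ q ≤ 2 * L` this is `O(L ^ 5)`, the source of the threshold in `delayLog`.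
-/
theorem length_bfs_le (hL : 1 ≤ L) :
    (params κ B L D).X * ((params κ B L D).md * ((params κ B L D).N * L)) ≤
      phaseConst κ B * ((20 + 6 * B) * (6 * B)) * (2 ^ delayLog L D * 2 ^ delayLog L D * L ^ 3) := by
  calc _ ≤ (phaseConst κ B * (2 ^ delayLog L D * L)) * (((20 + 6 * B) * 2 ^ delayLog L D) *
        (6 * B * L * L)) :=
        Nat.mul_le_mul (params_X_le hL) (Nat.mul_le_mul params_md_le le_rfl)
    _ = _ := by ring

variable {c k : ℕ}

theorem length_attempt_small (hL : 1 ≤ L) (hD : D < L ^ 5) (lam : ℕ) :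
    (attempt (params κ B L D) lam : List (Instr c (Node c) (Msg c k))).length ≤
      attemptConst κ B * (D * L + L ^ 3) := by
  have hq : delayLog L D = 0 := if_pos hD
  have h1 := length_flood_le (c := c) (k := k) L (params κ B L D).q lam (params κ B L D).M₁
  have h2 := length_flood_le (c := c) (k := k) L (params κ B L D).q lam (params κ B L D).M₂
  have h3 := length_flood_le (c := c) (k := k) L (params κ B L D).q lam
    ((params κ B L D).J * (params κ B L D).X)
  have h4 := params_JX_le (κ := κ) (B := B) (D := D) hL
  have h5 := Nat.mul_le_mul_right L (params_M₁_le_M₂ (κ := κ) (B := B) (L := L) (D := D))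
  have h6 := Nat.mul_le_mul_right L (params_M₂_le_JX (κ := κ) (B := B) (L := L) (D := D))
  have h7 := Nat.mul_le_mul_right L h4
  have h8 := length_bfs_le (κ := κ) (B := B) (D := D) hL
  rw [hq] at h7 h8
  rw [length_attempt]
  have h9 : L ^ 2 ≤ L ^ 3 := Nat.pow_le_pow_right hL (by norm_num)
  have h10 : 1 ≤ L ^ 3 := Nat.one_le_pow _ _ hL
  have e1 : phaseConst κ B * (D + 2 ^ 0 * L) * L ≤ phaseConst κ B * (D * L + L ^ 3) := by
    calc _ = phaseConst κ B * (D * L + L ^ 2) := by ring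
      _ ≤ _ := by gcongr
  have e2 : phaseConst κ B * ((20 + 6 * B) * (6 * B)) * (2 ^ 0 * 2 ^ 0 * L ^ 3) ≤
      phaseConst κ B * ((20 + 6 * B) * (6 * B)) * (D * L + L ^ 3) := by
    refine Nat.mul_le_mul_left _ ?_
    omega
  have hPL : (params κ B L D).L = L := rfl
  rw [hPL]
  calc _ ≤ 3 * (phaseConst κ B * (D * L + L ^ 3)) +
        phaseConst κ B * ((20 + 6 * B) * (6 * B)) * (D * L + L ^ 3) + 4 * (D * L + L ^ 3) := by
        omega
    _ = (3 * phaseConst κ B + phaseConst κ B * ((20 + 6 * B) * (6 * B)) + 4) *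
        (D * L + L ^ 3) := by ring
    _ ≤ _ := by
        refine Nat.mul_le_mul_right _ ?_
        unfold attemptConst
        rw [mul_assoc 4]
        omega

/-- Since `D ≥ L ^ 5`, both the searches and the additive `2 ^ q * L` phases are absorbed in `O(D)`,
and phases have average length at most `lam + 2`. -/
theorem length_attempt_large (hL : 1 ≤ L) (hD : L ^ 5 ≤ D) {lam : ℕ} (hlam : 1 ≤ lam) :
    (attempt (params κ B L D) lam : List (Instr c (Node c) (Msg c k))).length ≤
      attemptConst κ B * D * lam := by
  have hq : L ≤ 2 ^ (params κ B L D).q := by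
    show L ≤ 2 ^ delayLog L D
    rw [delayLog, if_neg (by omega)]
    exact Nat.le_pow_clog (by norm_num) L
  have hW : 2 ^ delayLog L D ≤ 2 * L := pow_delayLog_le hL
  have h1 := length_flood_le' (c := c) (k := k) hq lam (params κ B L D).M₁
  have h2 := length_flood_le' (c := c) (k := k) hq lam (params κ B L D).M₂
  have h3 := length_flood_le' (c := c) (k := k) hq lam
    ((params κ B L D).J * (params κ B L D).X)
  have h4 := params_JX_le (κ := κ) (B := B) (D := D) hL
  have h5 := Nat.mul_le_mul_right (lam + 2)
    (params_M₁_le_M₂ (κ := κ) (B := B) (L := L) (D := D))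
  have h6 := Nat.mul_le_mul_right (lam + 2)
    (params_M₂_le_JX (κ := κ) (B := B) (L := L) (D := D))
  have h7 := Nat.mul_le_mul_right (lam + 2) h4
  have h8 := length_bfs_le (κ := κ) (B := B) (D := D) hL
  have hL2 : L * L ≤ D := by
    calc L * L = L ^ 2 := by ring
      _ ≤ L ^ 5 := Nat.pow_le_pow_right hL (by norm_num)
      _ ≤ D := hD
  have hD1 : 1 ≤ D := le_trans (Nat.one_le_pow _ _ hL) hD
  have e1 : phaseConst κ B * (D + 2 ^ delayLog L D * L) * (lam + 2) ≤
      9 * phaseConst κ B * D * lam := by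
    have : D + 2 ^ delayLog L D * L ≤ 3 * D := by
      have := Nat.mul_le_mul_right L hW
      rw [mul_assoc] at this
      omega
    calc _ ≤ phaseConst κ B * (3 * D) * (3 * lam) :=
          Nat.mul_le_mul (Nat.mul_le_mul_left _ this) (by omega)
      _ = _ := by ring
  have e2 : phaseConst κ B * ((20 + 6 * B) * (6 * B)) *
      (2 ^ delayLog L D * 2 ^ delayLog L D * L ^ 3) ≤
      4 * phaseConst κ B * ((20 + 6 * B) * (6 * B)) * D * lam := by
    have : 2 ^ delayLog L D * 2 ^ delayLog L D * L ^ 3 ≤ 4 * D := by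
      calc _ ≤ (2 * L) * (2 * L) * L ^ 3 := by gcongr
        _ = 4 * L ^ 5 := by ring
        _ ≤ _ := by omega
    calc _ ≤ phaseConst κ B * ((20 + 6 * B) * (6 * B)) * (4 * D) * 1 := by
          rw [mul_one]; exact Nat.mul_le_mul_left _ this
      _ ≤ phaseConst κ B * ((20 + 6 * B) * (6 * B)) * (4 * D) * lam :=
          Nat.mul_le_mul_left _ hlam
      _ = _ := by ring
  have e3 : 1 ≤ D * lam := Nat.mul_pos hD1 hlam
  rw [length_attempt]
  have hPL : (params κ B L D).L = L := rfl
  rw [hPL]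
  calc _ ≤ 3 * (9 * phaseConst κ B * D * lam) +
        4 * phaseConst κ B * ((20 + 6 * B) * (6 * B)) * D * lam + 4 * (D * lam) := by
        omega
    _ = _ := by unfold attemptConst; ring

theorem length_setup_le (hL : 1 ≤ L) :
    (setupProg (params κ B L D) : List (Instr c (Node c) (Msg c k))).length ≤
      (32 * B + 2) * L ^ 3 := by
  rw [length_setupProg]
  show L * (32 * (B * L) + 1) + 1 ≤ _
  calc _ ≤ L * (32 * (B * L) + L) + L * L := by
        have : 1 ≤ L * L := Nat.mul_pos hL hL
        gcongr
    _ = (32 * B + 2) * L ^ 2 := by ring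
    _ ≤ _ := Nat.mul_le_mul_left _ (Nat.pow_le_pow_right hL (by norm_num))

theorem length_main_small (hL : 1 ≤ L) (hD : D < L ^ 5) :
    (setupProg (params κ B L D) ++ attempts (params κ B L D) 1 :
      List (Instr c (Node c) (Msg c k))).length ≤ timeConst κ B * (D * L + L ^ 3) := by
  have h1 := length_attempt_small (κ := κ) (B := B) (c := c) (k := k) hL hD (2 ^ 0)
  have h2 := length_setup_le (κ := κ) (B := B) (D := D) (c := c) (k := k) hL
  rw [attempts, attempts, List.nil_append, List.length_append]
  calc _ ≤ (32 * B + 2) * (D * L + L ^ 3) + attemptConst κ B * (D * L + L ^ 3) :=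
        add_le_add (h2.trans (Nat.mul_le_mul_left _ (by omega))) h1
    _ = (attemptConst κ B + 32 * B + 2) * (D * L + L ^ 3) := by ring
    _ ≤ _ := Nat.mul_le_mul_right _ (by unfold timeConst; omega)

theorem length_main_large (hL : 1 ≤ L) (hD : L ^ 5 ≤ D) (n : ℕ) :
    (setupProg (params κ B L D) ++ attempts (params κ B L D) (n + 1) :
      List (Instr c (Node c) (Msg c k))).length ≤ timeConst κ B * (D * 2 ^ n + L ^ 3) := by
  have h1 := length_attempts_le (c := c) (k := k) (P := params κ B L D) (n := n + 1)
    fun i _ => length_attempt_large (κ := κ) (B := B) (c := c) (k := k) hL hD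
      (Nat.one_le_two_pow (n := i))
  have h2 := length_setup_le (κ := κ) (B := B) (D := D) (c := c) (k := k) hL
  rw [List.length_append]
  calc _ ≤ (32 * B + 2) * (D * 2 ^ n + L ^ 3) + attemptConst κ B * D * 2 ^ (n + 1) :=
        add_le_add (h2.trans (Nat.mul_le_mul_left _ (by omega))) h1
    _ = (32 * B + 2) * (D * 2 ^ n + L ^ 3) + 2 * attemptConst κ B * (D * 2 ^ n) := by ring
    _ ≤ (32 * B + 2) * (D * 2 ^ n + L ^ 3) + 2 * attemptConst κ B * (D * 2 ^ n + L ^ 3) := by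
        gcongr
        omega
    _ = _ := by unfold timeConst; ring

theorem params_depth_le (hL : 1 ≤ L) :
    (params κ B L D).J * ((params κ B L D).X + 1) + (params κ B L D).X ≤
      9 * phaseConst κ B * (D + L) := by
  have h1 := params_JX_le (κ := κ) (B := B) (D := D) hL
  have h2 := params_J_le (κ := κ) (B := B) (D := D) hL
  have h3 := params_X_le (κ := κ) (B := B) (D := D) hL
  have h4 : phaseConst κ B * (2 ^ delayLog L D * L) ≤
      phaseConst κ B * (D + 2 ^ delayLog L D * L) := Nat.mul_le_mul_left _ (by omega)
  have h5 : D + 2 ^ delayLog L D * L ≤ 3 * (D + L) := by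
    by_cases hD : D < L ^ 5
    · rw [delayLog, if_pos hD]
      omega
    · have hW := Nat.mul_le_mul_right L (pow_delayLog_le (D := D) hL)
      have hL2 : L * L ≤ D := by
        calc L * L = L ^ 2 := by ring
          _ ≤ L ^ 5 := Nat.pow_le_pow_right hL (by norm_num)
          _ ≤ D := by omega
      rw [mul_assoc] at hW
      omega
  calc _ = (params κ B L D).J * (params κ B L D).X + (params κ B L D).J +
        (params κ B L D).X := by ring
    _ ≤ 3 * (phaseConst κ B * (D + 2 ^ delayLog L D * L)) := by omega
    _ ≤ 3 * (phaseConst κ B * (3 * (D + L))) := by gcongr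
    _ = _ := by ring

end Parameters

/-! ### The failure probability -/

section Error

variable {κ B L D : ℕ}

/-- A constant that bounds the failure probability. -/
def errorConst (κ B : ℕ) : ℕ :=
  4 + phaseConst κ B * (κ + 2) + 4 * phaseConst κ B ^ 2 * (20 + 6 * B) * (κ + 2)

theorem phases_le {y : ℕ} (hL : 1 ≤ L) (hLy : L ≤ y) (hD : D ≤ κ * y) :
    phaseConst κ B * (D + 2 ^ delayLog L D * L) ≤ phaseConst κ B * (κ + 2) * y ^ 2 := by
  rw [mul_assoc]
  refine Nat.mul_le_mul_left _ ?_
  have hy : 1 ≤ y := hL.trans hLy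
  calc D + 2 ^ delayLog L D * L ≤ κ * y + (2 * y) * y :=
        add_le_add hD (Nat.mul_le_mul ((pow_delayLog_le hL).trans (by omega)) hLy)
    _ ≤ κ * y ^ 2 + 2 * y * y := by
        gcongr
        exact Nat.le_self_pow (by norm_num) y
    _ = _ := by ring

theorem attemptError_le {y n : ℕ} (hL : 1 ≤ L) (hLy : L ≤ y) (hn : n ≤ y) (hD : D ≤ κ * y) :
    attemptError (params κ B L D) n (12 * B * L) ≤
      (2 * y ^ 6 + phaseConst κ B * (κ + 2) * y ^ 6 +
        4 * phaseConst κ B ^ 2 * (20 + 6 * B) * (κ + 2) * y ^ 6) * 2⁻¹ ^ (B * L) := by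
  have hy : (1 : ℝ) ≤ y := by exact_mod_cast hL.trans hLy
  -- Because `(16/17)^12 ≤ 1/2`; likewise `(7/8)^6 ≤ 1/2` below.
  have h1 : (16 / 17 : ℝ) ^ (12 * B * L) ≤ 2⁻¹ ^ (B * L) := by
    rw [mul_assoc, pow_mul]
    exact pow_le_pow_left₀ (by norm_num) (by norm_num) _
  have h2 : (7 / 8 : ℝ) ^ (6 * B * L) ≤ 2⁻¹ ^ (B * L) := by
    rw [mul_assoc, pow_mul]
    exact pow_le_pow_left₀ (by norm_num) (by norm_num) _
  have hJ : ((params κ B L D).J : ℝ) ≤ phaseConst κ B * (κ + 2) * y ^ 2 := by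
    exact_mod_cast (params_J_le hL).trans (phases_le hL hLy hD)
  have hW : 2 ^ delayLog L D ≤ 2 * y := (pow_delayLog_le hL).trans (by omega)
  have hX : ((params κ B L D).X : ℝ) ≤ phaseConst κ B * (2 * y * y) := by
    exact_mod_cast (params_X_le hL).trans (Nat.mul_le_mul_left _ (Nat.mul_le_mul hW hLy))
  have hmd : ((params κ B L D).md : ℝ) ≤ (20 + 6 * B) * (2 * y) := by
    exact_mod_cast params_md_le.trans (Nat.mul_le_mul_left _ hW)
  have hn' : (n : ℝ) ≤ y := by exact_mod_cast hn
  have hN : (params κ B L D).N = 6 * B * L := rfl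
  unfold attemptError buildError
  rw [hN]
  set ε : ℝ := 2⁻¹ ^ (B * L)
  have hε : 0 ≤ ε := by positivity
  calc _ ≤ (y * ε : ℝ) + (y * ε + (phaseConst κ B * (κ + 2) * y ^ 2) * (y * y) * ε +
        (phaseConst κ B * (2 * y * y)) * (((20 + 6 * B) * (2 * y)) *
          (y * (phaseConst κ B * (κ + 2) * y ^ 2) * ε))) := by
        gcongr
    _ = (2 * y ^ 1 + phaseConst κ B * (κ + 2) * y ^ 4 +
        4 * phaseConst κ B ^ 2 * (20 + 6 * B) * (κ + 2) * y ^ 6) * ε := by ring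
    _ ≤ _ := by
        gcongr <;> norm_num

theorem totalError_le {y n m : ℕ} (hL : 1 ≤ L) (hLy : L + 1 ≤ y) (hn : n ≤ y) (hD : D ≤ κ * y)
    (hm : m ≤ L) :
    (n : ℝ) ^ 2 * 2⁻¹ ^ (B * L) + L * (n * 2⁻¹ ^ (B * L)) +
        (m + 1) * attemptError (params κ B L D) n (12 * B * L) ≤
      errorConst κ B * y ^ 7 * 2⁻¹ ^ (B * L) := by
  have hy : (1 : ℝ) ≤ y := by exact_mod_cast (by omega : 1 ≤ y)
  have h1 := attemptError_le (B := B) hL (by omega) hn hD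
  have hn' : (n : ℝ) ≤ y := by exact_mod_cast hn
  have hL' : (L : ℝ) ≤ y := by exact_mod_cast (by omega : L ≤ y)
  have hm' : (m : ℝ) + 1 ≤ y := by exact_mod_cast (by omega : m + 1 ≤ y)
  have h0 := attemptError_nonneg (params κ B L D) n (12 * B * L)
  set ε : ℝ := 2⁻¹ ^ (B * L)
  have hε : 0 ≤ ε := by positivity
  calc _ ≤ (y : ℝ) ^ 2 * ε + y * (y * ε) + y * ((2 * y ^ 6 + phaseConst κ B * (κ + 2) * y ^ 6 +
        4 * phaseConst κ B ^ 2 * (20 + 6 * B) * (κ + 2) * y ^ 6) * ε) := by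
        gcongr
    _ = (2 * y ^ 2 + (2 + phaseConst κ B * (κ + 2) +
        4 * phaseConst κ B ^ 2 * (20 + 6 * B) * (κ + 2)) * y ^ 7) * ε := by ring
    _ ≤ (2 * y ^ 7 + (2 + phaseConst κ B * (κ + 2) +
        4 * phaseConst κ B ^ 2 * (20 + 6 * B) * (κ + 2)) * y ^ 7) * ε := by
        gcongr
        norm_num
    _ = _ := by
        unfold errorConst
        push_cast
        ring

/-- The constant `B` can be chosen such that the failure probability is small. -/
theorem exists_errorConst_le (κ β : ℕ) :
    ∃ B, 7 + β ≤ B ∧ errorConst κ B * 2 ^ (7 + β) ≤ 2 ^ B := by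
  -- As `phaseConst` is linear in `B`, `errorConst` grows only like `B ^ 3`, so `2 ^ B` overtakes
  -- it.
  set C : ℕ := 4 + (18 * 13842 * κ + 400) * (κ + 2) +
    4 * (18 * 13842 * κ + 400) ^ 2 * 26 * (κ + 2) with hC
  have h1 : ∀ B, 1 ≤ B → errorConst κ B ≤ C * B ^ 3 := by
    intro B hB
    have hp : phaseConst κ B ≤ (18 * 13842 * κ + 400) * B := by
      unfold phaseConst
      have : κ * 1 ≤ κ * B := Nat.mul_le_mul_left κ hB
      nlinarith
    have hB3 : B ≤ B ^ 3 := Nat.le_self_pow (by norm_num) B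
    have hB1 : 1 ≤ B ^ 3 := Nat.one_le_pow _ _ hB
    calc errorConst κ B ≤ 4 * B ^ 3 + ((18 * 13842 * κ + 400) * B) * (κ + 2) +
          4 * ((18 * 13842 * κ + 400) * B) ^ 2 * (26 * B) * (κ + 2) := by
          unfold errorConst
          gcongr
          · omega
          · omega
      _ = 4 * B ^ 3 + (18 * 13842 * κ + 400) * (κ + 2) * B +
          4 * (18 * 13842 * κ + 400) ^ 2 * 26 * (κ + 2) * B ^ 3 := by ring
      _ ≤ 4 * B ^ 3 + (18 * 13842 * κ + 400) * (κ + 2) * B ^ 3 +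
          4 * (18 * 13842 * κ + 400) ^ 2 * 26 * (κ + 2) * B ^ 3 := by gcongr
      _ = C * B ^ 3 := by rw [hC]; ring
  have hC0 : 0 < C := by rw [hC]; positivity
  clear_value C
  have hlim := tendsto_pow_const_div_const_pow_of_one_lt 3 (by norm_num : (1 : ℝ) < 2)
  have hpos : (0 : ℝ) < 1 / (C * 2 ^ (7 + β)) := by
    positivity
  obtain ⟨B, hB1, hB2, hB3⟩ := ((hlim.eventually (gt_mem_nhds hpos)).and
    ((Filter.eventually_ge_atTop 1).and (Filter.eventually_ge_atTop (7 + β)))).exists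
  refine ⟨B, hB3, ?_⟩
  have h2 : ((C * B ^ 3 * 2 ^ (7 + β) : ℕ) : ℝ) ≤ 2 ^ B := by
    rw [div_lt_div_iff₀ (by positivity) (by positivity)] at hB1
    push_cast
    nlinarith
  exact (Nat.mul_le_mul_right _ (h1 B hB2)).trans (by exact_mod_cast h2)

theorem errorConst_mul_le {β : ℕ} (hL : 1 ≤ L) (hB : 7 + β ≤ B)
    (h : errorConst κ B * 2 ^ (7 + β) ≤ 2 ^ B) :
    errorConst κ B * (2 ^ L) ^ 7 * (2 ^ L) ^ β ≤ 2 ^ (B * L) := by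
  obtain ⟨e, rfl⟩ := Nat.exists_eq_add_of_le hB
  obtain ⟨l, rfl⟩ := Nat.exists_eq_add_of_le hL
  calc _ = errorConst κ (7 + β + e) * 2 ^ (7 + β) * 2 ^ ((7 + β) * l) := by ring
    _ ≤ 2 ^ (7 + β + e) * 2 ^ ((7 + β) * l) := Nat.mul_le_mul_right _ h
    _ ≤ 2 ^ (7 + β + e) * 2 ^ ((7 + β) * l + e * l) :=
        Nat.mul_le_mul_left _ (Nat.pow_le_pow_right (by norm_num) (by omega))
    _ = _ := by ring

end Error

/-! ### Logarithms -/

section Logarithms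

/-- The first sufficient attempt does not come too late. -/
theorem exists_attempt {n D L : ℕ} (hD : 1 ≤ D) (hDn : D ≤ n) (hn : n ≤ 2 ^ L) :
    ∃ k, k ≤ L ∧ n ≤ D * 2 ^ 2 ^ k ∧ (2 : ℝ) ^ k ≤ 2 * (1 + Real.logb 2 (n / D)) := by
  classical
  have hex : ∃ k, n ≤ D * 2 ^ 2 ^ k := ⟨L, by
    calc n ≤ 1 * 2 ^ L := by omega
      _ ≤ D * 2 ^ 2 ^ L := Nat.mul_le_mul hD
          (Nat.pow_le_pow_right (by norm_num) Nat.lt_two_pow_self.le)⟩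
  have hD0 : (0 : ℝ) < D := by exact_mod_cast hD
  have hlog : 0 ≤ Real.logb 2 (n / D) := Real.logb_nonneg (by norm_num) (by
    rw [le_div_iff₀ hD0, one_mul]; exact_mod_cast hDn)
  -- For the least sufficient exponent the preceding one is too small, so doubling overshoots `log
  -- (n / D)` by a factor of at most two.
  refine ⟨Nat.find hex, Nat.find_min' hex ?_, Nat.find_spec hex, ?_⟩
  · calc n ≤ 1 * 2 ^ L := by omega
      _ ≤ D * 2 ^ 2 ^ L := Nat.mul_le_mul hD
          (Nat.pow_le_pow_right (by norm_num) Nat.lt_two_pow_self.le)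
  · rcases hk : Nat.find hex with _ | k
    · simp; linarith
    · have h1 := Nat.find_min hex (m := k) (by omega)
      push Not at h1
      have h2 : ((2 : ℝ) ^ k) ≤ Real.logb 2 (n / D) := by
        rw [Real.le_logb_iff_rpow_le (by norm_num) (div_pos (by
          exact_mod_cast (by omega : 0 < n)) hD0), le_div_iff₀ hD0, mul_comm]
        have : ((2 : ℝ) ^ ((2 : ℝ) ^ k)) = (2 : ℝ) ^ (2 ^ k : ℕ) := by
          simpa using Real.rpow_natCast (2 : ℝ) (2 ^ k)
        rw [this]
        exact_mod_cast h1.le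
      rw [pow_succ]
      linarith

/-- If `D` is at most polylogarithmic, then `log n` and `log (n / D)` agree up to constants. -/
theorem logb_le_of_small {κ : ℝ} (hκ : 1 ≤ κ) {K n D L : ℕ} (hD : 1 ≤ D) (hDn : D ≤ n)
    (hL1 : 1 ≤ L) (hDL : D ≤ K * L ^ 5) (hL : (L : ℝ) ≤ κ * Real.logb 2 n) :
    Real.logb 2 n ≤ (2 + 2 * Real.logb 2 K + 20 * Real.log (20 * κ)) *
      (1 + Real.logb 2 (n / D)) := by
  have hD0 : (0 : ℝ) < D := by exact_mod_cast hD
  have hn0 : (0 : ℝ) < n := by exact_mod_cast (by omega : 0 < n)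
  have hL0 : (0 : ℝ) < L := by exact_mod_cast hL1
  have hK1 : 1 ≤ K := by
    by_contra! hK
    rw [Nat.lt_one_iff] at hK
    simp [hK] at hDL
    omega
  have hK0 : (1 : ℝ) ≤ K := by exact_mod_cast hK1
  have hlog : 0 ≤ Real.logb 2 (n / D) := Real.logb_nonneg (by norm_num) (by
    rw [le_div_iff₀ hD0, one_mul]; exact_mod_cast hDn)
  have hlogK : 0 ≤ Real.logb 2 (K : ℝ) := Real.logb_nonneg (by norm_num) hK0
  have hlogκ : 0 ≤ Real.log (20 * κ) := Real.log_nonneg (by linarith)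
  have h1 : Real.logb 2 (n / D) = Real.logb 2 n - Real.logb 2 D :=
    Real.logb_div hn0.ne' hD0.ne'
  have h2 : Real.logb 2 D ≤ Real.logb 2 K + 5 * Real.logb 2 L := by
    calc Real.logb 2 D ≤ Real.logb 2 (K * L ^ 5) :=
          Real.logb_le_logb_of_le (by norm_num) hD0 (by exact_mod_cast hDL)
      _ = _ := by
          rw [Real.logb_mul (by positivity) (by positivity), Real.logb_pow]
          norm_num
  have h3 : Real.logb 2 L ≤ 2 * Real.log L := by
    have hl2 : (1 : ℝ) / 2 ≤ Real.log 2 := by have := Real.log_two_gt_d9; linarith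
    have hlL : 0 ≤ Real.log (L : ℝ) := Real.log_nonneg (by exact_mod_cast hL1)
    rw [Real.logb, div_le_iff₀ (by linarith)]
    nlinarith
  -- Tangent bound for the logarithm, scaled so that `5 * logb 2 L` amounts to at most half of `logb
  -- 2 n` plus a constant; that half is moved to the left side.
  have h4 : Real.log L ≤ L / (20 * κ) + Real.log (20 * κ) := by
    have := Real.log_le_sub_one_of_pos (x := (L : ℝ) / (20 * κ)) (by positivity)
    rw [Real.log_div hL0.ne' (by positivity)] at this
    linarith
  have h5 : (L : ℝ) / (20 * κ) ≤ Real.logb 2 n / 20 := by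
    rw [div_le_div_iff₀ (by positivity) (by norm_num)]
    nlinarith
  have h6 : Real.logb 2 n ≤ 2 * Real.logb 2 (n / D) + (2 * Real.logb 2 K +
      20 * Real.log (20 * κ)) := by linarith
  nlinarith [mul_nonneg hlogK hlog, mul_nonneg hlogκ hlog]

end Logarithms

/-! ### Packets -/

section Encoding

theorem exists_packet_encoding {c k b : ℕ} (h : c + k ≤ b) :
    ∃ (enc : Msg c k → BitString b) (dec : BitString b → Option (Msg c k)),
      ∀ m, dec (enc m) = some m := by
  classical
  have e : Msg c k ≃ (Fin (c + k) → Bool) := Fintype.equivOfCardEq (by simp [pow_add])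
  set enc : Msg c k → BitString b := fun m => ⟨List.ofFn (e m), by simpa using h⟩ with henc
  have hinj : Function.Injective enc := fun m m' hm =>
    e.injective (List.ofFn_injective (congrArg Subtype.val hm))
  refine ⟨enc, fun x => if h : ∃ m, enc m = x then some h.choose else none, fun m => ?_⟩
  have hex : ∃ m', enc m' = enc m := ⟨m, rfl⟩
  dsimp only
  rw [dif_pos hex, hinj hex.choose_spec]

theorem exists_identifier_encoding {c b : ℕ} (h : c ≤ b) :
    ∃ enc : (Fin c → Bool) → BitString b, Function.Injective enc :=
  ⟨fun x => ⟨List.ofFn x, by simpa using h⟩, fun _ _ hx =>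
    List.ofFn_injective (congrArg Subtype.val hx)⟩

theorem isDistributedLayering_mono {V : Type*} {b C : ℕ} {G : SimpleGraph V} {s : V} {x y : ℝ}
    {o : V → LayerOutput b C} (h : IsDistributedLayering G s x o) (hxy : x ≤ y) :
    IsDistributedLayering G s y o :=
  ⟨h.id_injective, h.layering, h.source, h.parent, h.collisionFree, h.depth_le.trans hxy⟩

end Encoding

/-! ### The protocol -/

section Protocol

variable {V : Type*} [Fintype V] {G : SimpleGraph V}

theorem diam_lt_card (hG : G.Connected) : G.diam < Fintype.card V := by
  have := hG.nonempty
  obtain ⟨u, v, huv⟩ := G.exists_dist_eq_diam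
  obtain ⟨p, hp, hl⟩ := hG.exists_path_of_dist u v
  rw [← huv, ← hl]
  exact hp.length_lt

theorem one_le_degree [Nontrivial V] [DecidableRel G.Adj] (hG : G.Connected) (v : V) :
    1 ≤ G.degree v :=
  hG.preconnected.degree_pos_of_nontrivial v

/-- The protocol constructs a layering in the time that is needed for a sufficient attempt. -/
theorem le_prob_protocol [Nontrivial V] (hG : G.Connected) (s : V) {κ β B L D T : ℕ} {x : ℝ}
    (hL : 1 ≤ L) (hcard : Fintype.card V ≤ 2 ^ L) (hD1 : G.diam ≤ κ * D) (hD2 : D ≤ κ * G.diam)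
    (hB : 7 + β ≤ B) (hB' : errorConst κ B * 2 ^ (7 + β) ≤ 2 ^ B)
    (hsmall : D < L ^ 5 → timeConst κ B * (D * L + L ^ 3) ≤ T)
    (hlarge : L ^ 5 ≤ D → ∃ n, n ≤ L ∧ Fintype.card V ≤ G.diam * 2 ^ 2 ^ n ∧
      timeConst κ B * (D * 2 ^ n + L ^ 3) ≤ T)
    (hx : ((9 * phaseConst κ B * (D + L) : ℕ) : ℝ) ≤ x)
    {b : ℕ} {enc : Msg (B * L) (B * L) → BitString b}
    {dec : BitString b → Option (Msg (B * L) (B * L))} (hdec : ∀ m, dec (enc m) = some m)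
    {idEnc : (Fin (B * L) → Bool) → BitString b} (hid : Function.Injective idEnc) :
    1 - (((2 : ℝ) ^ L) ^ β)⁻¹ ≤
      (toProtocol (mainProg (params κ B L D)) initNode
        (Node.result (params κ B L D).X idEnc) enc dec).prob G s T
        {σ | (fun v => (σ v).2) ∈ {τ : V → Node (B * L) | ∃ o : V → LayerOutput b 6,
          (∀ v, (τ v).result (params κ B L D).X idEnc = some (o v)) ∧
          IsDistributedLayering G s x o}} := by
  classical
  set P := params κ B L D with hP
  have hPL : P.L = L := rfl
  have hLy : L + 1 ≤ 2 ^ L := Nat.lt_two_pow_self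
  have hDy : D ≤ κ * 2 ^ L :=
    hD2.trans (Nat.mul_le_mul_left _ ((diam_lt_card hG).le.trans hcard))
  have herr := errorConst_mul_le (κ := κ) hL hB hB'
  -- Slab indices fit into the `B * L` bits that a packet reserves for them.
  have hJ : P.J < 2 ^ (B * L) := by
    have hy : 0 < (2 ^ L) ^ 2 := by positivity
    calc P.J ≤ phaseConst κ B * (κ + 2) * (2 ^ L) ^ 2 :=
          (params_J_le hL).trans (phases_le hL (by omega) hDy)
      _ < errorConst κ B * (2 ^ L) ^ 2 := by
          refine Nat.mul_lt_mul_of_pos_right ?_ hy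
          unfold errorConst
          omega
      _ ≤ errorConst κ B * (2 ^ L) ^ 7 * 1 := by
          rw [mul_one]
          exact Nat.mul_le_mul_left _ (Nat.pow_le_pow_right (by positivity) (by norm_num))
      _ ≤ errorConst κ B * (2 ^ L) ^ 7 * (2 ^ L) ^ β :=
          Nat.mul_le_mul_left _ (Nat.one_le_pow _ _ (by positivity))
      _ ≤ _ := herr
  have hvalid := params_valid (κ := κ) (D := D) hL (by omega : 1 ≤ B) hJ
  obtain ⟨n, hnL, hwalk, hlen⟩ : ∃ n, n ≤ L ∧
      (∀ b : V → Info (B * L), GoodInfo G s P.L b → ∀ v, ∃ p : G.Walk s v,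
        walkCost (fun v => wt P.q (2 ^ n) (b v).cls) p ≤ 769 * κ * D) ∧
      (setupProg P ++ attempts P (n + 1) :
        List (Instr (B * L) (Node (B * L)) (Msg (B * L) (B * L)))).length ≤ T := by
    have hle : 769 * G.diam ≤ 769 * κ * D := by
      rw [mul_assoc]
      exact Nat.mul_le_mul_left _ hD1
    by_cases hD : D < L ^ 5
    -- With `q = 0` all delays are one, so already the first value of `lam` succeeds.
    · refine ⟨0, Nat.zero_le _, fun b _ v => ?_, (length_main_small hL hD).trans (hsmall hD)⟩
      have hq : P.q = 0 := if_pos hD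
      rw [hq]
      obtain ⟨p, hp⟩ := exists_cheap_walk_zero hG (lam := 2 ^ 0) (s := s) (b := b) v
      exact ⟨p, hp.trans hle⟩
    · obtain ⟨n, hnL, hn, hT⟩ := hlarge (not_lt.1 hD)
      refine ⟨n, hnL, fun b hb v => ?_, (length_main_large hL (not_lt.1 hD) n).trans hT⟩
      obtain ⟨p, hp⟩ := exists_cheap_walk hG (q := P.q) hb hn v
      exact ⟨p, hp.trans hle⟩
  -- The protocol itself does not depend on `n`; only the analysis splits the program after the
  -- first trial known to suffice.
  obtain ⟨r, hr⟩ := attempts_eq_append (c := B * L) (k := B * L) P (Nat.succ_le_succ hnL)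
  have hmain : (mainProg P : List (Instr (B * L) (Node (B * L)) (Msg (B * L) (B * L)))) =
      (setupProg P ++ attempts P (n + 1)) ++ r := by
    rw [mainProg, hPL, hr, List.append_assoc]
  rw [hmain]
  obtain ⟨r', hr'⟩ := exists_prob_toProtocol (r := r) (init := initNode)
    (res := Node.result P.X idEnc) hdec G s hlen
    {τ : V → Node (B * L) | ∃ o : V → LayerOutput b 6,
      (∀ v, (τ v).result P.X idEnc = some (o v)) ∧ IsDistributedLayering G s x o}
  rw [hr']
  have hdone : (fun s : Node (B * L) => (s.result P.X idEnc).isSome) = Node.done :=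
    funext fun s => s.isSome_result _ _
  rw [hdone]
  refine sub_le_sub_left (le_trans (gex_mainProg_le hvalid hG hcard (one_le_degree hG) hwalk r'
    (fun σ => by split_ifs <;> norm_num) fun σ hσ => ?_) ?_) 1
  · rw [if_pos]
    obtain ⟨b', τ, hb, ⟨t, ht, hτ⟩, rfl⟩ := hσ
    obtain ⟨o, ho, hlay⟩ := hτ.isDistributedLayering hG ht hvalid.two_le_ρ hvalid.two_le_X hb.inj
      hid
    refine ⟨o, ho, isDistributedLayering_mono hlay (le_trans ?_ hx)⟩
    exact_mod_cast params_depth_le hL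
  · refine (totalError_le hL hLy hcard hDy hnL).trans ?_
    have h1 : ((errorConst κ B * (2 ^ L) ^ 7 * (2 ^ L) ^ β : ℕ) : ℝ) ≤ (2 ^ (B * L) : ℕ) := by
      exact_mod_cast herr
    push_cast at h1 ⊢
    rw [inv_pow, ← div_eq_mul_inv, div_le_iff₀ (by positivity), ← div_eq_inv_mul,
      le_div_iff₀ (by positivity)]
    exact h1

end Protocol

end RadioLayering

/-! ### Assembly: real constants and the final estimates -/

theorem mainTheorem2 :
    ∃ C : ℕ, ∀ κ β : ℝ, 1 ≤ κ → 2 ≤ β →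
      ∃ (K : ℕ) (a : ℝ) (A : (L Dapx : ℕ) → RadioProtocol (K * L) (LayerOutput (K * L) C)),
        ∀ (V : Type*) [Fintype V] (G : SimpleGraph V) (s : V) (L Dapx : ℕ),
          G.Connected →
          Real.logb 2 (Fintype.card V) ≤ L → (L : ℝ) ≤ κ * Real.logb 2 (Fintype.card V) →
          (G.diam : ℝ) ≤ κ * Dapx → (Dapx : ℝ) ≤ κ * G.diam →
          1 - (Fintype.card V : ℝ) ^ (-β) ≤
            (A L Dapx).prob G s
              ⌊a * (G.diam * (1 + Real.logb 2 (Fintype.card V / G.diam))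
                + Real.logb 2 (Fintype.card V) ^ 3)⌋₊
              { σ | ∃ o : V → LayerOutput (K * L) C,
                  (∀ v, (A L Dapx).out (σ v) = some (o v)) ∧
                  IsDistributedLayering G s
                    (a * (G.diam + Real.logb 2 (Fintype.card V))) o } := by
  refine ⟨6, fun κ β hκ hβ => ?_⟩
  -- The parameters of the program are natural numbers, so `κ` and `β` are rounded up.
  obtain ⟨k, hk⟩ := exists_nat_ge κ
  obtain ⟨β', hβ'⟩ := exists_nat_ge β
  obtain ⟨B, hB1, hB2⟩ := RadioLayering.exists_errorConst_le k β'
  choose enc dec hdec using fun L : ℕ => RadioLayering.exists_packet_encoding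
    (c := B * L) (k := B * L) (b := 2 * B * L) (le_of_eq (by ring))
  choose idEnc hid using fun L : ℕ => RadioLayering.exists_identifier_encoding
    (c := B * L) (b := 2 * B * L) (Nat.mul_le_mul_right _ (by omega))
  set C₁ : ℝ := 2 + 2 * Real.logb 2 k + 20 * Real.log (20 * κ) with hC₁
  set tc : ℝ := ((RadioLayering.timeConst k B : ℕ) : ℝ) with htc
  set pc : ℝ := 9 * ((RadioLayering.phaseConst k B : ℕ) : ℝ) with hpc
  have hk1 : (1 : ℝ) ≤ k := hκ.trans hk
  have hκ0 : 0 ≤ κ := by linarith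
  have hC₁0 : 0 ≤ C₁ := by
    have h1 : 0 ≤ Real.logb 2 (k : ℝ) := Real.logb_nonneg (by norm_num) hk1
    have h2 : 0 ≤ Real.log (20 * κ) := Real.log_nonneg (by linarith)
    positivity
  have htc0 : 0 ≤ tc := Nat.cast_nonneg _
  have hpc0 : 0 ≤ pc := by positivity
  -- A packet holds `B * L` bits of identifier and `B * L` bits of slab index. The first summand of
  -- the constant bounds the rounds: small `D`, large `D` and `L ^ 3` in this order; the second
  -- bounds the depth.
  refine ⟨2 * B, tc * (k * κ * C₁ + 2 * k + κ ^ 3) + pc * (k + κ), fun L D =>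
    RadioLayering.toProtocol (RadioLayering.mainProg (RadioLayering.params k B L D))
      RadioLayering.initNode
      (RadioLayering.Node.result (RadioLayering.params k B L D).X (idEnc L)) (enc L) (dec L), ?_⟩
  intro V _ G s L D hG hnL hLn hD1 hD2
  set a : ℝ := tc * (k * κ * C₁ + 2 * k + κ ^ 3) + pc * (k + κ) with ha
  -- For a single node the required probability is `1 - 1 = 0`, so nothing has to be computed; this
  -- also disposes of the diameter zero.
  rcases (Nat.succ_le_of_lt (Fintype.card_pos_iff.2 ⟨s⟩)).eq_or_lt with hn | hn
  · rw [← hn, Nat.cast_one, Real.one_rpow, sub_self]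
    exact div_nonneg (Nat.cast_nonneg _) (Nat.cast_nonneg _)
  have : Nontrivial V := Fintype.one_lt_card_iff_nontrivial.1 hn
  set n := Fintype.card V with hndef
  set ℓ := Real.logb 2 n with hℓ
  have hn0 : (0 : ℝ) < n := by exact_mod_cast (by omega : 0 < n)
  have hℓ1 : 1 ≤ ℓ := by
    rw [hℓ, Real.le_logb_iff_rpow_le (by norm_num) hn0, Real.rpow_one]
    exact_mod_cast hn
  have hL1 : 1 ≤ L := by exact_mod_cast hℓ1.trans hnL
  have hcard : n ≤ 2 ^ L := by
    rw [hℓ, Real.logb_le_iff_le_rpow (by norm_num) hn0, Real.rpow_natCast] at hnL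
    exact_mod_cast hnL
  have hdiam : 1 ≤ G.diam := Nat.one_le_iff_ne_zero.2 (SimpleGraph.connected_iff_diam_ne_zero.1 hG)
  have hdn : G.diam ≤ n := (RadioLayering.diam_lt_card hG).le
  have hdiam0 : (0 : ℝ) < G.diam := by exact_mod_cast hdiam
  have hD1' : G.diam ≤ k * D := by
    have : (G.diam : ℝ) ≤ k * D := hD1.trans (mul_le_mul_of_nonneg_right hk (Nat.cast_nonneg _))
    exact_mod_cast this
  have hD2r : (D : ℝ) ≤ k * G.diam :=
    hD2.trans (mul_le_mul_of_nonneg_right hk (Nat.cast_nonneg _))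
  have hD2' : D ≤ k * G.diam := by exact_mod_cast hD2r
  set Λ := 1 + Real.logb 2 (n / G.diam) with hΛ
  have hΛ1 : 1 ≤ Λ := by
    have : 0 ≤ Real.logb 2 ((n : ℝ) / G.diam) := Real.logb_nonneg (by norm_num) (by
      rw [le_div_iff₀ hdiam0, one_mul]; exact_mod_cast hdn)
    linarith
  have hL3 : (L : ℝ) ^ 3 ≤ κ ^ 3 * ℓ ^ 3 := by
    rw [← mul_pow]
    exact pow_le_pow_left₀ (Nat.cast_nonneg _) hLn 3
  have hDΛ : 0 ≤ G.diam * Λ := by positivity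
  have hℓ3 : 0 ≤ ℓ ^ 3 := by positivity
  have hkκ : 0 ≤ k * κ * C₁ := by positivity
  have hk0 : (0 : ℝ) ≤ k := Nat.cast_nonneg _
  have hκ3 : 0 ≤ κ ^ 3 := by positivity
  -- Here `y` is the leading term of the running time, `D * L` in the regime of small `D` and `D * 2
  -- ^ m` in the other.
  have hmain : ∀ y : ℝ, y ≤ k * κ * C₁ * (G.diam * Λ) ∨ y ≤ 2 * k * (G.diam * Λ) →
      tc * (y + L ^ 3) ≤ a * (G.diam * Λ + ℓ ^ 3) := by
    intro y hy
    have hy' : y ≤ (k * κ * C₁ + 2 * k) * (G.diam * Λ) := by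
      have h1 := mul_nonneg hkκ hDΛ
      have h2 := mul_nonneg hk0 hDΛ
      rcases hy with hy | hy <;> linarith
    calc tc * (y + L ^ 3) ≤ tc * ((k * κ * C₁ + 2 * k) * (G.diam * Λ) + κ ^ 3 * ℓ ^ 3) := by
          gcongr
      _ ≤ tc * ((k * κ * C₁ + 2 * k + κ ^ 3) * (G.diam * Λ + ℓ ^ 3)) := by
          gcongr
          have h1 := mul_nonneg hkκ hℓ3
          have h2 := mul_nonneg hk0 hℓ3
          have h3 := mul_nonneg hκ3 hDΛ
          linarith
      _ ≤ _ := by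
          rw [ha, ← mul_assoc, add_mul (tc * _)]
          exact le_add_of_nonneg_right (by positivity)
  have hprob : (n : ℝ) ^ (-β) ≥ (((2 : ℝ) ^ L) ^ β')⁻¹ := by
    rw [Real.rpow_neg hn0.le]
    refine inv_anti₀ (by positivity) ?_
    calc (n : ℝ) ^ β ≤ (n : ℝ) ^ (β' : ℝ) :=
          Real.rpow_le_rpow_of_exponent_le (by exact_mod_cast hn.le) hβ'
      _ = (n : ℝ) ^ β' := Real.rpow_natCast _ _
      _ ≤ _ := pow_le_pow_left₀ hn0.le (by exact_mod_cast hcard) _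
  refine le_trans (sub_le_sub_left hprob 1) (RadioLayering.le_prob_protocol hG s hL1 hcard hD1'
    hD2' hB1 hB2 (fun hD => ?_) (fun hD => ?_) ?_ (hdec L) (hid L))
  · refine Nat.le_floor ?_
    push_cast
    refine hmain _ (Or.inl ?_)
    have hlog := RadioLayering.logb_le_of_small hκ (K := k) hdiam hdn hL1
      (hD1'.trans (Nat.mul_le_mul_left _ hD.le)) hLn
    calc (D : ℝ) * L ≤ (k * G.diam) * (κ * ℓ) := by gcongr
      _ ≤ (k * G.diam) * (κ * (C₁ * Λ)) := by gcongr
      _ = _ := by ring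
  · obtain ⟨m, hm1, hm2, hm3⟩ := RadioLayering.exists_attempt hdiam hdn hcard
    refine ⟨m, hm1, hm2, Nat.le_floor ?_⟩
    push_cast
    refine hmain _ (Or.inr ?_)
    calc (D : ℝ) * 2 ^ m ≤ (k * G.diam) * (2 * Λ) := by gcongr
      _ = _ := by ring
  · push_cast
    calc pc * (D + L) ≤ pc * (k * G.diam + κ * ℓ) := by gcongr
      _ ≤ pc * ((k + κ) * (G.diam + ℓ)) := by
          gcongr
          have h1 : 0 ≤ k * ℓ := by positivity
          have h2 : 0 ≤ κ * G.diam := by positivity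
          linarith
      _ ≤ _ := by
          rw [ha, ← mul_assoc, add_mul (tc * _)]
          exact le_add_of_nonneg_left (by positivity)
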